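/- **Setting.** Let $N\ge 1$. Phase space is $\mathbb R^{2N}$ with canonical variables $(x_j,y_j)_{j\in\mathbb Z/N}$, sites $0,\dots,N-1$, and Poisson bracket $\{f,g\}=\sum_j(\partial_{x_j}f\,\partial_{y_j}g-\partial_{y_j}f\,\partial_{x_j}g)$. Let $\tau$ be the cyclic shift $(\tau f)(x,y)=f(\tau x,\tau y)$, $(\tau x)_j=x_{j+1}$, and $f^{\oplus}=\sum_{l=1}^N\tau^lf$ the cyclically symmetric function with seed $f$. For a polynomial $f$ let $\|f\|_1$ be the sum of the absolute values of its coefficients in the complex canonical variables $x_j=\frac1{\sqrt2}(\xi_j+i\eta_j)$, $y_j=\frac i{\sqrt2}(\xi_j-i\eta_j)$. A homogeneous polynomial seed $f$ of degree $d$ is of class $\mathcal D(C,\sigma)$, $C,\sigma>0$, if $f=\sum_{m\ge0}f^{(m)}$ with $f^{(m)}$ homogeneous of degree $d$, depending only on the variables at sites $0,\dots,m$, and $\|f^{(m)}\|_1\le Ce^{-\sigma m}$. For a sequence $\mathcal X=\{\mathcal X_1,\dots,\mathcal X_r\}$ (with $\mathcal X_j=0$ for $j>r$) put $L_{\mathcal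 X_j}=\{\mathcal X_j,\cdot\}$, $E_0=D_0=\mathrm{Id}$, $E_s=\sum_{j=1}^s\frac js L_{\mathcal X_j}E_{s-j}$, $D_s=-\sum_{j=1}^s\frac js D_{s-j}L_{\mathcal X_j}$, $T_{\mathcal X}=\sum_{s\ge0}E_s$, $T_{\mathcal X}^{-1}=\sum_{s\ge0}D_s$; applied to the coordinate functions these series define maps $z\mapsto T_{\mathcal X}(z)$, $z\mapsto T^{-1}_{\mathcal X}(z)$. $B_\rho$ is the open ball of radius $\rho$ about $0$ in $\mathbb R^{2N}$, for the norm $\|\cdot\|$ which is either the $\ell^2$ norm (total energy) or the $\ell^\infty$ norm (specific energy) of $(x,y)$. **Theorem.** Let $\Omega,\mu>0$, $\sigma_0=-\ln(2\mu)$, and $\max(\ln 4,\sigma_0/4)\le\sigma_*<\sigma_1<\sigma_0$ (for instance $\sigma_1=\sigma_0/2$). Consider $H=H_\Omega+Z_0+H_1=h_\Omega^\oplus+\zeta_0^\oplus+h_1^\oplus$ with $h_\Omega=\frac\Omega2(x_0^2+y_0^2)$, $\zeta_0$ quadratic of class $\mathcal D(C_{\zeta_0},\sigma_0)$ with $\zeta_0^{(0)}=0$,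 $\{H_\Omega,Z_0\}=0$, and $h_1$ quartic of class $\mathcal D(C_{h_1},\sigma_1)$. Define, independently of $N$, $$E_{0*}=\frac{\min(\sigma_0-\sigma_1,\sigma_1-\sigma_*)}{\sigma_0-\sigma_*},\qquad \Lambda=(1-e^{-\sigma_0})(1-e^{-(\sigma_0-\sigma_*)})E_{0*},\qquad \mu_*=\frac{\Omega\Lambda}{8C_{\zeta_0}e^{\sigma_1}}>0,$$ and, for each positive integer $r<\frac12\,\mu_*/\mu$, $$\gamma=2\Omega\Bigl(1-\frac{r\mu}{\mu_*}\Bigr)\in(\Omega,2\Omega),\quad C_*=\frac{C_{h_1}}{\gamma\Lambda}>0,\quad C_r=64r^2C_*,\quad \tilde C_r=96r^2C_*,\quad \sigma_j=\sigma_1-\tfrac{j-1}r(\sigma_1-\sigma_*).$$ Then for every such $r$ there is a finite generating sequence $\mathcal X=\{\chi_1^\oplus,\dots,\chi_r^\oplus\}$, with $\chi_s$ homogeneous of degree $2s+2$, such that, degree by degree, $T_{\mathcal X}H^{(r)}=H$ with $$H^{(r)}=H_\Omega+Z_0+\dots+Z_r+P^{(r+1)},\qquad \{H_\Omega,Z_s\}=0\quad(0\le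 s\le r),$$ where $Z_s=\zeta_s^\oplus$ is homogeneous of degree $2s+2$ and $P^{(r+1)}=\sum_{s\ge r+1}H^{(r)}_s$ with $H^{(r)}_s=(h^{(r)}_s)^\oplus$ homogeneous of degree $2s+2$. Moreover: (i) for $1\le s\le r$, $\chi_s$ is of class $\mathcal D\bigl(C_r^{s-1}\frac{C_{h_1}}{\gamma s},\sigma_s\bigr)$; (ii) for $1\le s\le r$, $\zeta_s$ is of class $\mathcal D\bigl(C_r^{s-1}\frac{C_{h_1}}{s},\sigma_s\bigr)$; (iii) if $\sigma_*=\sigma_0/4$, $R>0$ and $R^2<\frac{2}{3(1+e)C_r}$, then for either norm the series for $T_{\mathcal X}(z)$ and $T_{\mathcal X}^{-1}(z)$ converge on $B_{\frac23R}$ and define there injective analytic canonical (symplectic) maps, inverse to each other (wherever the image point lies again in $B_{\frac23R}$), with $$B_{R/3}\subset T_{\mathcal X}B_{\frac23R}\subset B_R,\qquad B_{R/3}\subset T^{-1}_{\mathcal X}B_{\frac23R}\subset B_R,$$ $$\|T_{\mathcal X}(z)-z\|\le4^4C_*R^3,\qquad \|T_{\mathcal X}^{-1}(z)-z\|\le4^4C_*R^3\qquad(z\in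 B_{\frac23R});$$ (iv) if $\sigma_*=\sigma_0/4$, the seeds $h^{(r)}_s$, $s\ge r+1$, are of class $\mathcal D(2\tilde C_r^{s-1}C_{h_1},\sigma_*)$; and under the condition on $R$ in (iii) the series $P^{(r+1)}=\sum_{s\ge r+1}H^{(r)}_s$ converges on $B_{\frac23R}$ to an analytic function, $H\circ T_{\mathcal X}^{-1}=H^{(r)}$ on $B_{\frac23R}$, and $H^{(r)}(T_{\mathcal X}(z))=H(z)$ whenever $z,T_{\mathcal X}(z)\in B_{\frac23R}$. -/

import Mathlib

open MvPolynomial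

/-- Canonical variables of a ring of `N` sites: `Sum.inl j` labels the position `x_j`,
`Sum.inr j` labels the momentum `y_j`; the sites are `0, …, N-1`, added modulo `N`. -/
abbrev Var (N : ℕ) : Type := Fin N ⊕ Fin N

/-- Real polynomials in the canonical variables. -/
abbrev PhasePoly (N : ℕ) : Type := MvPolynomial (Var N) ℝ

/-- The site at which a variable lives. -/
def site {N : ℕ} : Var N → Fin N := Sum.elim id id

/-- `shiftBy l f = τ^l f`, i.e. `f` with `x_j, y_j` replaced by `x_{j+l}, y_{j+l}`. -/
noncomputable def shiftBy {N : ℕ} (l : Fin N) (f : PhasePoly N) : PhasePoly N :=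
  rename (Sum.map (fun j => j + l) (fun j => j + l)) f

/-- The cyclically symmetric polynomial `f^⊕ = ∑_l τ^l f` generated by the seed `f`. -/
noncomputable def oplus {N : ℕ} (f : PhasePoly N) : PhasePoly N := ∑ l : Fin N, shiftBy l f

/-- The canonical Poisson bracket. -/
noncomputable def poisson {N : ℕ} (f g : PhasePoly N) : PhasePoly N :=
  ∑ j : Fin N, (pderiv (Sum.inl j) f * pderiv (Sum.inr j) g
    - pderiv (Sum.inr j) f * pderiv (Sum.inl j) g)

/-- `f` written in the complex canonical variables `(ξ, η)`, where
`x_j = (ξ_j + i η_j) / √2` and `y_j = i (ξ_j - i η_j) / √2`. -/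
noncomputable def toComplexVars {N : ℕ} (f : PhasePoly N) : MvPolynomial (Var N) ℂ :=
  aeval (Sum.elim
    (fun j => C ((1 / Real.sqrt 2 : ℝ) : ℂ) * (X (Sum.inl j) + C Complex.I * X (Sum.inr j)))
    (fun j => C (Complex.I * ((1 / Real.sqrt 2 : ℝ) : ℂ)) *
      (X (Sum.inl j) - C Complex.I * X (Sum.inr j)))) f

/-- The polynomial norm (with unit radius): the sum of the absolute values of the coefficients,
taken in the complex canonical variables. -/
noncomputable def polyNorm {N : ℕ} (f : PhasePoly N) : ℝ :=
  ∑ k ∈ (toComplexVars f).support, ‖(toComplexVars f).coeff k‖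

/-- `F` decomposes the homogeneous seed `f` of degree `d` as `f = ∑_{m ≥ 0} F m`, where `F m`
involves only the sites `0, …, m` and has norm at most `C e^{-σ m}`. -/
structure IsDecayDecomposition {N : ℕ} (d : ℕ) (f : PhasePoly N) (C σ : ℝ) (F : ℕ → PhasePoly N) :
    Prop where
  C_pos : 0 < C
  σ_pos : 0 < σ
  homogeneous : ∀ m, (F m).IsHomogeneous d
  range : ∀ m, ∀ v ∈ (F m).vars, (site v : ℕ) ≤ m
  decay : ∀ m, polyNorm (F m) ≤ C * Real.exp (-σ * m)
  sum : ∀ k, HasSum (fun m => (F m).coeff k) (f.coeff k)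

/-- The homogeneous seed `f` of degree `d` is of class `𝒟(C, σ)`. -/
def IsClassD {N : ℕ} (d : ℕ) (f : PhasePoly N) (C σ : ℝ) : Prop :=
  ∃ F : ℕ → PhasePoly N, IsDecayDecomposition d f C σ F

/-- `f` is of class `𝒟(C, σ)` with a decomposition whose term of range zero vanishes. -/
def IsClassDZero {N : ℕ} (d : ℕ) (f : PhasePoly N) (C σ : ℝ) : Prop :=
  ∃ F : ℕ → PhasePoly N, IsDecayDecomposition d f C σ F ∧ F 0 = 0

/-- The operators `E_s` of the Lie transform with generating sequence `𝒳 1, 𝒳 2, …`: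
`E_0 = 1`, `E_s = ∑_{j=1}^{s} (j/s) {𝒳_j, E_{s-j} ·}` (the summation index is `j - 1`). -/
noncomputable def lieE {N : ℕ} (𝒳 : ℕ → PhasePoly N) : ℕ → PhasePoly N → PhasePoly N
  | 0, f => f
  | s + 1, f => ∑ j : Fin (s + 1),
      (((j : ℕ) + 1 : ℝ) / ((s : ℝ) + 1)) • poisson (𝒳 (j + 1)) (lieE 𝒳 (s - j) f)
  termination_by s => s
  decreasing_by omega

/-- The operators `D_s` of the inverse of the Lie transform:
`D_0 = 1`, `D_s = -∑_{j=1}^{s} (j/s) D_{s-j} {𝒳_j, ·}` (the summation index is `j - 1`). -/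
noncomputable def lieD {N : ℕ} (𝒳 : ℕ → PhasePoly N) : ℕ → PhasePoly N → PhasePoly N
  | 0, f => f
  | s + 1, f => -∑ j : Fin (s + 1),
      (((j : ℕ) + 1 : ℝ) / ((s : ℝ) + 1)) • lieD 𝒳 (s - j) (poisson (𝒳 (j + 1)) f)
  termination_by s => s
  decreasing_by omega

/-- `h_Ω = (Ω/2) (x_0² + y_0²)`. -/
noncomputable def hOmega (N : ℕ) [NeZero N] (Ω : ℝ) : PhasePoly N :=
  C (Ω / 2) * (X (Sum.inl 0) ^ 2 + X (Sum.inr 0) ^ 2)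

/-- The homogeneous parts, of degree `2s+2`, of `H = h_Ω^⊕ + ζ₀^⊕ + h₁^⊕`. -/
noncomputable def hamTerm {N : ℕ} [NeZero N] (Ω : ℝ) (ζ₀ h₁ : PhasePoly N) : ℕ → PhasePoly N
  | 0 => oplus (hOmega N Ω) + oplus ζ₀
  | 1 => oplus h₁
  | _ + 2 => 0

/-- The homogeneous parts, of degree `2s+2`, of
`H_Ω + Z_0 + … + Z_r + P`, with `Z_s = (ζ s)^⊕` and `P = ∑_{s > r} (h s)^⊕`. -/
noncomputable def normalFormTerm {N : ℕ} [NeZero N] (Ω : ℝ) (r : ℕ) (ζ h : ℕ → PhasePoly N)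
    (s : ℕ) : PhasePoly N :=
  (if s = 0 then oplus (hOmega N Ω) else 0) + (if s ≤ r then oplus (ζ s) else oplus (h s))

/-! Explicit constants. -/

/-- `σ_0 = -ln(2μ)`. -/
noncomputable def sigmaZero (μ : ℝ) : ℝ := -Real.log (2 * μ)

/-- `E_{0*} = min(σ_0 - σ_1, σ_1 - σ_*) / (σ_0 - σ_*)`. -/
noncomputable def EStar (μ σ₁ σs : ℝ) : ℝ :=
  min (sigmaZero μ - σ₁) (σ₁ - σs) / (sigmaZero μ - σs)

/-- `(1 - e^{-σ_0}) (1 - e^{-(σ_0 - σ_*)}) E_{0*}`. -/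
noncomputable def lossFactor (μ σ₁ σs : ℝ) : ℝ :=
  (1 - Real.exp (-sigmaZero μ)) * (1 - Real.exp (-(sigmaZero μ - σs))) * EStar μ σ₁ σs

/-- The threshold `μ_*`. -/
noncomputable def muStar (Ω Cζ μ σ₁ σs : ℝ) : ℝ :=
  Ω * lossFactor μ σ₁ σs / (8 * Cζ * Real.exp σ₁)

/-- `γ = 2 Ω (1 - r μ / μ_*)`. -/
noncomputable def gammaConst (Ω Cζ μ σ₁ σs : ℝ) (r : ℕ) : ℝ :=
  2 * Ω * (1 - r * μ / muStar Ω Cζ μ σ₁ σs)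

/-- `C_* = C_{h_1} / (γ (1 - e^{-σ_0}) (1 - e^{-(σ_0 - σ_*)}) E_{0*})`. -/
noncomputable def CStar (Ω Cζ Ch μ σ₁ σs : ℝ) (r : ℕ) : ℝ :=
  Ch / (gammaConst Ω Cζ μ σ₁ σs r * lossFactor μ σ₁ σs)

/-- `σ_j = σ_1 - ((j-1)/r) (σ_1 - σ_*)`. -/
noncomputable def sigmaSeq (σ₁ σs : ℝ) (r j : ℕ) : ℝ :=
  σ₁ - ((j : ℝ) - 1) / r * (σ₁ - σs)

/-- The phase space with the `ℓ^p` norm (used for `p = 2` and `p = ∞`). -/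
abbrev Phase (N : ℕ) (p : ENNReal) : Type := PiLp p (fun _ : Var N => ℝ)

/-- Evaluation of a polynomial at a phase point. -/
noncomputable def evalAt {N : ℕ} {p : ENNReal} (z : Phase N p) (f : PhasePoly N) : ℝ :=
  eval (fun v => z v) f

/-- The standard symplectic form. -/
noncomputable def symplecticForm {N : ℕ} {p : ENNReal} (u v : Phase N p) : ℝ :=
  ∑ j : Fin N, (u (Sum.inl j) * v (Sum.inr j) - u (Sum.inr j) * v (Sum.inl j))

/-- `T` is an analytic canonical transformation of `U` onto `T '' U`. -/
structure IsAnalyticCanonicalOn {N : ℕ} {p : ENNReal} [Fact (1 ≤ p)]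
    (T : Phase N p → Phase N p) (U : Set (Phase N p)) : Prop where
  analytic : AnalyticOnNhd ℝ T U
  injOn : Set.InjOn T U
  symplectic : ∀ z ∈ U, ∀ u v : Phase N p,
    symplecticForm (fderiv ℝ T z u) (fderiv ℝ T z v) = symplecticForm u v

/-!
The Hamiltonian is normalized by successive homological equations, with all sizes measured on
seeds.

*Seeds.* The key estimate is `polyNorm_poisson_oplus_le`, in its local form
`sum_polyNorm_poisson_shiftBy_le`: when `f` and all the translates of `g` are bracketed, a given
pair of variables meets for a single translation, so that the bracket of two cyclically symmetric
functions is bounded by `d d' ‖f‖ ‖g‖` independently of `N`. If both seeds decay exponentially, so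
does a suitable seed of the bracket, with the slower of the two rates; the convolution of the
exponentials costs `1 / (1 - e^{-δ})`, where `δ` is the difference of the rates
(`DecayingSeed.exists_poisson`).

*Homological equation.* In the complex variables `{H_Ω, ·}` is diagonal, and on polynomials of even
degree its nonzero eigenvalues have modulus at least `2Ω`. Since `ζ₀` has no piece of range zero,
the equation `Z + {χ, H_Ω + Z₀} = Ψ` is triangular with respect to the range and can be solved
piece by piece. Its solution is a perturbation of that for `H_Ω` alone, so the divisor `2Ω`
decreases to `γ`, and no decay is lost because `ζ₀` decays faster than `Ψ`
(`DecayingSeed.exists_homological`).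

*Normal form.* With `H₀ = H_Ω + Z₀`, the terms of the transformed Hamiltonian are
`D_s H₀ + D_{s-1} H₁`, because the families `E` and `D` are inverse to each other
(`sum_lieE_lieD`). The `s`-th of these involves `χ_s` only through `-{χ_s, H₀}`, so `χ_s` and `ζ_s`
are found from the `s`-th homological equation (`NormalizedTo.exists_succ`). The bounds follow from
a recursive estimate of `D_k` and `E_k` on any scale of sizes (`IsSizeBound.apply_lieD`,
`IsSizeBound.apply_lieE`). It is used with slowly decreasing rates up to order `r`, with the fixed
rate `σ_*` for the remainder, and with the plain polynomial norm for the convergence of the series.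

*Convergence.* A homogeneous polynomial of degree `d` is bounded by `‖f‖ ‖z‖^d`, and a cyclically
covariant vector field satisfies the same bound in both norms (`norm_toLp_evalAt_le`). Hence the
series converge like geometric series. Multiplicativity of `E` and `D` turns into the exchange
theorem `IsLieSeries.hasSum_evalAt`, which gives both `T ∘ S = id` and `H ∘ S = H^{(r)}`, and the
preservation of brackets shows that the Jacobian matrix is symplectic
(`IsLieSeries.seriesJacobian_mem_symplecticGroup`).
-/

open Finset.HasAntidiagonal (antidiagonal mem_antidiagonal)

/-! ### The coefficient norm of complex polynomials -/

/-- The sum of the absolute values of the coefficients of a complex polynomial. -/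
noncomputable def coeffNorm {σ : Type*} (P : MvPolynomial σ ℂ) : ℝ :=
  ∑ k ∈ P.support, ‖P.coeff k‖

section coeffNorm
variable {σ τ : Type*}

lemma coeffNorm_eq_sum (P : MvPolynomial σ ℂ) {T : Finset (σ →₀ ℕ)} (hT : P.support ⊆ T) :
    coeffNorm P = ∑ k ∈ T, ‖P.coeff k‖ := by
  refine Finset.sum_subset hT fun k _ hk => ?_
  rw [notMem_support_iff.mp hk, norm_zero]

lemma coeffNorm_nonneg (P : MvPolynomial σ ℂ) : 0 ≤ coeffNorm P :=
  Finset.sum_nonneg fun _ _ => norm_nonneg _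

@[simp] lemma coeffNorm_zero : coeffNorm (0 : MvPolynomial σ ℂ) = 0 := by simp [coeffNorm]

lemma coeffNorm_monomial (k : σ →₀ ℕ) (c : ℂ) : coeffNorm (monomial k c) = ‖c‖ := by
  classical
  rw [coeffNorm_eq_sum (T := {k}) _ support_monomial_subset]
  simp

lemma norm_coeff_le_coeffNorm (P : MvPolynomial σ ℂ) (k : σ →₀ ℕ) : ‖P.coeff k‖ ≤ coeffNorm P := by
  classical
  rw [coeffNorm_eq_sum P (Finset.subset_insert k P.support)]
  exact Finset.single_le_sum (f := fun k => ‖P.coeff k‖) (fun _ _ => norm_nonneg _)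
    (Finset.mem_insert_self _ _)

lemma coeffNorm_add_le (P Q : MvPolynomial σ ℂ) :
    coeffNorm (P + Q) ≤ coeffNorm P + coeffNorm Q := by
  classical
  rw [coeffNorm_eq_sum (P + Q) support_add,
    coeffNorm_eq_sum P (Finset.subset_union_left (s₂ := Q.support)),
    coeffNorm_eq_sum Q (Finset.subset_union_right (s₁ := P.support)), ← Finset.sum_add_distrib]
  exact Finset.sum_le_sum fun k _ => by simpa using norm_add_le _ _

lemma coeffNorm_sum_le {ι : Type*} (s : Finset ι) (P : ι → MvPolynomial σ ℂ) :
    coeffNorm (∑ i ∈ s, P i) ≤ ∑ i ∈ s, coeffNorm (P i) := by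
  classical
  induction s using Finset.induction_on with
  | empty => simp
  | insert a s ha ih =>
    rw [Finset.sum_insert ha, Finset.sum_insert ha]
    exact (coeffNorm_add_le _ _).trans (by gcongr)

lemma coeffNorm_C_mul (c : ℂ) (P : MvPolynomial σ ℂ) :
    coeffNorm (C c * P) = ‖c‖ * coeffNorm P := by
  classical
  rw [coeffNorm_eq_sum (C c * P) (T := P.support), coeffNorm, Finset.mul_sum]
  · simp
  · intro k hk
    rw [mem_support_iff, coeff_C_mul] at hk
    exact mem_support_iff.mpr (right_ne_zero_of_mul hk)

lemma coeffNorm_neg (P : MvPolynomial σ ℂ) : coeffNorm (-P) = coeffNorm P := by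
  have := coeffNorm_C_mul (-1) P
  simpa using this

lemma coeffNorm_sub_le (P Q : MvPolynomial σ ℂ) :
    coeffNorm (P - Q) ≤ coeffNorm P + coeffNorm Q := by
  rw [sub_eq_add_neg, ← coeffNorm_neg Q]
  exact coeffNorm_add_le _ _

lemma coeffNorm_mul_le (P Q : MvPolynomial σ ℂ) :
    coeffNorm (P * Q) ≤ coeffNorm P * coeffNorm Q := by
  classical
  conv_lhs => rw [P.as_sum, Q.as_sum, Finset.sum_mul_sum]
  refine (coeffNorm_sum_le _ _).trans ?_
  rw [coeffNorm, coeffNorm, Finset.sum_mul_sum]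
  refine Finset.sum_le_sum fun k _ => (coeffNorm_sum_le _ _).trans ?_
  refine Finset.sum_le_sum fun l _ => ?_
  rw [monomial_mul, coeffNorm_monomial, norm_mul]

lemma coeffNorm_rename {f : σ → τ} (hf : Function.Injective f) (P : MvPolynomial σ ℂ) :
    coeffNorm (rename f P) = coeffNorm P := by
  classical
  rw [coeffNorm, support_rename_of_injective hf,
    Finset.sum_image (fun _ _ _ _ h => Finsupp.mapDomain_injective hf h)]
  exact Finset.sum_congr rfl fun k _ => by rw [coeff_rename_mapDomain f hf]

/-- Each monomial of degree `d` contributes `d` times to the derivatives, counted with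
multiplicity. -/
lemma sum_coeffNorm_pderiv_le [Fintype σ] {P : MvPolynomial σ ℂ} {d : ℕ}
    (hP : P.IsHomogeneous d) : ∑ v, coeffNorm (pderiv v P) ≤ d * coeffNorm P := by
  classical
  have h1 : ∀ v, coeffNorm (pderiv v P) ≤ ∑ k ∈ P.support, ‖P.coeff k‖ * (k v : ℝ) := by
    intro v
    conv_lhs => rw [P.as_sum, map_sum]
    refine (coeffNorm_sum_le _ _).trans (Finset.sum_le_sum fun k _ => ?_)
    rw [pderiv_monomial, coeffNorm_monomial, norm_mul]
    simp
  refine (Finset.sum_le_sum fun v _ => h1 v).trans ?_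
  rw [Finset.sum_comm, coeffNorm, Finset.mul_sum]
  refine Finset.sum_le_sum fun k hk => ?_
  rw [← Finset.mul_sum, mul_comm]
  have : k.degree = d := by
    by_contra h
    exact mem_support_iff.mp hk (hP.coeff_eq_zero h)
  rw [← this, Finsupp.degree_eq_sum]
  push_cast
  rfl

end coeffNorm

/-! ### Shifts, the Poisson bracket and complex variables -/

section bracket
variable {N : ℕ}

/-- The Hamiltonian derivation `{h, ·}`. -/
noncomputable def poissonD (h : PhasePoly N) :
    Derivation ℝ (PhasePoly N) (PhasePoly N) :=
  ∑ j : Fin N, (pderiv (Sum.inl j) h • pderiv (Sum.inr j)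
    - pderiv (Sum.inr j) h • pderiv (Sum.inl j))

lemma poissonD_apply (h f : PhasePoly N) : poissonD h f = poisson h f := by
  simp only [poissonD, poisson]
  rw [← Derivation.coeFnAddMonoidHom_apply, map_sum, Finset.sum_apply]
  simp

lemma poisson_add_right (h f g : PhasePoly N) :
    poisson h (f + g) = poisson h f + poisson h g := by
  simp only [← poissonD_apply, map_add]

lemma poisson_smul_right (c : ℝ) (h f : PhasePoly N) :
    poisson h (c • f) = c • poisson h f := by
  simp only [← poissonD_apply, Derivation.map_smul]

lemma poisson_mul_right (h f g : PhasePoly N) :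
    poisson h (f * g) = poisson h f * g + f * poisson h g := by
  simp only [← poissonD_apply, Derivation.leibniz, smul_eq_mul]
  ring

lemma poisson_antisymm (f g : PhasePoly N) : poisson f g = -poisson g f := by
  simp only [poisson, ← Finset.sum_neg_distrib]
  exact Finset.sum_congr rfl fun j _ => by ring

lemma poisson_sum_right {ι : Type*} (s : Finset ι) (h : PhasePoly N) (f : ι → PhasePoly N) :
    poisson h (∑ i ∈ s, f i) = ∑ i ∈ s, poisson h (f i) := by
  simp only [← poissonD_apply, map_sum]

lemma poisson_add_left (f g h : PhasePoly N) :
    poisson (f + g) h = poisson f h + poisson g h := by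
  rw [poisson_antisymm, poisson_add_right, poisson_antisymm f, poisson_antisymm g]; abel

lemma poisson_smul_left (c : ℝ) (f h : PhasePoly N) :
    poisson (c • f) h = c • poisson f h := by
  rw [poisson_antisymm, poisson_smul_right, poisson_antisymm f, smul_neg]

lemma poisson_sum_left {ι : Type*} (s : Finset ι) (f : ι → PhasePoly N) (h : PhasePoly N) :
    poisson (∑ i ∈ s, f i) h = ∑ i ∈ s, poisson (f i) h := by
  rw [poisson_antisymm, poisson_sum_right, ← Finset.sum_neg_distrib]
  exact Finset.sum_congr rfl fun i _ => by rw [poisson_antisymm (f i)]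

@[simp] lemma poisson_zero_left (f : PhasePoly N) : poisson 0 f = 0 := by simp [poisson]
@[simp] lemma poisson_zero_right (f : PhasePoly N) : poisson f 0 = 0 := by simp [poisson]

lemma poisson_neg_right (h f : PhasePoly N) : poisson h (-f) = -poisson h f := by
  simp only [← poissonD_apply, map_neg]

lemma poisson_X_inl (f : PhasePoly N) (j : Fin N) :
    poisson f (X (Sum.inl j)) = -pderiv (Sum.inr j) f := by
  classical
  simp [poisson, pderiv_X, Pi.single_apply]

lemma poisson_X_inr (f : PhasePoly N) (j : Fin N) :
    poisson f (X (Sum.inr j)) = pderiv (Sum.inl j) f := by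
  classical
  simp [poisson, pderiv_X, Pi.single_apply]

lemma pderiv_comm {σ R : Type*} [CommRing R] (u v : σ) (f : MvPolynomial σ R) :
    pderiv u (pderiv v f) = pderiv v (pderiv u f) := by
  classical
  have : ⁅(pderiv u : Derivation R (MvPolynomial σ R) (MvPolynomial σ R)),
      (pderiv v : Derivation R (MvPolynomial σ R) (MvPolynomial σ R))⁆ = 0 := by
    refine derivation_ext fun i => ?_
    rw [Derivation.commutator_apply]
    simp only [pderiv_X, Pi.single_apply, Derivation.coe_zero, Pi.zero_apply]
    split_ifs <;> simp
  have h2 := congrArg (fun D => D f) this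
  simpa [Derivation.commutator_apply, sub_eq_zero] using h2

lemma pderiv_poisson (v : Var N) (f g : PhasePoly N) :
    pderiv v (poisson f g) = poisson (pderiv v f) g + poisson f (pderiv v g) := by
  simp only [poisson, map_sum, map_sub, pderiv_mul, ← Finset.sum_add_distrib]
  refine Finset.sum_congr rfl fun j _ => ?_
  simp only [pderiv_comm v]
  ring

/-- The Jacobi identity, in the form: `{h, ·}` is a derivation of the Poisson bracket. -/
lemma poisson_jacobi (h f g : PhasePoly N) :
    poisson h (poisson f g) = poisson (poisson h f) g + poisson f (poisson h g) := by
  have : ⁅poissonD h, poissonD f⁆ = poissonD (poisson h f) := by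
    refine derivation_ext fun v => ?_
    rw [Derivation.commutator_apply]
    simp only [poissonD_apply]
    rcases v with j | j
    · rw [poisson_X_inl, poisson_X_inl, poisson_X_inl, poisson_neg_right, poisson_neg_right,
        pderiv_poisson, poisson_antisymm f]
      abel
    · rw [poisson_X_inr, poisson_X_inr, poisson_X_inr, pderiv_poisson, poisson_antisymm f]
      abel
  have h2 := congrArg (fun D => D g) this
  simp only [Derivation.commutator_apply, poissonD_apply] at h2
  rw [← h2]; abel

lemma isHomogeneous_poisson {f g : PhasePoly N} {d d' e : ℕ} (hf : f.IsHomogeneous d)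
    (hg : g.IsHomogeneous d') (he : d + d' = e + 2) : (poisson f g).IsHomogeneous e := by
  have key : ∀ u v : Var N, (pderiv u f * pderiv v g).IsHomogeneous e := by
    intro u v
    by_cases hd : d = 0
    · subst hd
      have : pderiv u f = 0 := by
        rw [← totalDegree_zero_iff_isHomogeneous, totalDegree_eq_zero_iff_eq_C] at hf
        rw [hf, pderiv_C]
      rw [this, zero_mul]; exact isHomogeneous_zero _ _ _
    by_cases hd' : d' = 0
    · subst hd'
      have : pderiv v g = 0 := by
        rw [← totalDegree_zero_iff_isHomogeneous, totalDegree_eq_zero_iff_eq_C] at hg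
        rw [hg, pderiv_C]
      rw [this, mul_zero]; exact isHomogeneous_zero _ _ _
    have := (hf.pderiv (i := u)).mul (hg.pderiv (i := v))
    rwa [show d - 1 + (d' - 1) = e by omega] at this
  exact IsHomogeneous.sum _ _ _ fun j _ => (key _ _).sub (key _ _)

/-! #### Cyclic shifts -/

/-- The action of the shift on the labels of the variables. -/
def shiftVar (l : Fin N) : Var N → Var N := Sum.map (fun j => j + l) (fun j => j + l)

lemma shiftBy_eq (l : Fin N) (f : PhasePoly N) : shiftBy l f = rename (shiftVar l) f := rfl

lemma shiftVar_injective [NeZero N] (l : Fin N) : Function.Injective (shiftVar l) :=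
  Sum.map_injective.mpr ⟨add_left_injective l, add_left_injective l⟩

lemma shiftBy_shiftBy [NeZero N] (a b : Fin N) (f : PhasePoly N) :
    shiftBy a (shiftBy b f) = shiftBy (b + a) f := by
  rw [shiftBy_eq, shiftBy_eq, shiftBy_eq, rename_rename]
  congr 1
  ext v
  rcases v with j | j <;> simp [shiftVar]

lemma shiftBy_zero [NeZero N] (f : PhasePoly N) : shiftBy 0 f = f := by
  rw [shiftBy_eq]
  convert rename_id_apply f
  ext v
  rcases v with j | j <;> simp [shiftVar]

lemma pderiv_shiftBy [NeZero N] (l : Fin N) (v : Var N) (f : PhasePoly N) :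
    pderiv (shiftVar l v) (shiftBy l f) = shiftBy l (pderiv v f) :=
  pderiv_rename (shiftVar_injective l) v f

lemma shiftBy_poisson [NeZero N] (l : Fin N) (f g : PhasePoly N) :
    shiftBy l (poisson f g) = poisson (shiftBy l f) (shiftBy l g) := by
  conv_rhs => rw [poisson, ← Equiv.sum_comp (Equiv.addRight l)]
  have h1 : ∀ (j : Fin N) (f : PhasePoly N), pderiv (Sum.inl (j + l)) (shiftBy l f)
    = shiftBy l (pderiv (Sum.inl j) f) := fun j f => pderiv_shiftBy l (Sum.inl j) f
  have h2 : ∀ (j : Fin N) (f : PhasePoly N), pderiv (Sum.inr (j + l)) (shiftBy l f)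
    = shiftBy l (pderiv (Sum.inr j) f) := fun j f => pderiv_shiftBy l (Sum.inr j) f
  simp only [Equiv.coe_addRight, h1, h2, poisson]
  simp only [shiftBy_eq, map_sum, map_sub, map_mul]

/-- The shift as an algebra homomorphism and the seed map `f ↦ f^⊕` as a linear map. -/
noncomputable def oplusL (N : ℕ) : PhasePoly N →ₗ[ℝ] PhasePoly N :=
  ∑ l : Fin N, (rename (shiftVar l)).toLinearMap

lemma oplusL_apply (f : PhasePoly N) : oplusL N f = oplus f := by
  simp [oplusL, oplus, shiftBy_eq]

lemma shiftBy_oplus [NeZero N] (a : Fin N) (f : PhasePoly N) : shiftBy a (oplus f) = oplus f := by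
  have : shiftBy a (oplus f) = ∑ l : Fin N, shiftBy a (shiftBy l f) := by
    simp only [oplus, shiftBy_eq a, map_sum]
  rw [this, oplus, ← Equiv.sum_comp (Equiv.addRight a) fun l => shiftBy l f]
  simp [shiftBy_shiftBy]

lemma oplus_shiftBy [NeZero N] (a : Fin N) (f : PhasePoly N) : oplus (shiftBy a f) = oplus f := by
  rw [oplus, oplus, ← Equiv.sum_comp (Equiv.addLeft a) fun l => shiftBy l f]
  simp [shiftBy_shiftBy]

lemma isHomogeneous_shiftBy {f : PhasePoly N} {d : ℕ} (hf : f.IsHomogeneous d) (l : Fin N) :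
    (shiftBy l f).IsHomogeneous d := hf.rename_isHomogeneous

lemma isHomogeneous_oplus {f : PhasePoly N} {d : ℕ} (hf : f.IsHomogeneous d) :
    (oplus f).IsHomogeneous d :=
  IsHomogeneous.sum _ _ _ fun l _ => isHomogeneous_shiftBy hf l

lemma poisson_oplus_left (f g : PhasePoly N) :
    poisson (oplus f) g = ∑ l : Fin N, poisson (shiftBy l f) g := by
  rw [oplus, poisson_sum_left]

/-- The bracket of two cyclically symmetric functions has the seed `∑_l {f, τ^l g}`. -/
lemma oplus_sum_poisson_shiftBy [NeZero N] (f g : PhasePoly N) :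
    oplus (∑ l : Fin N, poisson f (shiftBy l g)) = poisson (oplus f) (oplus g) := by
  have h : ∑ l : Fin N, poisson f (shiftBy l g) = poisson f (oplus g) := by
    rw [oplus, poisson_sum_right]
  rw [h, poisson_oplus_left, oplus]
  exact Finset.sum_congr rfl fun l _ => by rw [shiftBy_poisson, shiftBy_oplus]

/-! #### Complex variables -/

/-- Passage to the complex canonical variables as a homomorphism of algebras. -/
noncomputable def complexHom (N : ℕ) : PhasePoly N →ₐ[ℝ] MvPolynomial (Var N) ℂ :=
  aeval (Sum.elim
    (fun j => C ((1 / Real.sqrt 2 : ℝ) : ℂ) * (X (Sum.inl j) + C Complex.I * X (Sum.inr j)))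
    (fun j => C (Complex.I * ((1 / Real.sqrt 2 : ℝ) : ℂ)) *
      (X (Sum.inl j) - C Complex.I * X (Sum.inr j))))

lemma polyNorm_eq (f : PhasePoly N) : polyNorm f = coeffNorm (complexHom N f) := rfl

lemma complexHom_X_inl (j : Fin N) : complexHom N (X (Sum.inl j)) =
    C ((1 / Real.sqrt 2 : ℝ) : ℂ) * (X (Sum.inl j) + C Complex.I * X (Sum.inr j)) := by
  simp [complexHom]

lemma complexHom_X_inr (j : Fin N) : complexHom N (X (Sum.inr j)) =
    C (Complex.I * ((1 / Real.sqrt 2 : ℝ) : ℂ)) *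
      (X (Sum.inl j) - C Complex.I * X (Sum.inr j)) := by
  simp [complexHom]

lemma inv_sqrt_two_mul_self : (((1 / Real.sqrt 2 : ℝ) : ℂ)) * ((1 / Real.sqrt 2 : ℝ) : ℂ) = 1 / 2 := by
  rw [← Complex.ofReal_mul, div_mul_div_comm, Real.mul_self_sqrt (by norm_num)]
  norm_num

lemma complexHom_C (a : ℝ) : complexHom N (C a) = C (a : ℂ) := by
  simp [complexHom, MvPolynomial.algebraMap_apply]

lemma complexHom_smul (a : ℝ) (f : PhasePoly N) :
    complexHom N (a • f) = C (a : ℂ) * complexHom N f := by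
  rw [smul_eq_C_mul, map_mul, complexHom_C]

/-- The chain rule for the passage to complex variables. -/
lemma pderiv_complexHom (v : Var N) (f : PhasePoly N) :
    pderiv v (complexHom N f) =
      ∑ u, complexHom N (pderiv u f) * pderiv v (complexHom N (X u)) := by
  classical
  induction f using MvPolynomial.induction_on with
  | C a => simp
  | add p q hp hq => simp only [map_add, hp, hq, add_mul, Finset.sum_add_distrib]
  | mul_X p w hp =>
    rw [map_mul, pderiv_mul, hp, Finset.sum_mul]
    have h : ∀ u, complexHom N (pderiv u (p * X w)) = complexHom N (pderiv u p) * complexHom N (X w)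
        + complexHom N p * complexHom N (pderiv u (X w)) := fun u => by
      rw [pderiv_mul, map_add, map_mul, map_mul]
    simp only [h, add_mul, Finset.sum_add_distrib]
    refine congrArg₂ (· + ·) (Finset.sum_congr rfl fun u _ => by ring) ?_
    rw [Finset.sum_eq_single w (fun u _ hu => by rw [pderiv_X_of_ne hu.symm]; simp) (by simp),
      pderiv_X_self, map_one, mul_one]

lemma pderiv_inl_complexHom (j : Fin N) (f : PhasePoly N) :
    pderiv (Sum.inl j) (complexHom N f) = C ((1 / Real.sqrt 2 : ℝ) : ℂ) *
      (complexHom N (pderiv (Sum.inl j) f) + C Complex.I * complexHom N (pderiv (Sum.inr j) f)) := by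
  classical
  rw [pderiv_complexHom, Fintype.sum_sum_type]
  simp only [complexHom_X_inl, complexHom_X_inr, pderiv_C_mul, map_add, map_sub, pderiv_X,
    Pi.single_apply, Sum.inl.injEq, reduceCtorEq, if_false, mul_zero, add_zero, sub_zero]
  simp only [mul_ite, mul_one, mul_zero, Finset.sum_ite_eq', Finset.mem_univ, if_true, map_mul]
  ring

lemma pderiv_inr_complexHom (j : Fin N) (f : PhasePoly N) :
    pderiv (Sum.inr j) (complexHom N f) = C ((1 / Real.sqrt 2 : ℝ) : ℂ) *
      (C Complex.I * complexHom N (pderiv (Sum.inl j) f) + complexHom N (pderiv (Sum.inr j) f)) := by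
  classical
  rw [pderiv_complexHom, Fintype.sum_sum_type]
  simp only [complexHom_X_inl, complexHom_X_inr, pderiv_C_mul, map_add, map_sub, pderiv_X,
    Pi.single_apply, Sum.inr.injEq, reduceCtorEq, if_false, zero_add, zero_sub]
  simp only [mul_ite, mul_one, mul_zero, Finset.sum_ite_eq', Finset.mem_univ, if_true, map_mul,
    mul_neg, neg_ite, neg_zero]
  have hI : (C Complex.I * C Complex.I : MvPolynomial (Var N) ℂ) = -1 := by
    rw [← C_mul, Complex.I_mul_I]; simp
  linear_combination (-complexHom N (pderiv (Sum.inr j) f) * C ((1 / Real.sqrt 2 : ℝ) : ℂ)) * hI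

/-- The complex variables are canonical: they preserve the form of the Poisson bracket. -/
lemma complexHom_poisson (f g : PhasePoly N) : complexHom N (poisson f g) =
    ∑ j : Fin N, (pderiv (Sum.inl j) (complexHom N f) * pderiv (Sum.inr j) (complexHom N g)
      - pderiv (Sum.inr j) (complexHom N f) * pderiv (Sum.inl j) (complexHom N g)) := by
  rw [poisson, map_sum]
  refine Finset.sum_congr rfl fun j _ => ?_
  rw [map_sub, map_mul, map_mul]
  simp only [pderiv_inl_complexHom, pderiv_inr_complexHom]
  have hI : (C Complex.I * C Complex.I : MvPolynomial (Var N) ℂ) = -1 := by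
    rw [← C_mul, Complex.I_mul_I]; simp
  have ha : (C ((1 / Real.sqrt 2 : ℝ) : ℂ) * C ((1 / Real.sqrt 2 : ℝ) : ℂ) :
      MvPolynomial (Var N) ℂ) * 2 = 1 := by
    rw [← C_mul, inv_sqrt_two_mul_self, ← map_ofNat C 2, ← C_mul]
    norm_num
  set a : MvPolynomial (Var N) ℂ := C ((1 / Real.sqrt 2 : ℝ) : ℂ)
  set X1 := complexHom N (pderiv (Sum.inl j) f)
  set Y1 := complexHom N (pderiv (Sum.inr j) f)
  set X2 := complexHom N (pderiv (Sum.inl j) g)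
  set Y2 := complexHom N (pderiv (Sum.inr j) g)
  linear_combination (-(X1 * Y2 - Y1 * X2)) * ha - a * a * (Y1 * X2 - X1 * Y2) * hI

lemma complexHom_isHomogeneous {f : PhasePoly N} {d : ℕ} (hf : f.IsHomogeneous d) :
    (complexHom N f).IsHomogeneous d := by
  have h : ∀ v : Var N, (complexHom N (X v)).IsHomogeneous 1 := by
    have hC : ∀ (c : ℂ) (v : Var N), (C c * X v : MvPolynomial (Var N) ℂ).IsHomogeneous 1 :=
      fun c v => by simpa using (isHomogeneous_C (Var N) c).mul (isHomogeneous_X ℂ v)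
    have hC' : ∀ (c : ℂ) (P : MvPolynomial (Var N) ℂ), P.IsHomogeneous 1 →
      (C c * P).IsHomogeneous 1 :=
      fun c P hP => by simpa using (isHomogeneous_C (Var N) c).mul hP
    rintro (j | j)
    · rw [complexHom_X_inl]
      exact hC' _ _ ((isHomogeneous_X ℂ _).add (hC _ _))
    · rw [complexHom_X_inr]
      exact hC' _ _ ((isHomogeneous_X ℂ _).sub (hC _ _))
  conv_lhs => rw [f.as_sum, map_sum]
  refine IsHomogeneous.sum _ _ _ fun k hk => ?_
  have hkd : k.degree = d := by
    by_contra h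
    exact mem_support_iff.mp hk (hf.coeff_eq_zero h)
  rw [monomial_eq, map_mul, complexHom_C, Finsupp.prod, map_prod]
  have := (isHomogeneous_C (Var N) ((f.coeff k : ℝ) : ℂ)).mul
    (IsHomogeneous.prod k.support (fun v => complexHom N (X v ^ k v)) (fun v => k v)
      (fun v _ => by simpa using (h v).pow (k v)))
  rwa [zero_add, ← Finsupp.degree_apply, hkd] at this

lemma complexHom_shiftBy (l : Fin N) (f : PhasePoly N) :
    complexHom N (shiftBy l f) = rename (shiftVar l) (complexHom N f) := by
  rw [shiftBy_eq]
  induction f using MvPolynomial.induction_on with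
  | C a => simp
  | add p q hp hq => simp only [map_add, hp, hq]
  | mul_X p w hp =>
    rw [map_mul, map_mul, map_mul, map_mul, hp, rename_X]
    congr 1
    rcases w with j | j
    · simp only [shiftVar, Sum.map_inl, complexHom_X_inl, map_mul, map_add, rename_C, rename_X]
      rfl
    · simp only [shiftVar, Sum.map_inr, complexHom_X_inr, map_mul, map_sub, rename_C, rename_X]
      rfl

/-! #### The polynomial norm -/

lemma polyNorm_nonneg (f : PhasePoly N) : 0 ≤ polyNorm f := coeffNorm_nonneg _

@[simp] lemma polyNorm_zero : polyNorm (0 : PhasePoly N) = 0 := by simp [polyNorm_eq]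

lemma polyNorm_add_le (f g : PhasePoly N) : polyNorm (f + g) ≤ polyNorm f + polyNorm g := by
  simpa [polyNorm_eq] using coeffNorm_add_le _ _

lemma polyNorm_neg (f : PhasePoly N) : polyNorm (-f) = polyNorm f := by
  simp [polyNorm_eq, coeffNorm_neg]

lemma polyNorm_sum_le {ι : Type*} (s : Finset ι) (f : ι → PhasePoly N) :
    polyNorm (∑ i ∈ s, f i) ≤ ∑ i ∈ s, polyNorm (f i) := by
  simpa [polyNorm_eq] using coeffNorm_sum_le s fun i => complexHom N (f i)

lemma polyNorm_smul (c : ℝ) (f : PhasePoly N) : polyNorm (c • f) = |c| * polyNorm f := by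
  rw [polyNorm_eq, complexHom_smul, coeffNorm_C_mul, Complex.norm_real]; rfl

lemma polyNorm_X_le (v : Var N) : polyNorm (X v : PhasePoly N) ≤ Real.sqrt 2 := by
  have h1 : ‖((1 / Real.sqrt 2 : ℝ) : ℂ)‖ = 1 / Real.sqrt 2 := by
    rw [Complex.norm_real, Real.norm_of_nonneg (by positivity)]
  have h2 : 1 / Real.sqrt 2 * (1 + 1) = Real.sqrt 2 := by
    rw [div_mul_eq_mul_div, one_mul, div_eq_iff (by positivity), Real.mul_self_sqrt (by norm_num)]
    norm_num
  have hX : ∀ u : Var N, coeffNorm (X u : MvPolynomial (Var N) ℂ) = 1 := fun u => by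
    rw [X, coeffNorm_monomial, norm_one]
  have hIX : ∀ u : Var N, coeffNorm (C Complex.I * X u : MvPolynomial (Var N) ℂ) = 1 := fun u => by
    rw [coeffNorm_C_mul, hX, Complex.norm_I, one_mul]
  rw [polyNorm_eq]
  rcases v with j | j
  · rw [complexHom_X_inl, coeffNorm_C_mul, h1]
    refine le_of_le_of_eq ?_ h2
    exact mul_le_mul_of_nonneg_left ((coeffNorm_add_le _ _).trans_eq (by rw [hX, hIX]))
      (by positivity)
  · rw [complexHom_X_inr, coeffNorm_C_mul, norm_mul, h1, Complex.norm_I, one_mul]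
    refine le_of_le_of_eq ?_ h2
    exact mul_le_mul_of_nonneg_left ((coeffNorm_sub_le _ _).trans_eq (by rw [hX, hIX]))
      (by positivity)

/-- Exchange of a variable and its conjugate. -/
def conjVar : Var N ≃ Var N := Equiv.sumComm _ _

lemma polyNorm_poisson_le_sum (f g : PhasePoly N) : polyNorm (poisson f g) ≤
    ∑ v : Var N, coeffNorm (pderiv v (complexHom N f)) *
      coeffNorm (pderiv (conjVar v) (complexHom N g)) := by
  rw [polyNorm_eq, complexHom_poisson, Fintype.sum_sum_type, ← Finset.sum_add_distrib]
  refine (coeffNorm_sum_le _ _).trans (Finset.sum_le_sum fun j _ => ?_)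
  exact (coeffNorm_sub_le _ _).trans (add_le_add (coeffNorm_mul_le _ _) (coeffNorm_mul_le _ _))

lemma polyNorm_shiftBy [NeZero N] (l : Fin N) (f : PhasePoly N) : polyNorm (shiftBy l f) = polyNorm f := by
  rw [polyNorm_eq, complexHom_shiftBy, coeffNorm_rename (shiftVar_injective l), polyNorm_eq]

/-- The norms of the brackets of `f` with all the translates of `g` add up to no more than
`d d' ‖f‖ ‖g‖`: a pair of variables of `f` and `g` meets for exactly one translation. -/
lemma sum_polyNorm_poisson_shiftBy_le [NeZero N] {f g : PhasePoly N} {d d' : ℕ} (hf : f.IsHomogeneous d)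
    (hg : g.IsHomogeneous d') : ∑ l : Fin N, polyNorm (poisson f (shiftBy l g)) ≤
      d * d' * polyNorm f * polyNorm g := by
  set F := complexHom N f
  set G := complexHom N g
  have key : ∀ v : Var N, ∑ l : Fin N,
      coeffNorm (pderiv v (complexHom N (shiftBy l g))) ≤ ∑ u, coeffNorm (pderiv u G) := by
    intro v
    have hs : ∀ (l : Fin N) (u : Var N), shiftVar l u = v →
        coeffNorm (pderiv v (complexHom N (shiftBy l g))) = coeffNorm (pderiv u G) := by
      intro l u hu
      rw [complexHom_shiftBy, ← hu, pderiv_rename (shiftVar_injective l),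
        coeffNorm_rename (shiftVar_injective l)]
    rw [Fintype.sum_sum_type]
    have nn : ∀ u, 0 ≤ coeffNorm (pderiv u G) := fun u => coeffNorm_nonneg _
    rcases v with j | j
    · refine le_trans (le_of_eq ?_) (le_add_of_nonneg_right (Finset.sum_nonneg fun u _ => nn _))
      rw [← Equiv.sum_comp (Equiv.subLeft j) fun i => coeffNorm (pderiv (Sum.inl i) G)]
      exact Finset.sum_congr rfl fun l _ => hs l _ (by simp [shiftVar])
    · refine le_trans (le_of_eq ?_) (le_add_of_nonneg_left (Finset.sum_nonneg fun u _ => nn _))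
      rw [← Equiv.sum_comp (Equiv.subLeft j) fun i => coeffNorm (pderiv (Sum.inr i) G)]
      exact Finset.sum_congr rfl fun l _ => hs l _ (by simp [shiftVar])
  calc ∑ l : Fin N, polyNorm (poisson f (shiftBy l g))
      ≤ ∑ l : Fin N, ∑ v : Var N, coeffNorm (pderiv v F) *
          coeffNorm (pderiv (conjVar v) (complexHom N (shiftBy l g))) :=
        Finset.sum_le_sum fun l _ => polyNorm_poisson_le_sum _ _
    _ = ∑ v : Var N, coeffNorm (pderiv v F) *
          ∑ l : Fin N, coeffNorm (pderiv (conjVar v) (complexHom N (shiftBy l g))) := by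
        rw [Finset.sum_comm]; simp only [Finset.mul_sum]
    _ ≤ ∑ v : Var N, coeffNorm (pderiv v F) * (d' * coeffNorm G) := by
        refine Finset.sum_le_sum fun v _ => mul_le_mul_of_nonneg_left ?_ (coeffNorm_nonneg _)
        exact (key _).trans (sum_coeffNorm_pderiv_le (complexHom_isHomogeneous hg))
    _ ≤ (d * coeffNorm F) * (d' * coeffNorm G) := by
        rw [← Finset.sum_mul]
        exact mul_le_mul_of_nonneg_right (sum_coeffNorm_pderiv_le (complexHom_isHomogeneous hf))
          (mul_nonneg (Nat.cast_nonneg _) (coeffNorm_nonneg _))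
    _ = d * d' * polyNorm f * polyNorm g := by simp only [polyNorm_eq, F, G]; ring

lemma polyNorm_poisson_oplus_le [NeZero N] {f g : PhasePoly N} {d d' : ℕ} (hf : f.IsHomogeneous d)
    (hg : g.IsHomogeneous d') : polyNorm (poisson (oplus f) g) ≤
      d * d' * polyNorm f * polyNorm g := by
  have h : poisson (oplus f) g = -∑ l : Fin N, poisson g (shiftBy l f) := by
    rw [poisson_antisymm, oplus, poisson_sum_right]
  rw [h, polyNorm_neg]
  refine (polyNorm_sum_le _ _).trans ((sum_polyNorm_poisson_shiftBy_le hg hf).trans (le_of_eq ?_))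
  ring

end bracket

/-! ### Sites on which a polynomial depends -/

section support
variable {N : ℕ}

/-- The polynomials that depend only on the variables at the sites `0, …, m`. -/
noncomputable def sitesUpTo (N m : ℕ) : Subalgebra ℝ (PhasePoly N) :=
  supported ℝ {v : Var N | (site v : ℕ) ≤ m}

lemma mem_sitesUpTo {m : ℕ} {f : PhasePoly N} :
    f ∈ sitesUpTo N m ↔ ∀ v ∈ f.vars, (site v : ℕ) ≤ m := mem_supported

lemma pderiv_mem_supported {s : Set (Var N)} {f : PhasePoly N} (hf : f ∈ supported ℝ s)
    (v : Var N) : pderiv v f ∈ supported ℝ s := by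
  classical
  rw [supported_eq_adjoin_X] at hf
  induction hf using Algebra.adjoin_induction with
  | mem x hx =>
    obtain ⟨i, _, rfl⟩ := hx
    rw [pderiv_X, Pi.single_apply]
    split_ifs
    · exact one_mem _
    · exact zero_mem _
  | algebraMap r => simp [MvPolynomial.algebraMap_eq]
  | add x y _ _ hx hy => rw [map_add]; exact add_mem hx hy
  | mul x y hx' hy' hx hy =>
    rw [pderiv_mul]
    exact add_mem (mul_mem hx hy') (mul_mem hx' hy)

lemma poisson_mem_supported {s : Set (Var N)} {f g : PhasePoly N} (hf : f ∈ supported ℝ s)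
    (hg : g ∈ supported ℝ s) : poisson f g ∈ supported ℝ s :=
  sum_mem fun _ _ => sub_mem
    (mul_mem (pderiv_mem_supported hf _) (pderiv_mem_supported hg _))
    (mul_mem (pderiv_mem_supported hf _) (pderiv_mem_supported hg _))

lemma pderiv_eq_zero_of_mem_supported {s : Set (Var N)} {f : PhasePoly N}
    (hf : f ∈ supported ℝ s) {v : Var N} (hv : v ∉ s) : pderiv v f = 0 :=
  pderiv_eq_zero_of_notMem_vars fun h => hv (mem_supported.mp hf h)

lemma poisson_eq_zero_of_disjoint {S T : Set (Fin N)} (hST : Disjoint S T) {f g : PhasePoly N}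
    (hf : f ∈ supported ℝ {v | site v ∈ S}) (hg : g ∈ supported ℝ {v | site v ∈ T}) :
    poisson f g = 0 := by
  refine Finset.sum_eq_zero fun j _ => ?_
  by_cases hj : j ∈ S
  · have hj' : j ∉ T := Set.disjoint_left.mp hST hj
    rw [pderiv_eq_zero_of_mem_supported hg (v := Sum.inr j) hj',
      pderiv_eq_zero_of_mem_supported hg (v := Sum.inl j) hj', mul_zero, mul_zero, sub_zero]
  · rw [pderiv_eq_zero_of_mem_supported hf (v := Sum.inr j) hj,
      pderiv_eq_zero_of_mem_supported hf (v := Sum.inl j) hj, zero_mul, zero_mul, sub_zero]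

lemma shiftBy_mem_supported {S T : Set (Fin N)} {l : Fin N} (h : ∀ j ∈ S, j + l ∈ T)
    {f : PhasePoly N} (hf : f ∈ supported ℝ {v | site v ∈ S}) :
    shiftBy l f ∈ supported ℝ {v | site v ∈ T} := by
  classical
  rw [mem_supported] at hf ⊢
  intro v hv
  obtain ⟨u, hu, rfl⟩ := Finset.mem_image.mp (vars_rename _ _ hv)
  have := h _ (hf hu)
  rcases u with j | j <;> exact this

end support

/-! ### Brackets of seeds -/

section seedBracket
variable {N : ℕ}

/-- A seed of `{f^⊕, g^⊕}` for a seed `f` that depends on the sites `0, …, m`: the bracket of `f`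
with the translate `τ^l g` is shifted back by `l` if this translate begins to the left of `f`. -/
noncomputable def seedBracket [NeZero N] (m : ℕ) (f g : PhasePoly N) : PhasePoly N :=
  ∑ l : Fin N, shiftBy (if (l : ℕ) ≤ m then 0 else -l) (poisson f (shiftBy l g))

variable [NeZero N]

lemma oplus_seedBracket (m : ℕ) (f g : PhasePoly N) :
    oplus (seedBracket m f g) = poisson (oplus f) (oplus g) := by
  rw [← oplus_sum_poisson_shiftBy, ← oplusL_apply, ← oplusL_apply, seedBracket, map_sum, map_sum]
  simp only [oplusL_apply, oplus_shiftBy]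

lemma isHomogeneous_seedBracket (m : ℕ) {f g : PhasePoly N} {d d' e : ℕ}
    (hf : f.IsHomogeneous d) (hg : g.IsHomogeneous d') (he : d + d' = e + 2) :
    (seedBracket m f g).IsHomogeneous e :=
  IsHomogeneous.sum _ _ _ fun l _ =>
    isHomogeneous_shiftBy (isHomogeneous_poisson hf (isHomogeneous_shiftBy hg l) he) _

lemma polyNorm_seedBracket_le (m : ℕ) {f g : PhasePoly N} {d d' : ℕ} (hf : f.IsHomogeneous d)
    (hg : g.IsHomogeneous d') :
    polyNorm (seedBracket m f g) ≤ d * d' * polyNorm f * polyNorm g := by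
  refine (polyNorm_sum_le _ _).trans ?_
  simp only [polyNorm_shiftBy]
  exact sum_polyNorm_poisson_shiftBy_le hf hg

lemma seedBracket_mem_sitesUpTo {m m' : ℕ} {f g : PhasePoly N} (hf : f ∈ sitesUpTo N m)
    (hg : g ∈ sitesUpTo N m') : seedBracket m f g ∈ sitesUpTo N (m + m') := by
  have hN : 0 < N := Nat.pos_of_neZero N
  refine sum_mem fun l _ => ?_
  by_cases hall : N ≤ m + m' + 1
  · rw [mem_sitesUpTo]
    intro v _
    have := (site v).isLt
    omega
  have hf' : f ∈ supported ℝ {v : Var N | site v ∈ {j : Fin N | (j : ℕ) ≤ m}} := hf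
  have hg' : g ∈ supported ℝ {v : Var N | site v ∈ {j : Fin N | (j : ℕ) ≤ m'}} := hg
  split_ifs with hl
  · rw [shiftBy_zero]
    refine poisson_mem_supported (supported_mono (fun v hv => ?_) hf)
      (shiftBy_mem_supported (T := {j : Fin N | (j : ℕ) ≤ m + m'}) (fun j hj => ?_) hg')
    · exact le_trans hv (Nat.le_add_right _ _)
    · simp only [Set.mem_ofPred_eq, Fin.val_add] at hj ⊢
      exact (Nat.mod_le _ _).trans (by omega)
  by_cases hl' : N ≤ l + m'
  · rw [shiftBy_poisson, shiftBy_shiftBy, add_neg_cancel, shiftBy_zero]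
    refine poisson_mem_supported
      (shiftBy_mem_supported (T := {j : Fin N | (j : ℕ) ≤ m + m'}) (fun j hj => ?_) hf')
      (supported_mono (fun v hv => ?_) hg)
    · simp only [Set.mem_ofPred_eq, Fin.val_add, Fin.val_neg] at hj ⊢
      exact (Nat.mod_le _ _).trans (by split_ifs <;> omega)
    · exact le_trans hv (Nat.le_add_left _ _)
  · have hdisj : Disjoint {j : Fin N | (j : ℕ) ≤ m} {j : Fin N | m < (j : ℕ)} :=
      Set.disjoint_left.mpr fun j (hj : (j : ℕ) ≤ m) (hj' : m < (j : ℕ)) =>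
        absurd hj' (not_lt.mpr hj)
    have hg'' : shiftBy l g ∈ supported ℝ {v : Var N | site v ∈ {j : Fin N | m < (j : ℕ)}} := by
      refine shiftBy_mem_supported (fun j hj => ?_) hg'
      simp only [Set.mem_ofPred_eq, Fin.val_add] at hj ⊢
      rw [Nat.mod_eq_of_lt (by omega)]
      omega
    rw [poisson_eq_zero_of_disjoint hdisj hf' hg'', shiftBy_eq, map_zero]
    exact zero_mem _

end seedBracket

/-! ### Series of homogeneous polynomials, coefficient by coefficient -/

section coeffSum
variable {N : ℕ}

/-- Convergence of a series of polynomials, coefficient by coefficient. -/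
def CoeffSum {ι : Type*} (F : ι → PhasePoly N) (f : PhasePoly N) : Prop :=
  ∀ k, HasSum (fun i => (F i).coeff k) (f.coeff k)

lemma CoeffSum.unique {ι : Type*} {F : ι → PhasePoly N} {f g : PhasePoly N} (hf : CoeffSum F f)
    (hg : CoeffSum F g) : f = g :=
  MvPolynomial.ext _ _ fun k => (hf k).unique (hg k)

lemma CoeffSum.isHomogeneous {ι : Type*} {F : ι → PhasePoly N} {f : PhasePoly N} {d : ℕ}
    (hf : CoeffSum F f) (hF : ∀ i, (F i).IsHomogeneous d) : f.IsHomogeneous d := by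
  intro k hk
  by_contra h
  refine hk ((hf k).unique ?_)
  have : (fun i => (F i).coeff k) = fun _ => 0 := funext fun i =>
    (hF i).coeff_eq_zero fun h' => h (by rwa [Finsupp.degree_eq_weight_one] at h')
  rw [this]
  exact hasSum_zero

lemma CoeffSum.add {ι : Type*} {F G : ι → PhasePoly N} {f g : PhasePoly N} (hf : CoeffSum F f)
    (hg : CoeffSum G g) : CoeffSum (fun i => F i + G i) (f + g) := fun k => by
  simpa using (hf k).add (hg k)

/-- The exponents of total degree `d`. -/
noncomputable def degreeFinset (N d : ℕ) : Finset (Var N →₀ ℕ) :=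
  (Finsupp.finite_of_degree_eq (σ := Var N) d).toFinset

lemma mem_degreeFinset {d : ℕ} {k : Var N →₀ ℕ} : k ∈ degreeFinset N d ↔ k.degree = d := by
  simp [degreeFinset]

lemma eq_sum_degreeFinset {f : PhasePoly N} {d : ℕ} (hf : f.IsHomogeneous d) :
    f = ∑ k ∈ degreeFinset N d, f.coeff k • monomial k (1 : ℝ) := by
  classical
  ext k
  simp only [coeff_sum, coeff_smul, coeff_monomial, smul_eq_mul, mul_ite, mul_one, mul_zero]
  rw [Finset.sum_ite_eq' (degreeFinset N d) k]
  split_ifs with h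
  · rfl
  · exact hf.coeff_eq_zero fun h' => h (mem_degreeFinset.mpr h')

lemma CoeffSum.hasSum_map {ι E : Type*} [NormedAddCommGroup E] [NormedSpace ℝ E]
    {F : ι → PhasePoly N} {f : PhasePoly N} {d : ℕ} (hf : CoeffSum F f)
    (hF : ∀ i, (F i).IsHomogeneous d) (T : PhasePoly N →ₗ[ℝ] E) :
    HasSum (fun i => T (F i)) (T f) := by
  have key : ∀ g : PhasePoly N, g.IsHomogeneous d → T g =
      ∑ l ∈ degreeFinset N d, g.coeff l • T (monomial l 1) := by
    intro g hg
    conv_lhs => rw [eq_sum_degreeFinset hg, map_sum]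
    simp
  simp only [key _ (hF _), key _ (hf.isHomogeneous hF)]
  exact hasSum_sum fun l _ => (hf l).smul_const _

lemma CoeffSum.map {ι : Type*} {F : ι → PhasePoly N} {f : PhasePoly N} {d : ℕ}
    (hf : CoeffSum F f) (hF : ∀ i, (F i).IsHomogeneous d) (T : PhasePoly N →ₗ[ℝ] PhasePoly N) :
    CoeffSum (fun i => T (F i)) (T f) := fun k =>
  hf.hasSum_map hF ((lcoeff ℝ k).comp T)

lemma CoeffSum.map₂ {ι κ : Type*} {F : ι → PhasePoly N} {G : κ → PhasePoly N}
    {f g : PhasePoly N} {d d' : ℕ}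
    (hf : CoeffSum F f) (hF : ∀ i, (F i).IsHomogeneous d)
    (hg : CoeffSum G g) (hG : ∀ i, (G i).IsHomogeneous d') :
    CoeffSum (fun p : ι × κ => poisson (F p.1) (G p.2)) (poisson f g) := by
  intro k
  have key : ∀ f g : PhasePoly N, f.IsHomogeneous d → g.IsHomogeneous d' →
      (poisson f g).coeff k = ∑ l ∈ degreeFinset N d, ∑ l' ∈ degreeFinset N d',
        f.coeff l * g.coeff l' * (poisson (monomial l 1) (monomial l' 1)).coeff k := by
    intro f g hf hg
    conv_lhs => rw [eq_sum_degreeFinset hf, eq_sum_degreeFinset hg, poisson_sum_left, coeff_sum]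
    refine Finset.sum_congr rfl fun l _ => ?_
    rw [poisson_sum_right, coeff_sum]
    refine Finset.sum_congr rfl fun l' _ => ?_
    rw [poisson_smul_left, poisson_smul_right, coeff_smul, coeff_smul, smul_eq_mul, smul_eq_mul]
    ring
  have key' : (fun p : ι × κ => (poisson (F p.1) (G p.2)).coeff k) = fun p =>
      ∑ l ∈ degreeFinset N d, ∑ l' ∈ degreeFinset N d', (F p.1).coeff l * (G p.2).coeff l' *
        (poisson (monomial l 1) (monomial l' 1)).coeff k :=
    funext fun p => key _ _ (hF _) (hG _)
  rw [key', key _ _ (hf.isHomogeneous hF) (hg.isHomogeneous hG)]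
  refine hasSum_sum fun l _ => hasSum_sum fun l' _ => ?_
  have h := (hf l).mul (hg l')
    (summable_mul_of_summable_norm (hf l).summable.norm (hg l').summable.norm)
  exact h.mul_right _

lemma HasSum.sum_antidiagonal {f : ℕ × ℕ → ℝ} {a : ℝ} (h : HasSum f a) :
    HasSum (fun n : ℕ => ∑ p ∈ antidiagonal n, f p) a := by
  refine ((Finset.HasAntidiagonal.sigmaAntidiagonalEquivProd (A := ℕ)).hasSum_iff.mpr h).sigma
    fun n => ?_
  exact Finset.hasSum (antidiagonal n) f

/-- Bounds on the polynomial norm bound the real coefficients, the inverse of the passage to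
complex variables being a substitution. -/
lemma abs_coeff_le_polyNorm {f : PhasePoly N} {d : ℕ} (hf : f.IsHomogeneous d)
    (k : Var N →₀ ℕ) : |f.coeff k| ≤ 2 ^ d * polyNorm f := by
  classical
  set a : ℂ := ((1 / Real.sqrt 2 : ℝ) : ℂ)
  let φ : Var N → MvPolynomial (Var N) ℂ := Sum.elim
    (fun j => C a * (X (Sum.inl j) - C Complex.I * X (Sum.inr j)))
    (fun j => C a * (X (Sum.inr j) - C Complex.I * X (Sum.inl j)))
  have hinv : ∀ g : PhasePoly N, bind₁ φ (complexHom N g) = map Complex.ofRealHom g := by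
    intro g
    have hI : (C Complex.I * C Complex.I : MvPolynomial (Var N) ℂ) = -1 := by
      rw [← C_mul, Complex.I_mul_I]; simp
    have ha : (C a * C a : MvPolynomial (Var N) ℂ) * 2 = 1 := by
      rw [← C_mul, inv_sqrt_two_mul_self, ← map_ofNat C 2, ← C_mul]
      norm_num
    induction g using MvPolynomial.induction_on with
    | C c => simp
    | add p q hp hq => simp only [map_add, hp, hq]
    | mul_X p w hp =>
      rw [map_mul, map_mul, map_mul, hp, map_X]
      refine congrArg₂ (· * ·) rfl ?_
      rcases w with j | j
      · rw [complexHom_X_inl]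
        simp only [map_mul, map_add, bind₁_X_right, bind₁_C_right, φ, Sum.elim_inl, Sum.elim_inr]
        linear_combination (X (Sum.inl j)) * ha - C a * C a * X (Sum.inl j) * hI
      · rw [complexHom_X_inr]
        simp only [map_mul, map_sub, bind₁_X_right, bind₁_C_right, φ, Sum.elim_inl, Sum.elim_inr]
        linear_combination (X (Sum.inr j)) * ha - C a * C a * (2 * X (Sum.inr j)
          - C Complex.I * X (Sum.inl j)) * hI
  have hX : ∀ u : Var N, coeffNorm (X u : MvPolynomial (Var N) ℂ) = 1 := fun u => by
    rw [X, coeffNorm_monomial, norm_one]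
  have hIX : ∀ u : Var N, coeffNorm (C Complex.I * X u : MvPolynomial (Var N) ℂ) = 1 := fun u => by
    rw [coeffNorm_C_mul, hX, Complex.norm_I, one_mul]
  have ha1 : ‖a‖ ≤ 1 := by
    rw [Complex.norm_real, Real.norm_of_nonneg (by positivity), div_le_one (by positivity)]
    exact Real.one_le_sqrt.mpr (by norm_num)
  have hφ : ∀ v, coeffNorm (φ v) ≤ 2 := by
    have : ∀ u w : Var N, coeffNorm (C a * (X u - C Complex.I * X w)) ≤ 2 := by
      intro u w
      rw [coeffNorm_C_mul]
      calc ‖a‖ * coeffNorm (X u - C Complex.I * X w)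
          ≤ 1 * (coeffNorm (X u) + coeffNorm (C Complex.I * X w)) :=
            mul_le_mul ha1 (coeffNorm_sub_le _ _) (coeffNorm_nonneg _) zero_le_one
        _ = 2 := by rw [hX, hIX]; norm_num
    rintro (j | j)
    · exact this _ _
    · exact this _ _
  have hone : coeffNorm (1 : MvPolynomial (Var N) ℂ) = 1 := by
    rw [← C_1, C_apply, coeffNorm_monomial, norm_one]
  have hpow : ∀ (P : MvPolynomial (Var N) ℂ) (n : ℕ), coeffNorm (P ^ n) ≤ coeffNorm P ^ n := by
    intro P n
    induction n with
    | zero => simp [hone]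
    | succ n ih =>
      rw [pow_succ, pow_succ]
      exact (coeffNorm_mul_le _ _).trans (mul_le_mul_of_nonneg_right ih (coeffNorm_nonneg _))
  have hprod : ∀ (s : Finset (Var N)) (P : Var N → MvPolynomial (Var N) ℂ),
      coeffNorm (∏ v ∈ s, P v) ≤ ∏ v ∈ s, coeffNorm (P v) := by
    intro s P
    induction s using Finset.induction_on with
    | empty => simp [hone]
    | insert v s hv ih =>
      rw [Finset.prod_insert hv, Finset.prod_insert hv]
      exact (coeffNorm_mul_le _ _).trans (mul_le_mul_of_nonneg_left ih (coeffNorm_nonneg _))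
  have hbind : coeffNorm (bind₁ φ (complexHom N f)) ≤ 2 ^ d * coeffNorm (complexHom N f) := by
    set P := complexHom N f with hP
    have hPd : P.IsHomogeneous d := complexHom_isHomogeneous hf
    conv_lhs => rw [P.as_sum, map_sum]
    refine (coeffNorm_sum_le _ _).trans ?_
    rw [coeffNorm, Finset.mul_sum]
    refine Finset.sum_le_sum fun l hl => ?_
    have hld : l.degree = d := by
      by_contra h
      exact mem_support_iff.mp hl (hPd.coeff_eq_zero h)
    rw [bind₁_monomial, coeffNorm_C_mul, mul_comm]
    refine mul_le_mul_of_nonneg_right ((hprod _ _).trans ?_) (norm_nonneg _)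
    calc ∏ v ∈ l.support, coeffNorm (φ v ^ l v) ≤ ∏ v ∈ l.support, (2 : ℝ) ^ l v :=
          Finset.prod_le_prod (fun _ _ => coeffNorm_nonneg _) fun v _ =>
            (hpow _ _).trans (pow_le_pow_left₀ (coeffNorm_nonneg _) (hφ v) _)
      _ = 2 ^ d := by rw [Finset.prod_pow_eq_pow_sum, ← hld, Finsupp.degree_apply]
  calc |f.coeff k| = ‖(map Complex.ofRealHom f).coeff k‖ := by
        rw [coeff_map, Complex.ofRealHom_eq_coe, Complex.norm_real]; rfl
    _ ≤ coeffNorm (map Complex.ofRealHom f) := norm_coeff_le_coeffNorm _ _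
    _ ≤ 2 ^ d * polyNorm f := by rw [← hinv, polyNorm_eq]; exact hbind

end coeffSum

/-! ### Seeds with exponentially decaying interaction -/

section seeds
variable {N : ℕ}

/-- The pieces `F 0, F 1, …` of a seed of degree `d`: `F m` is homogeneous, depends on the sites
`0, …, m` and has norm at most `C e^{-σ m}`. Nothing is required of the signs of `C` and `σ`. -/
structure DecayingPieces (d : ℕ) (C σ : ℝ) (F : ℕ → PhasePoly N) : Prop where
  homogeneous : ∀ m, (F m).IsHomogeneous d
  range : ∀ m, F m ∈ sitesUpTo N m
  decay : ∀ m, polyNorm (F m) ≤ C * Real.exp (-σ * m)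

/-- The seed `f` is the sum of decaying pieces; this is `IsClassD` without the positivity of the
constants. -/
def DecayingSeed (d : ℕ) (f : PhasePoly N) (C σ : ℝ) : Prop :=
  ∃ F : ℕ → PhasePoly N, DecayingPieces d C σ F ∧ CoeffSum F f

lemma IsDecayDecomposition.decayingPieces {d : ℕ} {f : PhasePoly N} {C σ : ℝ}
    {F : ℕ → PhasePoly N} (h : IsDecayDecomposition d f C σ F) : DecayingPieces d C σ F :=
  ⟨h.homogeneous, fun m => mem_sitesUpTo.mpr (h.range m), h.decay⟩

lemma IsClassD.decayingSeed {d : ℕ} {f : PhasePoly N} {C σ : ℝ} (h : IsClassD d f C σ) :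
    DecayingSeed d f C σ := by
  obtain ⟨F, hF⟩ := h
  exact ⟨F, hF.decayingPieces, hF.sum⟩

lemma DecayingSeed.isClassD {d : ℕ} {f : PhasePoly N} {C σ : ℝ} (h : DecayingSeed d f C σ)
    (hC : 0 < C) (hσ : 0 < σ) : IsClassD d f C σ := by
  obtain ⟨F, hF, hs⟩ := h
  exact ⟨F, hC, hσ, hF.homogeneous, fun m => mem_sitesUpTo.mp (hF.range m), hF.decay, hs⟩

lemma DecayingSeed.isHomogeneous {d : ℕ} {f : PhasePoly N} {C σ : ℝ}
    (h : DecayingSeed d f C σ) : f.IsHomogeneous d := by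
  obtain ⟨F, hF, hs⟩ := h
  exact hs.isHomogeneous hF.homogeneous

lemma DecayingPieces.mono {d : ℕ} {C C' σ σ' : ℝ} {F : ℕ → PhasePoly N}
    (h : DecayingPieces d C σ F) (hC : C ≤ C') (hσ : σ' ≤ σ) : DecayingPieces d C' σ' F := by
  refine ⟨h.homogeneous, h.range, fun m => (h.decay m).trans ?_⟩
  have h0 : 0 ≤ C := by
    have := (polyNorm_nonneg _).trans (h.decay 0)
    simpa using this
  refine mul_le_mul hC (Real.exp_le_exp.mpr ?_) (Real.exp_nonneg _) (h0.trans hC)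
  nlinarith [(Nat.cast_nonneg m : (0 : ℝ) ≤ m)]

lemma DecayingPieces.const_nonneg {d : ℕ} {C σ : ℝ} {F : ℕ → PhasePoly N}
    (h : DecayingPieces d C σ F) : 0 ≤ C := by
  have := (polyNorm_nonneg _).trans (h.decay 0)
  simpa using this

lemma DecayingSeed.mono {d : ℕ} {f : PhasePoly N} {C C' σ σ' : ℝ} (h : DecayingSeed d f C σ)
    (hC : C ≤ C') (hσ : σ' ≤ σ) : DecayingSeed d f C' σ' := by
  obtain ⟨F, hF, hs⟩ := h
  exact ⟨F, hF.mono hC hσ, hs⟩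

lemma decayingSeed_zero (d : ℕ) (σ : ℝ) : DecayingSeed d (0 : PhasePoly N) 0 σ :=
  ⟨fun _ => 0, ⟨fun _ => isHomogeneous_zero _ _ _, fun _ => zero_mem _, fun _ => by simp⟩,
    fun _ => by simp⟩

lemma DecayingSeed.add {d : ℕ} {f g : PhasePoly N} {C C' σ : ℝ} (hf : DecayingSeed d f C σ)
    (hg : DecayingSeed d g C' σ) : DecayingSeed d (f + g) (C + C') σ := by
  obtain ⟨F, hF, hfs⟩ := hf
  obtain ⟨G, hG, hgs⟩ := hg
  refine ⟨fun m => F m + G m, ⟨fun m => (hF.homogeneous m).add (hG.homogeneous m),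
    fun m => add_mem (hF.range m) (hG.range m), fun m => ?_⟩, hfs.add hgs⟩
  rw [add_mul]
  exact (polyNorm_add_le _ _).trans (add_le_add (hF.decay m) (hG.decay m))

lemma DecayingSeed.smul {d : ℕ} {f : PhasePoly N} {C σ : ℝ} (hf : DecayingSeed d f C σ) (c : ℝ) :
    DecayingSeed d (c • f) (|c| * C) σ := by
  obtain ⟨F, hF, hfs⟩ := hf
  refine ⟨fun m => c • F m, ⟨fun m => (homogeneousSubmodule _ _ d).smul_mem c (hF.homogeneous m),
    fun m => Subalgebra.smul_mem _ (hF.range m) c, fun m => ?_⟩, fun k => ?_⟩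
  · rw [polyNorm_smul, mul_assoc]
    exact mul_le_mul_of_nonneg_left (hF.decay m) (abs_nonneg c)
  · simpa using (hfs k).mul_left c

/-- Decaying pieces add up to a seed. -/
lemma DecayingPieces.exists_sum {d : ℕ} {C σ : ℝ} {F : ℕ → PhasePoly N}
    (h : DecayingPieces d C σ F) (hσ : 0 < σ) : ∃ f, CoeffSum F f := by
  classical
  have hexp : Summable fun m : ℕ => Real.exp (-σ * m) := by
    have := summable_geometric_of_lt_one (Real.exp_nonneg (-σ)) 
      (Real.exp_lt_one_iff.mpr (by linarith))
    refine this.congr fun m => ?_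
    rw [← Real.exp_nat_mul]; ring_nf
  have hsum : ∀ k, Summable fun m => (F m).coeff k := by
    intro k
    refine Summable.of_norm_bounded (g := fun m : ℕ => 2 ^ d * (C * Real.exp (-σ * m)))
      ((hexp.mul_left C).mul_left _) fun m => ?_
    exact (abs_coeff_le_polyNorm (h.homogeneous m) k).trans
      (mul_le_mul_of_nonneg_left (h.decay m) (by positivity))
  refine ⟨∑ k ∈ degreeFinset N d, monomial k (∑' m, (F m).coeff k), fun k => ?_⟩
  rw [coeff_sum]
  simp only [coeff_monomial]
  rw [Finset.sum_ite_eq' (degreeFinset N d) k]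
  split_ifs with hk
  · exact (hsum k).hasSum
  · have : (fun m => (F m).coeff k) = fun _ => 0 := funext fun m =>
      (h.homogeneous m).coeff_eq_zero fun h' => hk (mem_degreeFinset.mpr h')
    rw [this]
    exact hasSum_zero

lemma hasSum_exp_neg_mul {σ : ℝ} (hσ : 0 < σ) (C : ℝ) :
    HasSum (fun m : ℕ => C * Real.exp (-σ * m)) (C / (1 - Real.exp (-σ))) := by
  have hlt : Real.exp (-σ) < 1 := by rw [Real.exp_lt_one_iff]; linarith
  have := (hasSum_geometric_of_lt_one (Real.exp_nonneg (-σ)) hlt).mul_left C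
  rw [← div_eq_mul_inv] at this
  refine this.congr_fun fun m => ?_
  rw [← Real.exp_nat_mul]; ring_nf

lemma polyNorm_eq_sum_degreeFinset {f : PhasePoly N} {d : ℕ} (hf : f.IsHomogeneous d) :
    polyNorm f = ∑ k ∈ degreeFinset N d, ‖(complexHom N f).coeff k‖ := by
  rw [polyNorm_eq]
  refine coeffNorm_eq_sum _ fun k hk => mem_degreeFinset.mpr ?_
  by_contra h
  exact mem_support_iff.mp hk ((complexHom_isHomogeneous hf).coeff_eq_zero h)

lemma DecayingSeed.polyNorm_le {d : ℕ} {f : PhasePoly N} {C σ : ℝ} (h : DecayingSeed d f C σ)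
    (hσ : 0 < σ) : polyNorm f ≤ C / (1 - Real.exp (-σ)) := by
  have hf := h.isHomogeneous
  obtain ⟨F, hF, hs⟩ := h
  have hgeom := hasSum_exp_neg_mul hσ C
  have hlim : Filter.Tendsto (fun s : Finset ℕ => polyNorm (∑ m ∈ s, F m)) Filter.atTop
      (nhds (polyNorm f)) := by
    simp only [polyNorm_eq_sum_degreeFinset hf, polyNorm_eq_sum_degreeFinset
      (IsHomogeneous.sum _ _ _ fun m _ => hF.homogeneous m)]
    refine tendsto_finsetSum _ fun k _ => Filter.Tendsto.norm ?_
    have := hs.hasSum_map hF.homogeneous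
      (((lcoeff ℂ k).restrictScalars ℝ).comp (complexHom N).toLinearMap)
    simpa [HasSum, coeff_sum] using this
  refine le_of_tendsto' hlim fun s => (polyNorm_sum_le _ _).trans ?_
  refine (Finset.sum_le_sum fun m _ => hF.decay m).trans (sum_le_hasSum s (fun m _ => ?_) hgeom)
  exact (polyNorm_nonneg _).trans (hF.decay m)

variable [NeZero N]

/-- The pieces of the seed of a bracket, ordered by the number of sites involved. -/
noncomputable def bracketPieces (F G : ℕ → PhasePoly N) (M : ℕ) : PhasePoly N :=
  ∑ p ∈ antidiagonal M, seedBracket p.1 (F p.1) (G p.2)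

lemma isHomogeneous_bracketPieces {d d' e : ℕ} {F G : ℕ → PhasePoly N}
    (hF : ∀ m, (F m).IsHomogeneous d) (hG : ∀ m, (G m).IsHomogeneous d') (he : d + d' = e + 2)
    (M : ℕ) : (bracketPieces F G M).IsHomogeneous e :=
  IsHomogeneous.sum _ _ _ fun _ _ => isHomogeneous_seedBracket _ (hF _) (hG _) he

lemma bracketPieces_mem_sitesUpTo {F G : ℕ → PhasePoly N} (hF : ∀ m, F m ∈ sitesUpTo N m)
    {M : ℕ} (hG : ∀ m ≤ M, G m ∈ sitesUpTo N m) : bracketPieces F G M ∈ sitesUpTo N M := by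
  refine sum_mem fun p hp => ?_
  rw [mem_antidiagonal] at hp
  have := seedBracket_mem_sitesUpTo (hF p.1) (hG p.2 (by omega))
  rwa [hp] at this

/-- The seeds given by the pieces of the bracket generate the bracket. -/
lemma oplus_eq_of_coeffSum_bracketPieces {d d' e : ℕ} {F G : ℕ → PhasePoly N}
    {f g h : PhasePoly N} (hF : ∀ m, (F m).IsHomogeneous d) (hG : ∀ m, (G m).IsHomogeneous d')
    (he : d + d' = e + 2) (hf : CoeffSum F f) (hg : CoeffSum G g)
    (hh : CoeffSum (bracketPieces F G) h) : oplus h = poisson (oplus f) (oplus g) := by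
  have h1 := hh.map (isHomogeneous_bracketPieces hF hG he) (oplusL N)
  have h2 := CoeffSum.map₂ (hf.map hF (oplusL N))
    (fun i => by rw [oplusL_apply]; exact isHomogeneous_oplus (hF i)) (hg.map hG (oplusL N))
    (fun i => by rw [oplusL_apply]; exact isHomogeneous_oplus (hG i))
  simp only [oplusL_apply] at h1 h2
  refine h1.unique fun k => ((h2 k).sum_antidiagonal).congr_fun fun M => ?_
  change (oplus (bracketPieces F G M)).coeff k = _
  rw [← oplusL_apply, bracketPieces, map_sum, coeff_sum]
  exact Finset.sum_congr rfl fun p _ => by rw [oplusL_apply, oplus_seedBracket]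

/-- A convolution of two exponentials whose rates differ by at least `δ`. -/
lemma sum_antidiagonal_exp_le {σ σ' δ : ℝ} (hδ : 0 < δ) (h : σ + δ ≤ σ') (M : ℕ) :
    ∑ p ∈ antidiagonal M, Real.exp (-σ' * p.1) * Real.exp (-σ * p.2) ≤
      Real.exp (-σ * M) / (1 - Real.exp (-δ)) := by
  calc ∑ p ∈ antidiagonal M, Real.exp (-σ' * p.1) * Real.exp (-σ * p.2)
      ≤ ∑ p ∈ antidiagonal M, Real.exp (-σ * M) * Real.exp (-δ * p.1) := by
        refine Finset.sum_le_sum fun p hp => ?_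
        rw [mem_antidiagonal] at hp
        rw [← Real.exp_add, ← Real.exp_add, Real.exp_le_exp, ← hp]
        push_cast
        nlinarith [(Nat.cast_nonneg p.1 : (0 : ℝ) ≤ p.1)]
    _ = ∑ m ∈ Finset.range (M + 1), Real.exp (-σ * M) * Real.exp (-δ * m) :=
        Finset.Nat.sum_antidiagonal_eq_sum_range_succ_mk
          (fun p : ℕ × ℕ => Real.exp (-σ * M) * Real.exp (-δ * p.1)) M
    _ ≤ _ := sum_le_hasSum _ (fun _ _ => by positivity) (hasSum_exp_neg_mul hδ _)

lemma exp_lt_one_of_neg {δ : ℝ} (hδ : 0 < δ) : 0 < 1 - Real.exp (-δ) := by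
  rw [sub_pos, Real.exp_lt_one_iff]; linarith

/-- The bracket of two cyclically symmetric functions with decaying seeds has a decaying seed,
with the slower of the two rates; the difference `δ` of the rates sums the convolution of the
exponentials. -/
lemma DecayingSeed.exists_poisson {d d' e : ℕ} {f g : PhasePoly N} {Cf Cg σ σ' δ : ℝ}
    (hf : DecayingSeed d f Cf σ') (hg : DecayingSeed d' g Cg σ) (he : d + d' = e + 2)
    (hδ : 0 < δ) (hσ : 0 < σ) (hσσ : σ + δ ≤ σ') :
    ∃ h, DecayingSeed e h (d * d' * Cf * Cg / (1 - Real.exp (-δ))) σ ∧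
      oplus h = poisson (oplus f) (oplus g) := by
  obtain ⟨F, hF, hfs⟩ := hf
  obtain ⟨G, hG, hgs⟩ := hg
  have hCf := hF.const_nonneg
  have hCg := hG.const_nonneg
  have hp : DecayingPieces e (d * d' * Cf * Cg / (1 - Real.exp (-δ))) σ (bracketPieces F G) := by
    refine ⟨isHomogeneous_bracketPieces hF.homogeneous hG.homogeneous he,
      fun M => bracketPieces_mem_sitesUpTo hF.range fun m _ => hG.range m, fun M => ?_⟩
    calc polyNorm (bracketPieces F G M)
        ≤ ∑ p ∈ antidiagonal M, d * d' * Cf * Cg *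
            (Real.exp (-σ' * p.1) * Real.exp (-σ * p.2)) := by
          refine (polyNorm_sum_le _ _).trans (Finset.sum_le_sum fun p _ => ?_)
          refine (polyNorm_seedBracket_le _ (hF.homogeneous _) (hG.homogeneous _)).trans ?_
          calc (d : ℝ) * d' * polyNorm (F p.1) * polyNorm (G p.2)
              ≤ d * d' * (Cf * Real.exp (-σ' * p.1)) * (Cg * Real.exp (-σ * p.2)) := by
                gcongr
                · exact polyNorm_nonneg _
                · exact hF.decay _
                · exact hG.decay _
            _ = _ := by ring
      _ ≤ d * d' * Cf * Cg * (Real.exp (-σ * M) / (1 - Real.exp (-δ))) := by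
          rw [← Finset.mul_sum]
          exact mul_le_mul_of_nonneg_left (sum_antidiagonal_exp_le hδ hσσ M) (by positivity)
      _ = _ := by ring
  obtain ⟨h, hh⟩ := hp.exists_sum hσ
  exact ⟨h, ⟨_, hp, hh⟩, oplus_eq_of_coeffSum_bracketPieces hF.homogeneous hG.homogeneous he hfs
    hgs hh⟩

end seeds

/-! ### The homological equation -/

section rotation
variable {N : ℕ}

/-- The polynomials that are homogeneous of degree `d` are preserved by a linear map as soon as
its effect on complex coefficients is a bounded multiplier; the bound carries over to the norm. -/
lemma polyNorm_le_of_coeff_le {f g : PhasePoly N} {d : ℕ} {c : ℝ} (hf : f.IsHomogeneous d)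
    (hg : g.IsHomogeneous d)
    (h : ∀ k : Var N →₀ ℕ, k.degree = d →
      ‖(complexHom N g).coeff k‖ ≤ c * ‖(complexHom N f).coeff k‖) :
    polyNorm g ≤ c * polyNorm f := by
  rw [polyNorm_eq_sum_degreeFinset hf, polyNorm_eq_sum_degreeFinset hg, Finset.mul_sum]
  exact Finset.sum_le_sum fun k hk => h k (mem_degreeFinset.mp hk)

lemma eq_of_complexHom_coeff_eq {f g : PhasePoly N} {d : ℕ} (hf : f.IsHomogeneous d)
    (hg : g.IsHomogeneous d)
    (h : ∀ k : Var N →₀ ℕ, k.degree = d →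
      (complexHom N f).coeff k = (complexHom N g).coeff k) : f = g := by
  have h0 : polyNorm (f - g) ≤ 0 * polyNorm (f - g) := by
    refine polyNorm_le_of_coeff_le (hf.sub hg) (hf.sub hg) fun k hk => ?_
    rw [map_sub, coeff_sub, h k hk, sub_self, norm_zero, mul_zero]
  refine sub_eq_zero.mp (MvPolynomial.ext _ _ fun k => ?_)
  have := abs_coeff_le_polyNorm (hf.sub hg) k
  rw [le_antisymm (by simpa using h0) (polyNorm_nonneg (f - g)), mul_zero] at this
  simpa using this

lemma coeff_X_mul_pderiv (v : Var N) (P : MvPolynomial (Var N) ℂ) (k : Var N →₀ ℕ) :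
    (X v * pderiv v P).coeff k = k v * P.coeff k := by
  classical
  induction P using MvPolynomial.induction_on' with
  | monomial m a =>
    rw [X_mul_pderiv_monomial, coeff_smul, coeff_monomial, nsmul_eq_mul]
    split_ifs with h
    · rw [h]
    · simp
  | add p q hp hq => rw [map_add, mul_add, coeff_add, hp, hq, coeff_add, mul_add]

/-- The difference of the degrees in `η` and in `ξ` of a monomial. -/
def rotWeight (k : Var N →₀ ℕ) : ℤ := ∑ j : Fin N, ((k (Sum.inr j) : ℤ) - k (Sum.inl j))

lemma exists_rotWeight_eq {s : ℕ} {k : Var N →₀ ℕ} (hk : k.degree = 2 * s + 2) :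
    ∃ m : ℤ, |m| ≤ (s + 1 : ℕ) ∧ rotWeight k = 2 * m := by
  have h1 : (∑ j : Fin N, (k (Sum.inl j) : ℤ)) + ∑ j : Fin N, (k (Sum.inr j) : ℤ) = 2 * s + 2 := by
    rw [Finsupp.degree_eq_sum, Fintype.sum_sum_type] at hk
    exact_mod_cast hk
  have h2 : 0 ≤ ∑ j : Fin N, (k (Sum.inl j) : ℤ) := Finset.sum_nonneg fun _ _ => by positivity
  have h3 : 0 ≤ ∑ j : Fin N, (k (Sum.inr j) : ℤ) := Finset.sum_nonneg fun _ _ => by positivity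
  refine ⟨∑ j : Fin N, (k (Sum.inr j) : ℤ) - (s + 1), ?_, ?_⟩
  · rw [abs_le]; push_cast; constructor <;> linarith
  · rw [rotWeight, Finset.sum_sub_distrib]; linarith

variable [NeZero N]

/-- The derivation `{H_Ω, ·}` as an endomorphism. -/
noncomputable def rotL (N : ℕ) [NeZero N] (Ω : ℝ) : Module.End ℝ (PhasePoly N) :=
  (poissonD (oplus (hOmega N Ω))).toLinearMap

lemma rotL_apply (Ω : ℝ) (f : PhasePoly N) : rotL N Ω f = poisson (oplus (hOmega N Ω)) f :=
  poissonD_apply _ _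

lemma isHomogeneous_hOmega (Ω : ℝ) : (hOmega N Ω).IsHomogeneous 2 := by
  have := (isHomogeneous_C (Var N) (Ω / 2)).mul
    (((isHomogeneous_X ℝ (Sum.inl 0 : Var N)).pow 2).add
      ((isHomogeneous_X ℝ (Sum.inr 0 : Var N)).pow 2))
  simpa [hOmega] using this

lemma complexHom_oplus_hOmega (Ω : ℝ) : complexHom N (oplus (hOmega N Ω)) =
    ∑ j : Fin N, C (Ω * Complex.I) * (X (Sum.inl j) * X (Sum.inr j)) := by
  rw [oplus, map_sum]
  refine Finset.sum_congr rfl fun j _ => ?_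
  have h : shiftBy j (hOmega N Ω) = C (Ω / 2) * (X (Sum.inl j) ^ 2 + X (Sum.inr j) ^ 2) := by
    simp [shiftBy, hOmega]
  rw [h, map_mul, map_add, map_pow, map_pow, complexHom_C, complexHom_X_inl, complexHom_X_inr]
  have hI : (C Complex.I * C Complex.I : MvPolynomial (Var N) ℂ) = -1 := by
    rw [← C_mul, Complex.I_mul_I]; simp
  have ha : (C ((1 / Real.sqrt 2 : ℝ) : ℂ) * C ((1 / Real.sqrt 2 : ℝ) : ℂ) :
      MvPolynomial (Var N) ℂ) * 2 = 1 := by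
    rw [← C_mul, inv_sqrt_two_mul_self, ← map_ofNat C 2, ← C_mul]
    norm_num
  have hΩ : (C ((Ω / 2 : ℝ) : ℂ) : MvPolynomial (Var N) ℂ) * 2 = C (Ω : ℂ) := by
    rw [← map_ofNat C 2, ← C_mul]
    congr 1
    push_cast
    ring
  rw [C_mul, C_mul, ← hΩ]
  set a : MvPolynomial (Var N) ℂ := C ((1 / Real.sqrt 2 : ℝ) : ℂ)
  set x : MvPolynomial (Var N) ℂ := X (Sum.inl j)
  set y : MvPolynomial (Var N) ℂ := X (Sum.inr j)
  set i : MvPolynomial (Var N) ℂ := C Complex.I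
  set w : MvPolynomial (Var N) ℂ := C ((Ω / 2 : ℝ) : ℂ)
  linear_combination (2 * w * i * x * y) * ha +
    w * a * a * (y * y + (x - i * y) * (x - i * y)) * hI - w * a * a * (y * y) * hI

/-- In the complex variables `{H_Ω, ·}` is diagonal on the monomials. -/
lemma coeff_complexHom_rotL (Ω : ℝ) (f : PhasePoly N) (k : Var N →₀ ℕ) :
    (complexHom N (rotL N Ω f)).coeff k =
      (Ω * Complex.I * rotWeight k) * (complexHom N f).coeff k := by
  classical
  rw [rotL_apply, complexHom_poisson, complexHom_oplus_hOmega]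
  have h1 : ∀ j : Fin N, pderiv (Sum.inl j) (∑ i : Fin N, C (Ω * Complex.I) *
      (X (Sum.inl i) * X (Sum.inr i)) : MvPolynomial (Var N) ℂ) =
        C (Ω * Complex.I) * X (Sum.inr j) := by
    intro j
    simp [pderiv_X, Pi.single_apply]
  have h2 : ∀ j : Fin N, pderiv (Sum.inr j) (∑ i : Fin N, C (Ω * Complex.I) *
      (X (Sum.inl i) * X (Sum.inr i)) : MvPolynomial (Var N) ℂ) =
        C (Ω * Complex.I) * X (Sum.inl j) := by
    intro j
    simp [pderiv_X, Pi.single_apply]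
  rw [coeff_sum, rotWeight]
  push_cast
  rw [Finset.mul_sum, Finset.sum_mul]
  refine Finset.sum_congr rfl fun j _ => ?_
  rw [h1, h2, coeff_sub, mul_assoc, mul_assoc, coeff_C_mul, coeff_C_mul, coeff_X_mul_pderiv,
    coeff_X_mul_pderiv]
  ring

lemma coeff_complexHom_aeval_rotL (Ω : ℝ) (q : Polynomial ℝ) (f : PhasePoly N)
    (k : Var N →₀ ℕ) : (complexHom N (Polynomial.aeval (rotL N Ω) q f)).coeff k =
      Polynomial.aeval (Ω * Complex.I * rotWeight k : ℂ) q * (complexHom N f).coeff k := by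
  induction q using Polynomial.induction_on' with
  | add p q hp hq =>
    rw [map_add, LinearMap.add_apply, map_add, coeff_add, hp, hq, map_add, add_mul]
  | monomial n a =>
    rw [Polynomial.aeval_monomial, Polynomial.aeval_monomial]
    have : ∀ n : ℕ, (complexHom N ((rotL N Ω ^ n) f)).coeff k =
        (Ω * Complex.I * rotWeight k) ^ n * (complexHom N f).coeff k := by
      intro n
      induction n with
      | zero => simp
      | succ n ih => rw [pow_succ', Module.End.mul_apply, coeff_complexHom_rotL, ih]; ring
    rw [Module.End.mul_apply, Module.algebraMap_end_apply, complexHom_smul, coeff_C_mul, this]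
    simp [mul_assoc]

lemma aeval_rotL_mem {Ω : ℝ} {W : Submodule ℝ (PhasePoly N)}
    (hW : ∀ f ∈ W, rotL N Ω f ∈ W) (q : Polynomial ℝ) {f : PhasePoly N} (hf : f ∈ W) :
    Polynomial.aeval (rotL N Ω) q f ∈ W := by
  induction q using Polynomial.induction_on' with
  | add p q hp hq =>
    rw [map_add, LinearMap.add_apply]
    exact W.add_mem hp hq
  | monomial n a =>
    have : ∀ n : ℕ, (rotL N Ω ^ n) f ∈ W := by
      intro n
      induction n with
      | zero => simpa
      | succ n ih => rw [pow_succ', Module.End.mul_apply]; exact hW _ ih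
    rw [Polynomial.aeval_monomial, Module.End.mul_apply, Module.algebraMap_end_apply]
    exact W.smul_mem _ (this n)

lemma commute_aeval_rotL {Ω : ℝ} {T : Module.End ℝ (PhasePoly N)} (h : Commute (rotL N Ω) T)
    (q : Polynomial ℝ) : Commute (Polynomial.aeval (rotL N Ω) q) T := by
  induction q using Polynomial.induction_on' with
  | add p q hp hq => rw [map_add]; exact hp.add_left hq
  | monomial n a =>
    rw [Polynomial.aeval_monomial]
    exact Commute.mul_left (Algebra.commutes a T) (h.pow_left n)

lemma rotL_mem_sitesUpTo (Ω : ℝ) {m : ℕ} {f : PhasePoly N} (hf : f ∈ sitesUpTo N m) :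
    rotL N Ω f ∈ sitesUpTo N m := by
  rw [rotL_apply, poisson_oplus_left]
  refine sum_mem fun l _ => ?_
  have h0 : hOmega N Ω ∈ supported ℝ {v : Var N | site v ∈ ({0} : Set (Fin N))} := by
    have hx : ∀ v : Var N, site v = 0 →
        (X v : PhasePoly N) ∈ supported ℝ {v : Var N | site v ∈ ({0} : Set (Fin N))} :=
      fun v hv => X_mem_supported.mpr hv
    exact mul_mem (Subalgebra.algebraMap_mem _ _)
      (add_mem (pow_mem (hx _ rfl) 2) (pow_mem (hx _ rfl) 2))
  have hl : shiftBy l (hOmega N Ω) ∈ supported ℝ {v : Var N | site v ∈ ({l} : Set (Fin N))} :=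
    shiftBy_mem_supported (fun j hj => by
      rw [Set.mem_singleton_iff] at hj ⊢; rw [hj, zero_add]) h0
  by_cases hlm : (l : ℕ) ≤ m
  · refine poisson_mem_supported (supported_mono (fun v hv => ?_) hl) hf
    have : site v = l := hv
    change (site v : ℕ) ≤ m
    rwa [this]
  · have hf' : f ∈ supported ℝ {v : Var N | site v ∈ {j : Fin N | (j : ℕ) ≤ m}} := hf
    rw [poisson_eq_zero_of_disjoint (Set.disjoint_singleton_left.mpr hlm) hl hf']
    exact zero_mem _

lemma isHomogeneous_rotL (Ω : ℝ) {f : PhasePoly N} {d : ℕ} (hf : f.IsHomogeneous d) :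
    (rotL N Ω f).IsHomogeneous d := by
  rw [rotL_apply]
  exact isHomogeneous_poisson (isHomogeneous_oplus (isHomogeneous_hOmega Ω)) hf (by omega)

lemma oplus_poisson_oplus (h f : PhasePoly N) :
    oplus (poisson (oplus h) f) = poisson (oplus h) (oplus f) := by
  conv_rhs => rw [oplus.eq_def f, poisson_sum_right]
  exact Finset.sum_congr rfl fun l _ => by rw [shiftBy_poisson, shiftBy_oplus]

lemma commute_rotL_oplusL (Ω : ℝ) : Commute (rotL N Ω) (oplusL N) := by
  refine LinearMap.ext fun f => ?_
  rw [Module.End.mul_apply, Module.End.mul_apply, oplusL_apply, oplusL_apply, rotL_apply,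
    rotL_apply, oplus_poisson_oplus]

/-- A real polynomial that takes the value `1/λ` at the nonzero eigenvalues `λ = 2 i Ω m` of
`{H_Ω, ·}` on polynomials of degree `2s+2`, and vanishes at `0`. -/
lemma exists_interpolation {Ω : ℝ} (hΩ : 0 < Ω) (n : ℕ) : ∃ q : Polynomial ℝ, ∀ m : ℤ, |m| ≤ n →
    Polynomial.aeval (Ω * Complex.I * (2 * m : ℤ) : ℂ) q =
      if m = 0 then 0 else 1 / (Ω * Complex.I * (2 * m : ℤ) : ℂ) := by
  classical
  let t : ℕ → ℝ := fun m => -(2 * Ω * m) ^ 2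
  let Q := Lagrange.interpolate (Finset.Icc 1 n) t (fun m => 1 / t m)
  have hinj : Set.InjOn t (Finset.Icc 1 n : Finset ℕ) := by
    intro a _ b _ hab
    have h1 : (2 * Ω * (a : ℝ)) ^ 2 = (2 * Ω * b) ^ 2 := by simpa [t] using hab
    have h2 := (pow_left_inj₀ (by positivity) (by positivity) two_ne_zero).mp h1
    have h3 := mul_left_cancel₀ (by positivity) h2
    exact_mod_cast h3
  refine ⟨Polynomial.X * Q.comp (Polynomial.X ^ 2), fun m hm => ?_⟩
  split_ifs with h0
  · simp [h0]
  · have hm1 : m.natAbs ∈ Finset.Icc 1 n := by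
      rw [Int.abs_eq_natAbs] at hm
      rw [Finset.mem_Icc]; omega
    have hsq : (Ω * Complex.I * (2 * m : ℤ) : ℂ) ^ 2 = algebraMap ℝ ℂ (t m.natAbs) := by
      have h1 : t m.natAbs = -(2 * Ω * m) ^ 2 := by
        simp only [t]
        rw [mul_pow, mul_pow _ (m : ℝ), Nat.cast_natAbs]
        simp
      rw [h1, Complex.coe_algebraMap]
      push_cast
      rw [mul_pow, mul_pow, Complex.I_sq]
      ring
    have hev : Polynomial.eval (t m.natAbs) Q = 1 / t m.natAbs :=
      Lagrange.eval_interpolate_at_node _ hinj hm1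
    rw [map_mul, Polynomial.aeval_X, Polynomial.aeval_comp, map_pow, Polynomial.aeval_X, hsq,
      Polynomial.aeval_algebraMap_apply, Polynomial.coe_aeval_eq_eval, hev, map_div₀, ← hsq,
      map_one]
    have hne : (Ω * Complex.I * (2 * m : ℤ) : ℂ) ≠ 0 := by
      have : (Ω : ℂ) ≠ 0 := by exact_mod_cast hΩ.ne'
      have : (m : ℂ) ≠ 0 := by exact_mod_cast h0
      push_cast
      simp [*]
    field_simp

/-- The pseudo-inverse of `{H_Ω, ·}` on polynomials of degree `2s+2`. It is a polynomial in
`{H_Ω, ·}`, hence commutes with everything that commutes with `{H_Ω, ·}`. Since the degree is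
even, the nonzero eigenvalues of `{H_Ω, ·}` are at least `2Ω` in absolute value. -/
lemma exists_rotL_pseudoinverse {Ω : ℝ} (hΩ : 0 < Ω) (s : ℕ) : ∃ G : Module.End ℝ (PhasePoly N),
    (∀ f : PhasePoly N, f.IsHomogeneous (2 * s + 2) → (G f).IsHomogeneous (2 * s + 2)) ∧
    (∀ m, ∀ f ∈ sitesUpTo N m, G f ∈ sitesUpTo N m) ∧
    (∀ T, Commute (rotL N Ω) T → Commute G T) ∧
    (∀ f : PhasePoly N, f.IsHomogeneous (2 * s + 2) →
      polyNorm (G f) ≤ 1 / (2 * Ω) * polyNorm f ∧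
      polyNorm (rotL N Ω (G f)) ≤ polyNorm f ∧
      polyNorm (f - rotL N Ω (G f)) ≤ polyNorm f ∧
      rotL N Ω (G (G f)) = G f ∧
      rotL N Ω (f - rotL N Ω (G f)) = 0) := by
  obtain ⟨q, hq⟩ := exists_interpolation hΩ (s + 1)
  have hhom : ∀ f : PhasePoly N, f.IsHomogeneous (2 * s + 2) →
      (Polynomial.aeval (rotL N Ω) q f).IsHomogeneous (2 * s + 2) := fun f hf =>
    aeval_rotL_mem (W := homogeneousSubmodule _ _ _) (fun f hf => isHomogeneous_rotL Ω hf) q hf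
  refine ⟨Polynomial.aeval (rotL N Ω) q, hhom, fun m f hf =>
    aeval_rotL_mem (W := (sitesUpTo N m).toSubmodule) (fun f hf => rotL_mem_sitesUpTo Ω hf) q hf,
    fun T hT => commute_aeval_rotL hT q, fun f hf => ?_⟩
  have hG := hhom f hf
  have hLG := isHomogeneous_rotL Ω hG
  -- the two possible values of the multiplier on a monomial
  have key : ∀ k : Var N →₀ ℕ, k.degree = 2 * s + 2 →
      ((Ω * Complex.I * rotWeight k : ℂ) = 0 ∧
        Polynomial.aeval (Ω * Complex.I * rotWeight k : ℂ) q = 0) ∨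
      ((Ω * Complex.I * rotWeight k : ℂ) * Polynomial.aeval (Ω * Complex.I * rotWeight k : ℂ) q = 1
        ∧ ‖Polynomial.aeval (Ω * Complex.I * rotWeight k : ℂ) q‖ ≤ 1 / (2 * Ω)) := by
    intro k hk
    obtain ⟨m, hm, hw⟩ := exists_rotWeight_eq hk
    have := hq m hm
    rw [hw, this]
    split_ifs with h0
    · left; simp [h0]
    · right
      have hne : (Ω * Complex.I * (2 * m : ℤ) : ℂ) ≠ 0 := by
        have : (Ω : ℂ) ≠ 0 := by exact_mod_cast hΩ.ne'
        have : (m : ℂ) ≠ 0 := by exact_mod_cast h0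
        push_cast
        simp [*]
      refine ⟨mul_one_div_cancel hne, ?_⟩
      rw [norm_div, norm_one]
      refine one_div_le_one_div_of_le (by positivity) ?_
      have h1 : (1 : ℝ) ≤ |(m : ℝ)| := by exact_mod_cast Int.one_le_abs h0
      rw [norm_mul, norm_mul, Complex.norm_I, Complex.norm_real, Real.norm_of_nonneg hΩ.le,
        Complex.norm_intCast]
      push_cast
      rw [abs_mul, abs_two]
      nlinarith
  refine ⟨polyNorm_le_of_coeff_le hf hG fun k hk => ?_, ?_, ?_, ?_, ?_⟩
  · rw [coeff_complexHom_aeval_rotL, norm_mul]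
    refine mul_le_mul_of_nonneg_right ?_ (norm_nonneg _)
    rcases key k hk with ⟨-, h⟩ | ⟨-, h⟩
    · rw [h, norm_zero]; positivity
    · exact h
  · rw [← one_mul (polyNorm f)]
    refine polyNorm_le_of_coeff_le hf hLG fun k hk => ?_
    rw [coeff_complexHom_rotL, coeff_complexHom_aeval_rotL, ← mul_assoc, norm_mul]
    refine mul_le_mul_of_nonneg_right ?_ (norm_nonneg _)
    rcases key k hk with ⟨-, h⟩ | ⟨h, -⟩ <;> simp [h]
  · rw [← one_mul (polyNorm f)]
    refine polyNorm_le_of_coeff_le hf (hf.sub hLG) fun k hk => ?_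
    rw [map_sub, coeff_sub, coeff_complexHom_rotL, coeff_complexHom_aeval_rotL, ← mul_assoc]
    rcases key k hk with ⟨-, h⟩ | ⟨h, -⟩ <;> simp [h]
  · refine eq_of_complexHom_coeff_eq (isHomogeneous_rotL Ω (hhom _ hG)) hG fun k hk => ?_
    rw [coeff_complexHom_rotL, coeff_complexHom_aeval_rotL, coeff_complexHom_aeval_rotL,
      ← mul_assoc]
    rcases key k hk with ⟨-, h⟩ | ⟨h, -⟩ <;> simp [h]
  · refine eq_of_complexHom_coeff_eq (isHomogeneous_rotL Ω (hf.sub hLG))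
      (isHomogeneous_zero _ _ _) fun k hk => ?_
    rw [coeff_complexHom_rotL, map_sub, coeff_sub, coeff_complexHom_rotL,
      coeff_complexHom_aeval_rotL, ← mul_assoc]
    rcases key k hk with ⟨h, -⟩ | ⟨h, -⟩ <;> simp [h]

/-- A convolution as in `sum_antidiagonal_exp_le` without its term of order zero. -/
lemma sum_antidiagonal_exp_le_of_zero {z : ℕ → ℝ} {Cz σ σ₀ : ℝ} (hCz : 0 ≤ Cz) (hσ : σ < σ₀)
    (hz0 : z 0 = 0) (hz : ∀ m, z m ≤ Cz * Real.exp (-σ₀ * m)) (M : ℕ) :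
    ∑ p ∈ antidiagonal M, z p.1 * Real.exp (-σ * p.2) ≤
      Cz * (Real.exp (-(σ₀ - σ)) / (1 - Real.exp (-(σ₀ - σ)))) * Real.exp (-σ * M) := by
  set x := Real.exp (-(σ₀ - σ)) with hx
  have hx1 : x < 1 := by rw [hx, Real.exp_lt_one_iff]; linarith
  have hx0 : 0 ≤ x := Real.exp_nonneg _
  calc ∑ p ∈ antidiagonal M, z p.1 * Real.exp (-σ * p.2)
      = ∑ m ∈ Finset.range (M + 1), z m * Real.exp (-σ * (M - m : ℕ)) :=
        Finset.Nat.sum_antidiagonal_eq_sum_range_succ_mk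
          (fun p : ℕ × ℕ => z p.1 * Real.exp (-σ * p.2)) M
    _ = ∑ m ∈ Finset.range M, z (m + 1) * Real.exp (-σ * (M - (m + 1) : ℕ)) := by
        rw [Finset.sum_range_succ', hz0, zero_mul, add_zero]
    _ ≤ ∑ m ∈ Finset.range M, Cz * Real.exp (-σ * M) * x * x ^ m := by
        refine Finset.sum_le_sum fun m hm => ?_
        have hm' : m + 1 ≤ M := Finset.mem_range.mp hm
        refine (mul_le_mul_of_nonneg_right (hz _) (Real.exp_nonneg _)).trans (le_of_eq ?_)
        rw [mul_assoc, mul_assoc, mul_assoc, ← pow_succ', hx, ← Real.exp_nat_mul, ← Real.exp_add,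
          ← Real.exp_add, Nat.cast_sub hm']
        congr 2
        push_cast
        ring
    _ ≤ Cz * Real.exp (-σ * M) * x * (1 - x)⁻¹ := by
        rw [← Finset.mul_sum]
        refine mul_le_mul_of_nonneg_left ?_ (by positivity)
        exact sum_le_hasSum _ (fun _ _ => by positivity) (hasSum_geometric_of_lt_one hx0 hx1)
    _ = _ := by ring

lemma seedBracket_zero_left (m : ℕ) (g : PhasePoly N) : seedBracket m 0 g = 0 := by
  simp [seedBracket, shiftBy_eq]

/-- The fixed-point equation `K M = -G (F M + [Z, K] M)` is triangular because `Z 0 = 0`. -/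
lemma exists_homologicalPieces (G : Module.End ℝ (PhasePoly N)) (F Z : ℕ → PhasePoly N)
    (hZ : Z 0 = 0) : ∃ K : ℕ → PhasePoly N, ∀ M, K M = -G (F M + bracketPieces Z K M) := by
  let K : ℕ → PhasePoly N := WellFounded.fix (C := fun _ => PhasePoly N) Nat.lt_wfRel.wf
    fun M K => -G (F M + ∑ m : Fin M, seedBracket (M - m) (Z (M - m)) (K m m.2))
  refine ⟨K, fun M => ?_⟩
  have h1 : K M = -G (F M + ∑ m : Fin M, seedBracket (M - m) (Z (M - m)) (K m)) := by
    simp only [K]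
    rw [WellFounded.fix_eq]
  have h2 : bracketPieces Z K M = ∑ m : Fin M, seedBracket (M - m) (Z (M - m)) (K m) := by
    rw [bracketPieces, ← Finset.Nat.sum_antidiagonal_swap,
      Finset.Nat.sum_antidiagonal_eq_sum_range_succ_mk, Finset.sum_range_succ, Finset.sum_range]
    simp [hZ, seedBracket_zero_left]
  rw [h2, ← h1]

/-- Solution of the homological equation `Z + {X, H_Ω + Z₀} = Ψ` with `{H_Ω, Z} = 0` in terms of
seeds. The rate of decay is kept because the rate of `ζ₀` is strictly larger. -/
theorem DecayingSeed.exists_homological {Ω Cz σ₀ σ A B : ℝ} {s : ℕ} {ζ₀ ψ : PhasePoly N}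
    {Z : ℕ → PhasePoly N} (hΩ : 0 < Ω) (hZ : DecayingPieces 2 Cz σ₀ Z) (hZ0 : Z 0 = 0)
    (hζ₀ : CoeffSum Z ζ₀) (hcomm : poisson (oplus (hOmega N Ω)) (oplus ζ₀) = 0)
    (hψ : DecayingSeed (2 * s + 2) ψ A σ) (hσ : 0 < σ) (hσσ : σ < σ₀) (hB : 0 ≤ B)
    (hAB : A + 2 * (2 * s + 2) * Cz *
      (Real.exp (-(σ₀ - σ)) / (1 - Real.exp (-(σ₀ - σ)))) * B ≤ 2 * Ω * B) :
    ∃ χ ζ : PhasePoly N, DecayingSeed (2 * s + 2) χ B σ ∧ DecayingSeed (2 * s + 2) ζ A σ ∧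
      DecayingSeed (2 * s + 2) (ψ - ζ) A σ ∧ poisson (oplus (hOmega N Ω)) (oplus ζ) = 0 ∧
      poisson (oplus χ) (oplus (hOmega N Ω) + oplus ζ₀) = oplus (ψ - ζ) := by
  obtain ⟨G, hGhom, hGsite, hGcomm, hG⟩ := exists_rotL_pseudoinverse (N := N) hΩ s
  have hψh := hψ.isHomogeneous
  obtain ⟨F, hF, hFs⟩ := hψ
  obtain ⟨K, hK⟩ := exists_homologicalPieces G F Z hZ0
  set κ := Real.exp (-(σ₀ - σ)) / (1 - Real.exp (-(σ₀ - σ))) with hκ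
  have hA := hF.const_nonneg
  have hCz := hZ.const_nonneg
  have hKall : ∀ M, (K M).IsHomogeneous (2 * s + 2) ∧ K M ∈ sitesUpTo N M ∧
      polyNorm (K M) ≤ B * Real.exp (-σ * M) := by
    intro M
    induction M using Nat.strong_induction_on with
    | _ M ih =>
    have hterm : ∀ p ∈ antidiagonal M,
        (seedBracket p.1 (Z p.1) (K p.2)).IsHomogeneous (2 * s + 2) ∧
        seedBracket p.1 (Z p.1) (K p.2) ∈ sitesUpTo N M ∧
        polyNorm (seedBracket p.1 (Z p.1) (K p.2)) ≤
          2 * (2 * s + 2) * B * (polyNorm (Z p.1) * Real.exp (-σ * p.2)) := by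
      intro p hp
      rw [mem_antidiagonal] at hp
      rcases Nat.eq_zero_or_pos p.1 with h0 | h0
      · rw [h0, hZ0, seedBracket_zero_left]
        exact ⟨isHomogeneous_zero _ _ _, zero_mem _, by simp⟩
      · obtain ⟨h1, h2, h3⟩ := ih p.2 (by omega)
        refine ⟨isHomogeneous_seedBracket _ (hZ.homogeneous _) h1 (by omega), ?_, ?_⟩
        · have := seedBracket_mem_sitesUpTo (hZ.range p.1) h2
          rwa [hp] at this
        · refine (polyNorm_seedBracket_le _ (hZ.homogeneous _) h1).trans ?_
          calc ((2 : ℕ) : ℝ) * (2 * s + 2 : ℕ) * polyNorm (Z p.1) * polyNorm (K p.2)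
              ≤ ((2 : ℕ) : ℝ) * (2 * s + 2 : ℕ) * polyNorm (Z p.1) *
                (B * Real.exp (-σ * p.2)) :=
              mul_le_mul_of_nonneg_left h3 (mul_nonneg (by positivity) (polyNorm_nonneg _))
            _ = _ := by push_cast; ring
    have hbr : (bracketPieces Z K M).IsHomogeneous (2 * s + 2) :=
      IsHomogeneous.sum _ _ _ fun p hp => (hterm p hp).1
    have hsum : (F M + bracketPieces Z K M).IsHomogeneous (2 * s + 2) :=
      (hF.homogeneous M).add hbr
    refine ⟨?_, ?_, ?_⟩
    · rw [hK M]
      exact (hGhom _ hsum).neg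
    · rw [hK M]
      exact neg_mem (hGsite _ _ (add_mem (hF.range M) (sum_mem fun p hp => (hterm p hp).2.1)))
    · have hb := sum_antidiagonal_exp_le_of_zero hCz hσσ (z := fun m => polyNorm (Z m))
        (by simp [hZ0]) hZ.decay M
      have hbn : polyNorm (bracketPieces Z K M) ≤
          2 * (2 * s + 2) * B * (Cz * κ * Real.exp (-σ * M)) := by
        refine (polyNorm_sum_le _ _).trans
          ((Finset.sum_le_sum fun p hp => (hterm p hp).2.2).trans ?_)
        rw [← Finset.mul_sum]
        exact mul_le_mul_of_nonneg_left hb (by positivity)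
      rw [hK M, polyNorm_neg]
      refine ((hG _ hsum).1).trans ?_
      rw [one_div, inv_mul_le_iff₀ (by positivity)]
      calc polyNorm (F M + bracketPieces Z K M)
          ≤ A * Real.exp (-σ * M) + 2 * (2 * s + 2) * B * (Cz * κ * Real.exp (-σ * M)) :=
            (polyNorm_add_le _ _).trans (add_le_add (hF.decay M) hbn)
        _ = (A + 2 * (2 * s + 2) * Cz * κ * B) * Real.exp (-σ * M) := by ring
        _ ≤ (2 * Ω * B) * Real.exp (-σ * M) :=
            mul_le_mul_of_nonneg_right hAB (Real.exp_nonneg _)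
        _ = _ := by ring
  have hKp : DecayingPieces (2 * s + 2) B σ K :=
    ⟨fun M => (hKall M).1, fun M => (hKall M).2.1, fun M => (hKall M).2.2⟩
  obtain ⟨χ, hχ⟩ := hKp.exists_sum hσ
  have hbrhom := isHomogeneous_bracketPieces (e := 2 * s + 2) hZ.homogeneous hKp.homogeneous
    (by omega)
  -- the pieces of `{Z₀, χ^⊕}` can be summed because they occur in the fixed-point equation
  have hbr : DecayingPieces (2 * s + 2) (2 * (2 * s + 2) * B * (Cz * κ)) σ
      (bracketPieces Z K) := by
    refine ⟨hbrhom, fun M => bracketPieces_mem_sitesUpTo hZ.range fun m _ => hKp.range m,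
      fun M => ?_⟩
    have hb := sum_antidiagonal_exp_le_of_zero hCz hσσ (z := fun m => polyNorm (Z m))
      (by simp [hZ0]) hZ.decay M
    calc polyNorm (bracketPieces Z K M)
        ≤ ∑ p ∈ antidiagonal M, 2 * (2 * s + 2) * B *
            (polyNorm (Z p.1) * Real.exp (-σ * p.2)) := by
          refine (polyNorm_sum_le _ _).trans (Finset.sum_le_sum fun p _ => ?_)
          refine (polyNorm_seedBracket_le _ (hZ.homogeneous _) (hKp.homogeneous _)).trans ?_
          calc ((2 : ℕ) : ℝ) * (2 * s + 2 : ℕ) * polyNorm (Z p.1) * polyNorm (K p.2)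
              ≤ ((2 : ℕ) : ℝ) * (2 * s + 2 : ℕ) * polyNorm (Z p.1) *
                (B * Real.exp (-σ * p.2)) :=
              mul_le_mul_of_nonneg_left (hKp.decay _)
                (mul_nonneg (by positivity) (polyNorm_nonneg _))
            _ = _ := by push_cast; ring
      _ ≤ 2 * (2 * s + 2) * B * (Cz * κ * Real.exp (-σ * M)) := by
          rw [← Finset.mul_sum]
          exact mul_le_mul_of_nonneg_left hb (by positivity)
      _ = _ := by ring
  obtain ⟨b, hb⟩ := hbr.exists_sum hσ
  have hbo : oplus b = poisson (oplus ζ₀) (oplus χ) :=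
    oplus_eq_of_coeffSum_bracketPieces (e := 2 * s + 2) hZ.homogeneous hKp.homogeneous (by omega) hζ₀ hχ hb
  have hbh := hb.isHomogeneous hbrhom
  have hχeq : χ = -G (ψ + b) := by
    refine hχ.unique ?_
    have := (hFs.add hb).map (fun M => (hF.homogeneous M).add (hbrhom M)) (-G)
    refine fun k => (this k).congr_fun fun M => ?_
    rw [hK M]; rfl
  set L := rotL N Ω with hL
  have hGo : ∀ f, oplus (G f) = G (oplus f) := fun f => by
    have := congrArg (fun T => T f) (hGcomm _ (commute_rotL_oplusL Ω)).eq
    simpa [oplusL_apply] using this.symm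
  have hLo : ∀ f, oplus (L f) = L (oplus f) := fun f => by
    have := congrArg (fun T => T f) (commute_rotL_oplusL (N := N) Ω).eq
    simpa [oplusL_apply] using this.symm
  have hLT : Commute L (poissonD (oplus ζ₀)).toLinearMap := by
    refine LinearMap.ext fun f => ?_
    change L (poissonD (oplus ζ₀) f) = poissonD (oplus ζ₀) (L f)
    rw [poissonD_apply, poissonD_apply, hL, rotL_apply, rotL_apply, poisson_jacobi, hcomm,
      poisson_zero_left, zero_add]
  have hLTf : ∀ f, L (poisson (oplus ζ₀) f) = poisson (oplus ζ₀) (L f) := fun f => by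
    have := congrArg (fun T => T f) hLT.eq
    simpa [poissonD_apply] using this
  have hGTf : ∀ f, G (poisson (oplus ζ₀) f) = poisson (oplus ζ₀) (G f) := fun f => by
    have := congrArg (fun T => T f) (hGcomm _ hLT).eq
    simpa [poissonD_apply] using this
  have hLGχ : L (G χ) = χ := by
    rw [hχeq, map_neg, map_neg, (hG _ (hψh.add hbh)).2.2.2.1]
  refine ⟨χ, ψ - L (G ψ), ⟨K, hKp, hχ⟩, ⟨fun M => F M - L (G (F M)), ⟨fun M => ?_, fun M => ?_,
    fun M => ?_⟩, ?_⟩, ⟨fun M => L (G (F M)), ⟨fun M => ?_, fun M => ?_, fun M => ?_⟩, ?_⟩, ?_, ?_⟩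
  · exact (hF.homogeneous M).sub (isHomogeneous_rotL Ω (hGhom _ (hF.homogeneous M)))
  · exact sub_mem (hF.range M) (rotL_mem_sitesUpTo Ω (hGsite _ _ (hF.range M)))
  · exact ((hG _ (hF.homogeneous M)).2.2.1).trans (hF.decay M)
  · exact hFs.map hF.homogeneous (1 - L * G)
  · exact isHomogeneous_rotL Ω (hGhom _ (hF.homogeneous M))
  · exact rotL_mem_sitesUpTo Ω (hGsite _ _ (hF.range M))
  · exact ((hG _ (hF.homogeneous M)).2.1).trans (hF.decay M)
  · rw [sub_sub_cancel]
    exact hFs.map hF.homogeneous (L * G)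
  · rw [← rotL_apply, ← hL, ← hLo, (hG _ hψh).2.2.2.2]
    simp [oplus, shiftBy_eq]
  · have h1 : L (oplus χ) = -oplus (L (G ψ)) - poisson (oplus ζ₀) (oplus χ) := by
      have h2 : L (oplus χ) = -oplus (L (G ψ)) - oplus (L (G b)) := by
        have h3 : L χ = -L (G ψ) - L (G b) := by
          conv_lhs => rw [hχeq]
          rw [map_neg, map_add, map_add, neg_add, sub_eq_add_neg]
        rw [← hLo, h3, ← oplusL_apply, map_sub, map_neg, oplusL_apply, oplusL_apply]
      rw [h2, hLo (G b), hGo b, hbo, hGTf, hLTf, ← hGo, ← hLo, hLGχ]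
    rw [sub_sub_cancel, poisson_add_right, poisson_antisymm _ (oplus (hOmega N Ω)),
      poisson_antisymm _ (oplus ζ₀), ← rotL_apply, ← hL, h1]
    abel

end rotation

/-! ### The algebra of the Lie transform -/

section antidiagonal
variable {M : Type*} [AddCommMonoid M]

lemma sum_antidiagonal_assoc (T : ℕ → ℕ → ℕ → M) (n : ℕ) :
    ∑ p ∈ antidiagonal n, ∑ q ∈ antidiagonal p.2, T p.1 q.1 q.2 =
      ∑ p ∈ antidiagonal n, ∑ q ∈ antidiagonal p.1, T q.1 q.2 p.2 := by
  rw [Finset.sum_sigma', Finset.sum_sigma']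
  refine Finset.sum_nbij' (fun x => ⟨(x.1.1 + x.2.1, x.2.2), (x.1.1, x.2.1)⟩)
    (fun x => ⟨(x.2.1, x.2.2 + x.1.2), (x.2.2, x.1.2)⟩) ?_ ?_ ?_ ?_ ?_
  all_goals
    rintro ⟨⟨a, b⟩, c, d⟩ h
    simp only [Finset.mem_sigma, mem_antidiagonal] at h
    obtain ⟨h1, h2⟩ := h
    subst h2
    simp [← h1, add_assoc]

lemma sum_antidiagonal_left_comm (T : ℕ → ℕ → ℕ → M) (n : ℕ) :
    ∑ p ∈ antidiagonal n, ∑ q ∈ antidiagonal p.2, T p.1 q.1 q.2 =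
      ∑ p ∈ antidiagonal n, ∑ q ∈ antidiagonal p.2, T q.1 p.1 q.2 := by
  rw [Finset.sum_sigma', Finset.sum_sigma']
  refine Finset.sum_nbij' (fun x => ⟨(x.2.1, x.1.1 + x.2.2), (x.1.1, x.2.2)⟩)
    (fun x => ⟨(x.2.1, x.1.1 + x.2.2), (x.1.1, x.2.2)⟩) ?_ ?_ ?_ ?_ ?_
  all_goals
    rintro ⟨⟨a, b⟩, c, d⟩ h
    simp only [Finset.mem_sigma, mem_antidiagonal] at h
    obtain ⟨h1, h2⟩ := h
    subst h2
    simp [← h1, add_left_comm]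

end antidiagonal

section lie
variable {N : ℕ} (𝒳 : ℕ → PhasePoly N)

lemma lieE_zero (f : PhasePoly N) : lieE 𝒳 0 f = f := by rw [lieE]
lemma lieD_zero (f : PhasePoly N) : lieD 𝒳 0 f = f := by rw [lieD]

lemma lieE_eq {s : ℕ} (hs : s ≠ 0) (f : PhasePoly N) : lieE 𝒳 s f =
    ∑ p ∈ antidiagonal s, ((p.1 : ℝ) / s) • poisson (𝒳 p.1) (lieE 𝒳 p.2 f) := by
  obtain ⟨s, rfl⟩ := Nat.exists_eq_succ_of_ne_zero hs
  rw [lieE, Finset.Nat.sum_antidiagonal_succ, Finset.Nat.sum_antidiagonal_eq_sum_range_succ_mk,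
    Finset.sum_range]
  simp

lemma lieD_eq {s : ℕ} (hs : s ≠ 0) (f : PhasePoly N) : lieD 𝒳 s f =
    -∑ p ∈ antidiagonal s, ((p.1 : ℝ) / s) • lieD 𝒳 p.2 (poisson (𝒳 p.1) f) := by
  obtain ⟨s, rfl⟩ := Nat.exists_eq_succ_of_ne_zero hs
  rw [lieD, Finset.Nat.sum_antidiagonal_succ, Finset.Nat.sum_antidiagonal_eq_sum_range_succ_mk,
    Finset.sum_range]
  simp

lemma smul_lieE (s : ℕ) (f : PhasePoly N) : (s : ℝ) • lieE 𝒳 s f =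
    ∑ p ∈ antidiagonal s, (p.1 : ℝ) • poisson (𝒳 p.1) (lieE 𝒳 p.2 f) := by
  rcases eq_or_ne s 0 with rfl | hs
  · simp
  · rw [lieE_eq 𝒳 hs, Finset.smul_sum]
    refine Finset.sum_congr rfl fun p _ => ?_
    rw [smul_smul, mul_div_cancel₀ _ (Nat.cast_ne_zero.mpr hs)]

lemma smul_lieD (s : ℕ) (f : PhasePoly N) : (s : ℝ) • lieD 𝒳 s f =
    -∑ p ∈ antidiagonal s, (p.1 : ℝ) • lieD 𝒳 p.2 (poisson (𝒳 p.1) f) := by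
  rcases eq_or_ne s 0 with rfl | hs
  · simp
  · rw [lieD_eq 𝒳 hs, smul_neg, Finset.smul_sum]
    refine congrArg _ (Finset.sum_congr rfl fun p _ => ?_)
    rw [smul_smul, mul_div_cancel₀ _ (Nat.cast_ne_zero.mpr hs)]

/-- In the recursions for `E_s` and `D_s` only pairs `(j, i)` with `j ≥ 1`, hence `i < s`,
contribute. -/
lemma sum_antidiagonal_smul_congr {s : ℕ} {F G : ℕ × ℕ → PhasePoly N} (c : ℝ)
    (h : ∀ p ∈ antidiagonal s, p.2 < s → F p = G p) :
    ∑ p ∈ antidiagonal s, ((p.1 : ℝ) / c) • F p = ∑ p ∈ antidiagonal s, ((p.1 : ℝ) / c) • G p := by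
  refine Finset.sum_congr rfl fun p hp => ?_
  rcases Nat.eq_zero_or_pos p.1 with h0 | h0
  · simp [h0]
  · rw [h p hp (by rw [mem_antidiagonal] at hp; omega)]

lemma lieE_add (s : ℕ) (f g : PhasePoly N) :
    lieE 𝒳 s (f + g) = lieE 𝒳 s f + lieE 𝒳 s g := by
  induction s using Nat.strong_induction_on with
  | _ s ih =>
  rcases eq_or_ne s 0 with rfl | hs
  · simp [lieE_zero]
  · rw [lieE_eq 𝒳 hs, lieE_eq 𝒳 hs f, lieE_eq 𝒳 hs g, ← Finset.sum_add_distrib]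
    simp only [← smul_add, ← poisson_add_right]
    exact sum_antidiagonal_smul_congr _ fun p _ h => by rw [ih _ h]

lemma lieD_add (s : ℕ) (f g : PhasePoly N) :
    lieD 𝒳 s (f + g) = lieD 𝒳 s f + lieD 𝒳 s g := by
  induction s using Nat.strong_induction_on generalizing f g with
  | _ s ih =>
  rcases eq_or_ne s 0 with rfl | hs
  · simp [lieD_zero]
  · rw [lieD_eq 𝒳 hs, lieD_eq 𝒳 hs f, lieD_eq 𝒳 hs g, ← neg_add, ← Finset.sum_add_distrib]
    simp only [← smul_add, poisson_add_right]
    exact congrArg _ (sum_antidiagonal_smul_congr _ fun p _ h => by rw [ih _ h])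

lemma lieD_smul (s : ℕ) (c : ℝ) (f : PhasePoly N) : lieD 𝒳 s (c • f) = c • lieD 𝒳 s f := by
  induction s using Nat.strong_induction_on generalizing f with
  | _ s ih =>
  rcases eq_or_ne s 0 with rfl | hs
  · simp [lieD_zero]
  · rw [lieD_eq 𝒳 hs, lieD_eq 𝒳 hs f, smul_neg, Finset.smul_sum]
    simp only [smul_comm c, poisson_smul_right]
    exact congrArg _ (sum_antidiagonal_smul_congr _ fun p _ h => by rw [ih _ h])

/-- `D_s` as a linear map. -/
noncomputable def lieDL (s : ℕ) : PhasePoly N →ₗ[ℝ] PhasePoly N where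
  toFun := lieD 𝒳 s
  map_add' := lieD_add 𝒳 s
  map_smul' := lieD_smul 𝒳 s

lemma lieD_sum {ι : Type*} (s : ℕ) (t : Finset ι) (f : ι → PhasePoly N) :
    lieD 𝒳 s (∑ i ∈ t, f i) = ∑ i ∈ t, lieD 𝒳 s (f i) := map_sum (lieDL 𝒳 s) f t

lemma lieD_map_zero (s : ℕ) : lieD 𝒳 s 0 = 0 := map_zero (lieDL 𝒳 s)

lemma lieD_congr {𝒴 : ℕ → PhasePoly N} {s : ℕ} (h : ∀ j, 1 ≤ j → j ≤ s → 𝒳 j = 𝒴 j)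
    (f : PhasePoly N) : lieD 𝒳 s f = lieD 𝒴 s f := by
  induction s using Nat.strong_induction_on generalizing f with
  | _ s ih =>
  rcases eq_or_ne s 0 with rfl | hs
  · simp [lieD_zero]
  · rw [lieD_eq 𝒳 hs, lieD_eq 𝒴 hs]
    refine congrArg _ (sum_antidiagonal_smul_congr _ fun p hp hlt => ?_)
    rw [mem_antidiagonal] at hp
    rw [ih _ hlt (fun j h1 h2 => h j h1 (by omega)), h p.1 (by omega) (by omega)]

/-- `D` is a left inverse of `E` as a formal series of operators. -/
lemma sum_lieD_lieE (n : ℕ) (hn : n ≠ 0) (f : PhasePoly N) :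
    ∑ p ∈ antidiagonal n, lieD 𝒳 p.1 (lieE 𝒳 p.2 f) = 0 := by
  have h : (n : ℝ) • ∑ p ∈ antidiagonal n, lieD 𝒳 p.1 (lieE 𝒳 p.2 f) = 0 := by
    calc (n : ℝ) • ∑ p ∈ antidiagonal n, lieD 𝒳 p.1 (lieE 𝒳 p.2 f)
        = ∑ p ∈ antidiagonal n, ((p.1 : ℝ) • lieD 𝒳 p.1 (lieE 𝒳 p.2 f)
            + lieD 𝒳 p.1 ((p.2 : ℝ) • lieE 𝒳 p.2 f)) := by
          rw [Finset.smul_sum]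
          refine Finset.sum_congr rfl fun p hp => ?_
          rw [mem_antidiagonal] at hp
          rw [lieD_smul, ← add_smul, ← hp]
          push_cast; rfl
      _ = 0 := by
          simp only [smul_lieD, smul_lieE, lieD_sum, lieD_smul]
          rw [Finset.sum_add_distrib]
          have h1 := sum_antidiagonal_left_comm (M := PhasePoly N)
            (fun a j i => (j : ℝ) • lieD 𝒳 a (poisson (𝒳 j) (lieE 𝒳 i f))) n
          have h2 := sum_antidiagonal_assoc (M := PhasePoly N)
            (fun j a i => (j : ℝ) • lieD 𝒳 a (poisson (𝒳 j) (lieE 𝒳 i f))) n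
          rw [h1, h2, Finset.sum_neg_distrib, neg_add_cancel]
  exact (smul_eq_zero.mp h).resolve_left (Nat.cast_ne_zero.mpr hn)

/-- `D` is a right inverse of `E` as a formal series of operators. -/
lemma sum_lieE_lieD (n : ℕ) (hn : n ≠ 0) (f : PhasePoly N) :
    ∑ p ∈ antidiagonal n, lieE 𝒳 p.1 (lieD 𝒳 p.2 f) = 0 := by
  -- with `V = E ∘ D` and `D ∘ E = 1` one has `D ∘ V = D`, which determines `V = 1` recursively
  set V : ℕ → PhasePoly N := fun n => ∑ p ∈ antidiagonal n, lieE 𝒳 p.1 (lieD 𝒳 p.2 f) with hV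
  have hDV : ∀ n, ∑ p ∈ antidiagonal n, lieD 𝒳 p.1 (V p.2) = lieD 𝒳 n f := by
    intro n
    simp only [hV, lieD_sum]
    rw [sum_antidiagonal_assoc (fun a b c => lieD 𝒳 a (lieE 𝒳 b (lieD 𝒳 c f)))]
    rw [Finset.sum_eq_single (0, n)]
    · simp [lieD_zero, lieE_zero]
    · intro p hp h0
      rw [mem_antidiagonal] at hp
      refine sum_lieD_lieE 𝒳 p.1 (fun h => h0 ?_) _
      ext <;> simp <;> omega
    · simp
  change V n = 0
  induction n using Nat.strong_induction_on with
  | _ n ih =>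
  have h := hDV n
  obtain ⟨m, rfl⟩ := Nat.exists_eq_succ_of_ne_zero hn
  rw [Finset.Nat.sum_antidiagonal_succ, Finset.Nat.sum_antidiagonal_eq_sum_range_succ_mk,
    Finset.sum_range_succ, lieD_zero] at h
  have hV0 : V 0 = f := by simp [hV, lieE_zero, lieD_zero]
  rw [Finset.sum_eq_zero (fun i hi => ?_)] at h
  · simpa [hV0] using h
  · have hi' := Finset.mem_range.mp hi
    simp only
    rw [ih (m - i) (by omega) (by omega), lieD_map_zero]

/-- The operators `E_s` satisfy the Leibniz rule of an exponential for every bilinear operation of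
which the `{𝒳_j, ·}` are derivations. -/
lemma lieE_bilin (B : PhasePoly N →ₗ[ℝ] PhasePoly N →ₗ[ℝ] PhasePoly N)
    (hB : ∀ h f g, poisson h (B f g) = B (poisson h f) g + B f (poisson h g)) (n : ℕ)
    (f g : PhasePoly N) :
    lieE 𝒳 n (B f g) = ∑ p ∈ antidiagonal n, B (lieE 𝒳 p.1 f) (lieE 𝒳 p.2 g) := by
  induction n using Nat.strong_induction_on with
  | _ n ih =>
  rcases eq_or_ne n 0 with rfl | hn
  · simp [lieE_zero]
  refine smul_right_injective _ (Nat.cast_ne_zero.mpr hn : (n : ℝ) ≠ 0) ?_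
  change (n : ℝ) • _ = (n : ℝ) • _
  calc (n : ℝ) • lieE 𝒳 n (B f g)
      = ∑ p ∈ antidiagonal n, ∑ q ∈ antidiagonal p.2,
          ((p.1 : ℝ) • B (poisson (𝒳 p.1) (lieE 𝒳 q.1 f)) (lieE 𝒳 q.2 g)
            + (p.1 : ℝ) • B (lieE 𝒳 q.1 f) (poisson (𝒳 p.1) (lieE 𝒳 q.2 g))) := by
        rw [smul_lieE]
        have := sum_antidiagonal_smul_congr (s := n) 1
          (F := fun p => poisson (𝒳 p.1) (lieE 𝒳 p.2 (B f g)))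
          (G := fun p => poisson (𝒳 p.1) (∑ q ∈ antidiagonal p.2,
            B (lieE 𝒳 q.1 f) (lieE 𝒳 q.2 g))) (fun p _ h => by rw [ih _ h])
        simp only [div_one] at this
        rw [this]
        refine Finset.sum_congr rfl fun p _ => ?_
        rw [poisson_sum_right, Finset.smul_sum]
        exact Finset.sum_congr rfl fun q _ => by rw [hB, smul_add]
    _ = ∑ p ∈ antidiagonal n, (B ((p.1 : ℝ) • lieE 𝒳 p.1 f) (lieE 𝒳 p.2 g)
          + B (lieE 𝒳 p.1 f) ((p.2 : ℝ) • lieE 𝒳 p.2 g)) := by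
        simp only [smul_lieE, Finset.sum_add_distrib, map_sum, map_smul, LinearMap.sum_apply,
          LinearMap.smul_apply]
        rw [sum_antidiagonal_assoc (fun j a b => (j : ℝ) •
            B (poisson (𝒳 j) (lieE 𝒳 a f)) (lieE 𝒳 b g)),
          sum_antidiagonal_left_comm (fun j a b => (j : ℝ) •
            B (lieE 𝒳 a f) (poisson (𝒳 j) (lieE 𝒳 b g)))]
    _ = _ := by
        rw [Finset.smul_sum]
        refine Finset.sum_congr rfl fun p hp => ?_
        rw [mem_antidiagonal] at hp
        rw [map_smul, map_smul, LinearMap.smul_apply, ← add_smul, ← hp]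
        push_cast; rfl

lemma lieD_bilin (B : PhasePoly N →ₗ[ℝ] PhasePoly N →ₗ[ℝ] PhasePoly N)
    (hB : ∀ h f g, poisson h (B f g) = B (poisson h f) g + B f (poisson h g)) (n : ℕ)
    (f g : PhasePoly N) :
    lieD 𝒳 n (B f g) = ∑ p ∈ antidiagonal n, B (lieD 𝒳 p.1 f) (lieD 𝒳 p.2 g) := by
  induction n using Nat.strong_induction_on generalizing f g with
  | _ n ih =>
  rcases eq_or_ne n 0 with rfl | hn
  · simp [lieD_zero]
  refine smul_right_injective _ (Nat.cast_ne_zero.mpr hn : (n : ℝ) ≠ 0) ?_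
  change (n : ℝ) • _ = (n : ℝ) • _
  calc (n : ℝ) • lieD 𝒳 n (B f g)
      = -∑ p ∈ antidiagonal n, ∑ q ∈ antidiagonal p.2,
          ((p.1 : ℝ) • B (lieD 𝒳 q.1 (poisson (𝒳 p.1) f)) (lieD 𝒳 q.2 g)
            + (p.1 : ℝ) • B (lieD 𝒳 q.1 f) (lieD 𝒳 q.2 (poisson (𝒳 p.1) g))) := by
        rw [smul_lieD]
        have := sum_antidiagonal_smul_congr (s := n) 1
          (F := fun p => lieD 𝒳 p.2 (poisson (𝒳 p.1) (B f g)))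
          (G := fun p => ∑ q ∈ antidiagonal p.2,
            (B (lieD 𝒳 q.1 (poisson (𝒳 p.1) f)) (lieD 𝒳 q.2 g)
              + B (lieD 𝒳 q.1 f) (lieD 𝒳 q.2 (poisson (𝒳 p.1) g))))
          (fun p _ h => by
            rw [hB, lieD_add, ih _ h, ih _ h, Finset.sum_add_distrib])
        simp only [div_one] at this
        rw [this]
        simp only [Finset.smul_sum, smul_add]
    _ = ∑ p ∈ antidiagonal n, (B ((p.1 : ℝ) • lieD 𝒳 p.1 f) (lieD 𝒳 p.2 g)
          + B (lieD 𝒳 p.1 f) ((p.2 : ℝ) • lieD 𝒳 p.2 g)) := by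
        simp only [smul_lieD, Finset.sum_add_distrib, map_sum, map_smul, LinearMap.sum_apply,
          LinearMap.smul_apply, map_neg, LinearMap.neg_apply, Finset.sum_neg_distrib]
        rw [sum_antidiagonal_assoc (fun j a b => (j : ℝ) •
            B (lieD 𝒳 a (poisson (𝒳 j) f)) (lieD 𝒳 b g)),
          sum_antidiagonal_left_comm (fun j a b => (j : ℝ) •
            B (lieD 𝒳 a f) (lieD 𝒳 b (poisson (𝒳 j) g)))]
        rw [neg_add]
    _ = _ := by
        rw [Finset.smul_sum]
        refine Finset.sum_congr rfl fun p hp => ?_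
        rw [mem_antidiagonal] at hp
        rw [map_smul, map_smul, LinearMap.smul_apply, ← add_smul, ← hp]
        push_cast; rfl

lemma lieE_mul (n : ℕ) (f g : PhasePoly N) :
    lieE 𝒳 n (f * g) = ∑ p ∈ antidiagonal n, lieE 𝒳 p.1 f * lieE 𝒳 p.2 g :=
  lieE_bilin 𝒳 (LinearMap.mul ℝ _) (fun h f g => poisson_mul_right h f g) n f g

lemma lieD_mul (n : ℕ) (f g : PhasePoly N) :
    lieD 𝒳 n (f * g) = ∑ p ∈ antidiagonal n, lieD 𝒳 p.1 f * lieD 𝒳 p.2 g :=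
  lieD_bilin 𝒳 (LinearMap.mul ℝ _) (fun h f g => poisson_mul_right h f g) n f g

/-- The Poisson bracket as a bilinear map. -/
noncomputable def poissonB (N : ℕ) : PhasePoly N →ₗ[ℝ] PhasePoly N →ₗ[ℝ] PhasePoly N :=
  LinearMap.mk₂ ℝ poisson poisson_add_left poisson_smul_left poisson_add_right poisson_smul_right

lemma lieE_poisson (n : ℕ) (f g : PhasePoly N) :
    lieE 𝒳 n (poisson f g) = ∑ p ∈ antidiagonal n, poisson (lieE 𝒳 p.1 f) (lieE 𝒳 p.2 g) :=
  lieE_bilin 𝒳 (poissonB N) poisson_jacobi n f g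

lemma lieD_poisson (n : ℕ) (f g : PhasePoly N) :
    lieD 𝒳 n (poisson f g) = ∑ p ∈ antidiagonal n, poisson (lieD 𝒳 p.1 f) (lieD 𝒳 p.2 g) :=
  lieD_bilin 𝒳 (poissonB N) poisson_jacobi n f g

lemma poisson_C_right (h : PhasePoly N) (c : ℝ) : poisson h (C c) = 0 := by
  simp [poisson]

lemma lieE_C {n : ℕ} (hn : n ≠ 0) (c : ℝ) : lieE 𝒳 n (C c) = 0 := by
  induction n using Nat.strong_induction_on with
  | _ n ih =>
  rw [lieE_eq 𝒳 hn]
  refine Finset.sum_eq_zero fun p hp => ?_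
  rw [mem_antidiagonal] at hp
  rcases eq_or_ne p.2 0 with h2 | h2
  · rw [h2, lieE_zero, poisson_C_right, smul_zero]
  · rcases Nat.eq_zero_or_pos p.1 with h1 | h1
    · simp [h1]
    · rw [ih p.2 (by omega) h2, poisson_zero_right, smul_zero]

lemma lieD_C {n : ℕ} (hn : n ≠ 0) (c : ℝ) : lieD 𝒳 n (C c) = 0 := by
  rw [lieD_eq 𝒳 hn, neg_eq_zero]
  exact Finset.sum_eq_zero fun p _ => by rw [poisson_C_right, lieD_map_zero, smul_zero]

/-! ### Propagation of bounds through the Lie transform -/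

/-- A family `Q l C f` of statements of the form: `f` has order `l` and size at most `C`. -/
structure IsSizeBound (Q : ℕ → ℝ → PhasePoly N → Prop) : Prop where
  zero : ∀ l, Q l 0 0
  add : ∀ {l C C' f g}, Q l C f → Q l C' g → Q l (C + C') (f + g)
  smul : ∀ {l C f} (c : ℝ), Q l C f → Q l (|c| * C) (c • f)
  mono : ∀ {l C C' f}, Q l C f → C ≤ C' → Q l C' f
  nonneg : ∀ {l C f}, Q l C f → 0 ≤ C

lemma IsSizeBound.sum {Q : ℕ → ℝ → PhasePoly N → Prop} (hQ : IsSizeBound Q) {ι : Type*}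
    {t : Finset ι} {l : ℕ} {c : ι → ℝ} {f : ι → PhasePoly N} (h : ∀ i ∈ t, Q l (c i) (f i)) :
    Q l (∑ i ∈ t, c i) (∑ i ∈ t, f i) := by
  classical
  induction t using Finset.induction_on with
  | empty => simpa using hQ.zero l
  | insert a t ha ih =>
    rw [Finset.sum_insert ha, Finset.sum_insert ha]
    exact hQ.add (h a (Finset.mem_insert_self _ _))
      (ih fun i hi => h i (Finset.mem_insert_of_mem hi))

lemma IsSizeBound.neg {Q : ℕ → ℝ → PhasePoly N → Prop} (hQ : IsSizeBound Q) {l : ℕ} {c : ℝ}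
    {f : PhasePoly N} (h : Q l c f) : Q l c (-f) := by
  simpa using hQ.smul (-1) h

/-- Bounds for `D_k`: if `{𝒳_j, ·}` raises the order `l` by `j` and the size by the factor
`a j l`, then `D_k` raises the size by any factor `w k l` satisfying the corresponding
recursive inequality. -/
lemma IsSizeBound.apply_lieD {Q : ℕ → ℝ → PhasePoly N → Prop} (hQ : IsSizeBound Q) {l₀ n : ℕ}
    {a w : ℕ → ℕ → ℝ}
    (hbr : ∀ j l C f, 1 ≤ j → l₀ ≤ l → l + j ≤ n → Q l C f →
      Q (l + j) (a j l * C) (poisson (𝒳 j) f))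
    (hw0 : ∀ l, 1 ≤ w 0 l)
    (hw : ∀ k l : ℕ, 1 ≤ k → l₀ ≤ l → l + k ≤ n →
      ∑ p ∈ antidiagonal k, (p.1 : ℝ) / k * a p.1 l * w p.2 (l + p.1) ≤ w k l)
    (k l : ℕ) (hl : l₀ ≤ l) (hk : l + k ≤ n) {C : ℝ} {f : PhasePoly N} (hf : Q l C f) :
    Q (l + k) (w k l * C) (lieD 𝒳 k f) := by
  induction k using Nat.strong_induction_on generalizing l C f with
  | _ k ih =>
  rcases Nat.eq_zero_or_pos k with rfl | hk0
  · rw [lieD_zero]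
    exact hQ.mono hf (le_mul_of_one_le_left (hQ.nonneg hf) (hw0 l))
  rw [lieD_eq 𝒳 hk0.ne']
  refine hQ.neg (hQ.mono (hQ.sum (c := fun p => (p.1 : ℝ) / k * a p.1 l * w p.2 (l + p.1) * C)
    fun p hp => ?_) ?_)
  · rw [mem_antidiagonal] at hp
    rcases Nat.eq_zero_or_pos p.1 with h1 | h1
    · simpa [h1] using hQ.zero _
    · have h := ih p.2 (by omega) (l + p.1) (by omega) (by omega)
        (hbr p.1 l C f h1 hl (by omega) hf)
      rw [show l + p.1 + p.2 = l + k by omega] at h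
      have h2 := hQ.smul ((p.1 : ℝ) / k) h
      rw [abs_of_nonneg (by positivity)] at h2
      convert h2 using 1
      ring
  · rw [← Finset.sum_mul]
    exact mul_le_mul_of_nonneg_right (hw k l hk0 hl hk) (hQ.nonneg hf)

/-- The analogue of `IsSizeBound.apply_lieD` for `E_k`. -/
lemma IsSizeBound.apply_lieE {Q : ℕ → ℝ → PhasePoly N → Prop} (hQ : IsSizeBound Q)
    {a : ℕ → ℕ → ℝ} {u : ℕ → ℝ} {l : ℕ}
    (hbr : ∀ j l C f, 1 ≤ j → Q l C f → Q (l + j) (a j l * C) (poisson (𝒳 j) f))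
    (hu0 : 1 ≤ u 0)
    (hu : ∀ k : ℕ, 1 ≤ k →
      ∑ p ∈ antidiagonal k, (p.1 : ℝ) / k * a p.1 (l + p.2) * u p.2 ≤ u k)
    (k : ℕ) {C : ℝ} {f : PhasePoly N} (hf : Q l C f) :
    Q (l + k) (u k * C) (lieE 𝒳 k f) := by
  induction k using Nat.strong_induction_on with
  | _ k ih =>
  rcases Nat.eq_zero_or_pos k with rfl | hk0
  · rw [lieE_zero]
    exact hQ.mono hf (le_mul_of_one_le_left (hQ.nonneg hf) hu0)
  rw [lieE_eq 𝒳 hk0.ne']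
  refine hQ.mono (hQ.sum (c := fun p => (p.1 : ℝ) / k * a p.1 (l + p.2) * u p.2 * C)
    fun p hp => ?_) ?_
  · rw [mem_antidiagonal] at hp
    rcases Nat.eq_zero_or_pos p.1 with h1 | h1
    · simpa [h1] using hQ.zero _
    · have h := hbr p.1 (l + p.2) _ _ h1 (ih p.2 (by omega))
      rw [show l + p.2 + p.1 = l + k by omega] at h
      have h2 := hQ.smul ((p.1 : ℝ) / k) h
      rw [abs_of_nonneg (by positivity)] at h2
      convert h2 using 1
      ring
  · rw [← Finset.sum_mul]
    exact mul_le_mul_of_nonneg_right (hu k hk0) (hQ.nonneg hf)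

end lie

/-! ### Numerical inequalities -/

/-- Partial sums of the binomial series of `(1 + 3/8)^n`. They majorize the growth of the Lie
series: each bracket with the generating sequence contributes at most a factor `3/8`, and the
degrees contribute the binomial coefficients. -/
noncomputable def binomSum (n k : ℕ) : ℝ := ∑ p ∈ Finset.range (k + 1), (n.choose p) * (3 / 8 : ℝ) ^ p

lemma binomSum_zero (n : ℕ) : binomSum n 0 = 1 := by simp [binomSum]

lemma binomSum_mono {n n' k k' : ℕ} (hn : n ≤ n') (hk : k ≤ k') :
    binomSum n k ≤ binomSum n' k' := by
  calc binomSum n k ≤ binomSum n' k :=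
        Finset.sum_le_sum fun p _ => by
          have : (n.choose p : ℝ) ≤ n'.choose p := by exact_mod_cast Nat.choose_le_choose p hn
          gcongr
    _ ≤ binomSum n' k' := Finset.sum_le_sum_of_subset_of_nonneg
        (Finset.range_mono (by omega)) fun _ _ _ => by positivity

lemma one_le_binomSum (n k : ℕ) : 1 ≤ binomSum n k := by
  rw [← binomSum_zero n]
  exact binomSum_mono le_rfl (Nat.zero_le k)

lemma binomSum_le_pow (n k : ℕ) : binomSum n k ≤ (11 / 8 : ℝ) ^ n := by
  have h : (11 / 8 : ℝ) ^ n = binomSum n n := by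
    rw [show (11 / 8 : ℝ) = 3 / 8 + 1 by norm_num, add_pow, binomSum]
    exact Finset.sum_congr rfl fun p _ => by rw [one_pow, mul_one, mul_comm]
  rcases le_total k n with hk | hk
  · rw [h]; exact binomSum_mono le_rfl hk
  · have h2 : binomSum n k = binomSum n n := by
      refine (Finset.sum_subset (Finset.range_mono (by omega)) fun p _ hp => ?_).symm
      rw [Finset.mem_range, not_lt] at hp
      rw [Nat.choose_eq_zero_of_lt (by omega)]
      simp
    rw [h, h2]

lemma binomSum_succ (n k : ℕ) : binomSum n (k + 1) - 1 =
    ∑ p ∈ Finset.range (k + 1), (n.choose (p + 1)) * (3 / 8 : ℝ) ^ (p + 1) := by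
  rw [binomSum, Finset.sum_range_succ']
  simp

/-- The step of the recursion for `D_k`. -/
lemma binomSum_step (l k : ℕ) :
    (l + 1 : ℝ) / (k + 1) * (3 / 8) * binomSum (l + (k + 1)) k ≤
      binomSum (l + (k + 1)) (k + 1) - 1 := by
  rw [binomSum_succ, binomSum, Finset.mul_sum]
  refine Finset.sum_le_sum fun p hp => ?_
  have hp' : p ≤ k := Nat.lt_succ_iff.mp (Finset.mem_range.mp hp)
  have hch : ((l + (k + 1)).choose (p + 1) : ℝ) * (p + 1) =
      (l + (k + 1)).choose p * ((l + (k + 1) - p : ℕ) : ℝ) := by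
    exact_mod_cast Nat.choose_succ_right_eq (l + (k + 1)) p
  have h1 : (l + 1 : ℝ) / (k + 1) * (l + (k + 1)).choose p ≤ (l + (k + 1)).choose (p + 1) := by
    rw [div_mul_eq_mul_div, div_le_iff₀ (by positivity)]
    have h2 : (l + 1 : ℝ) ≤ ((l + (k + 1) - p : ℕ) : ℝ) := by
      exact_mod_cast (by omega : l + 1 ≤ l + (k + 1) - p)
    have h3 : (p + 1 : ℝ) ≤ k + 1 := by exact_mod_cast (by omega : p + 1 ≤ k + 1)
    calc (l + 1 : ℝ) * (l + (k + 1)).choose p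
        ≤ ((l + (k + 1) - p : ℕ) : ℝ) * (l + (k + 1)).choose p := by gcongr
      _ = (l + (k + 1)).choose (p + 1) * (p + 1) := by rw [hch]; ring
      _ ≤ (l + (k + 1)).choose (p + 1) * (k + 1) := by gcongr
  calc (l + 1 : ℝ) / (k + 1) * (3 / 8) * ((l + (k + 1)).choose p * (3 / 8) ^ p)
      = (l + 1 : ℝ) / (k + 1) * (l + (k + 1)).choose p * (3 / 8) ^ (p + 1) := by ring
    _ ≤ _ := by gcongr

/-- The step of the recursion for `E_k`. -/
lemma binomSum_step' (l k : ℕ) :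
    (l + k + 1 : ℝ) / (k + 1) * (3 / 8) * binomSum (l + k) k ≤ binomSum (l + (k + 1)) (k + 1) := by
  refine le_trans ?_ (sub_le_self _ zero_le_one)
  rw [binomSum_succ, binomSum, Finset.mul_sum]
  refine Finset.sum_le_sum fun p hp => ?_
  have hp' : p ≤ k := Nat.lt_succ_iff.mp (Finset.mem_range.mp hp)
  have hch : (l + k + 1 : ℝ) * (l + k).choose p = (l + (k + 1)).choose (p + 1) * (p + 1) := by
    exact_mod_cast Nat.add_one_mul_choose_eq (l + k) p
  have h1 : (l + k + 1 : ℝ) / (k + 1) * (l + k).choose p ≤ (l + (k + 1)).choose (p + 1) := by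
    rw [div_mul_eq_mul_div, div_le_iff₀ (by positivity), hch]
    have h3 : (p + 1 : ℝ) ≤ k + 1 := by exact_mod_cast (by omega : p + 1 ≤ k + 1)
    gcongr
  calc (l + k + 1 : ℝ) / (k + 1) * (3 / 8) * ((l + k).choose p * (3 / 8) ^ p)
      = (l + k + 1 : ℝ) / (k + 1) * (l + k).choose p * (3 / 8) ^ (p + 1) := by ring
    _ ≤ _ := by gcongr

/-- The factor by which a bracket with `𝒳_j` increases norms at order `l`. -/
noncomputable def bracketFactor (A : ℝ) (r j l : ℕ) : ℝ :=
  if j ≤ r then 3 / 16 * (j + 1) * (l + 1) * A ^ j / (r ^ 2 * j) else 0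

/-- The weights of the generating sequence add up to at most `3/8`. -/
lemma sum_antidiagonal_weight_le {r : ℕ} (hr : 1 ≤ r) (k : ℕ) :
    ∑ p ∈ antidiagonal k, (if 1 ≤ p.1 ∧ p.1 ≤ r then 3 / 16 * (p.1 + 1 : ℝ) / r ^ 2 else 0) ≤
      3 / 8 := by
  rw [Finset.Nat.sum_antidiagonal_eq_sum_range_succ_mk, ← Finset.sum_filter]
  have hr' : (1 : ℝ) ≤ r := by exact_mod_cast hr
  calc ∑ j ∈ Finset.range (k + 1) with 1 ≤ j ∧ j ≤ r, 3 / 16 * (j + 1 : ℝ) / r ^ 2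
      ≤ ∑ j ∈ Finset.Icc 1 r, 3 / 16 * (j + 1 : ℝ) / r ^ 2 :=
        Finset.sum_le_sum_of_subset_of_nonneg
          (fun j hj => by rw [Finset.mem_filter] at hj; rw [Finset.mem_Icc]; exact hj.2)
          fun _ _ _ => by positivity
    _ ≤ ∑ j ∈ Finset.Icc 1 r, 3 / 8 / (r : ℝ) := by
        refine Finset.sum_le_sum fun j hj => ?_
        have hj2 : (j : ℝ) ≤ r := by exact_mod_cast (Finset.mem_Icc.mp hj).2
        rw [div_le_div_iff₀ (by positivity) (by positivity)]
        nlinarith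
    _ = 3 / 8 := by
        rw [Finset.sum_const, Nat.card_Icc, nsmul_eq_mul, Nat.add_sub_cancel]
        field_simp

/-- A weighted sum as it occurs in the recursive bounds for `D_k` and `E_k`. -/
lemma sum_bracketFactor_le {A : ℝ} (hA : 0 ≤ A) {r k : ℕ} (hr : 1 ≤ r) {m u : ℕ × ℕ → ℝ}
    {μ : ℕ × ℕ → ℕ} {c : ℝ} (hc : 0 ≤ c)
    (hm : ∀ p ∈ antidiagonal (k + 1), 1 ≤ p.1 → (μ p + 1 : ℝ) * m p ≤ (k + 1) * c)
    (hu : ∀ p ∈ antidiagonal (k + 1), 1 ≤ p.1 → u p ≤ A ^ p.2 * m p) :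
    ∑ p ∈ antidiagonal (k + 1), (p.1 : ℝ) / (k + 1 : ℕ) * bracketFactor A r p.1 (μ p) * u p ≤
      A ^ (k + 1) * (3 / 8 * c) := by
  have hr' : (1 : ℝ) ≤ r := by exact_mod_cast hr
  calc ∑ p ∈ antidiagonal (k + 1), (p.1 : ℝ) / (k + 1 : ℕ) * bracketFactor A r p.1 (μ p) * u p
      ≤ ∑ p ∈ antidiagonal (k + 1), A ^ (k + 1) * c *
          (if 1 ≤ p.1 ∧ p.1 ≤ r then 3 / 16 * (p.1 + 1 : ℝ) / r ^ 2 else 0) := by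
        refine Finset.sum_le_sum fun p hp => ?_
        rcases Nat.eq_zero_or_pos p.1 with h0 | h0
        · simp [h0]
        have hp' := mem_antidiagonal.mp hp
        by_cases hpr : p.1 ≤ r
        · have h0' : (0 : ℝ) < p.1 := by exact_mod_cast h0
          rw [bracketFactor, if_pos hpr, if_pos ⟨h0, hpr⟩]
          calc (p.1 : ℝ) / (k + 1 : ℕ) *
                (3 / 16 * (p.1 + 1) * (μ p + 1) * A ^ p.1 / (r ^ 2 * p.1)) * u p
              ≤ (p.1 : ℝ) / (k + 1 : ℕ) *
                (3 / 16 * (p.1 + 1) * (μ p + 1) * A ^ p.1 / (r ^ 2 * p.1)) * (A ^ p.2 * m p) :=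
                mul_le_mul_of_nonneg_left (hu p hp h0) (by positivity)
            _ = 3 / 16 * (p.1 + 1) / r ^ 2 * A ^ (k + 1) * ((μ p + 1) * m p) / (k + 1) := by
                rw [← hp', pow_add]
                have : (p.1 : ℝ) + p.2 = k + 1 := by exact_mod_cast hp'
                push_cast
                rw [this]
                field_simp
            _ ≤ 3 / 16 * (p.1 + 1) / r ^ 2 * A ^ (k + 1) * ((k + 1) * c) / (k + 1) := by
                exact div_le_div_of_nonneg_right
                  (mul_le_mul_of_nonneg_left (hm p hp h0) (by positivity)) (by positivity)
            _ = _ := by field_simp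
        · rw [bracketFactor, if_neg hpr]
          simp only [mul_zero, zero_mul]
          positivity
    _ ≤ A ^ (k + 1) * c * (3 / 8) := by
        rw [← Finset.mul_sum]
        exact mul_le_mul_of_nonneg_left (sum_antidiagonal_weight_le hr _) (by positivity)
    _ = _ := by ring

/-- The bound for `D_k` at order `l`, with the linear part split off. -/
noncomputable def lieDFactor (A : ℝ) (k l : ℕ) : ℝ :=
  A ^ k * (if k = 0 then 1 else binomSum (l + k) k - 1)

lemma lieDFactor_le {A : ℝ} (hA : 0 ≤ A) (k l : ℕ) :
    lieDFactor A k l ≤ A ^ k * binomSum (l + k) k := by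
  unfold lieDFactor
  refine mul_le_mul_of_nonneg_left ?_ (by positivity)
  split_ifs
  · exact one_le_binomSum _ _
  · linarith

lemma lieDFactor_recursion {A : ℝ} (hA : 0 ≤ A) {r : ℕ} (hr : 1 ≤ r) (k l : ℕ) (hk : 1 ≤ k) :
    ∑ p ∈ antidiagonal k, (p.1 : ℝ) / k * bracketFactor A r p.1 l * lieDFactor A p.2 (l + p.1) ≤
      lieDFactor A k l := by
  obtain ⟨k, rfl⟩ := Nat.exists_eq_succ_of_ne_zero (by omega : k ≠ 0)
  refine (sum_bracketFactor_le hA hr (m := fun _ => binomSum (l + (k + 1)) k)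
    (c := (l + 1) / (k + 1) * binomSum (l + (k + 1)) k) ?_ ?_ ?_).trans ?_
  · have := one_le_binomSum (l + (k + 1)) k
    positivity
  · intro p _ _
    rw [← mul_assoc, mul_div_cancel₀ _ (by positivity)]
  · intro p hp h1
    rw [mem_antidiagonal] at hp
    refine (lieDFactor_le hA _ _).trans ?_
    rw [show l + p.1 + p.2 = l + (k + 1) by omega]
    exact mul_le_mul_of_nonneg_left (binomSum_mono le_rfl (by omega)) (by positivity)
  · rw [lieDFactor, if_neg (by omega)]
    refine mul_le_mul_of_nonneg_left ?_ (by positivity)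
    have := binomSum_step l k
    linarith

lemma lieEFactor_recursion {A : ℝ} (hA : 0 ≤ A) {r : ℕ} (hr : 1 ≤ r) (l k : ℕ) (hk : 1 ≤ k) :
    ∑ p ∈ antidiagonal k, (p.1 : ℝ) / k * bracketFactor A r p.1 (l + p.2) *
      (A ^ p.2 * binomSum (l + p.2) p.2) ≤ A ^ k * binomSum (l + k) k := by
  obtain ⟨k, rfl⟩ := Nat.exists_eq_succ_of_ne_zero (by omega : k ≠ 0)
  refine (sum_bracketFactor_le hA hr (μ := fun p => l + p.2)
    (m := fun p => binomSum (l + p.2) p.2)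
    (c := (l + k + 1) / (k + 1) * binomSum (l + k) k) ?_ ?_ ?_).trans ?_
  · have := one_le_binomSum (l + k) k
    positivity
  · intro p hp h1
    rw [mem_antidiagonal] at hp
    rw [← mul_assoc, mul_div_cancel₀ _ (by positivity)]
    have h2 : ((l + p.2 : ℕ) + 1 : ℝ) ≤ l + k + 1 := by
      exact_mod_cast (by omega : l + p.2 + 1 ≤ l + k + 1)
    have h3 := one_le_binomSum (l + p.2) p.2
    exact mul_le_mul h2 (binomSum_mono (by omega) (by omega)) (by linarith) (by positivity)
  · intro p _ _
    exact le_rfl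
  · refine mul_le_mul_of_nonneg_left ?_ (by positivity)
    have := binomSum_step' l k
    linarith

/-- For `E_k` on linear functions there is a gain of a factor `1/r²`. -/
lemma lieEFactor_recursion_zero {A : ℝ} (hA : 0 ≤ A) {r : ℕ} (hr : 1 ≤ r) (k : ℕ) (hk : 1 ≤ k) :
    ∑ p ∈ antidiagonal k, (p.1 : ℝ) / k * bracketFactor A r p.1 (0 + p.2) *
      (if p.2 = 0 then 1 else A ^ p.2 * (3 / 5 / r ^ 2)) ≤
        (if k = 0 then 1 else A ^ k * (3 / 5 / r ^ 2)) := by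
  obtain ⟨k, rfl⟩ := Nat.exists_eq_succ_of_ne_zero (by omega : k ≠ 0)
  have hr' : (1 : ℝ) ≤ r := by exact_mod_cast hr
  -- the term with `j = k` is separated from the others
  have hsplit : ∀ p ∈ antidiagonal (k + 1),
      (p.1 : ℝ) / (k + 1 : ℕ) * bracketFactor A r p.1 (0 + p.2) *
        (if p.2 = 0 then 1 else A ^ p.2 * (3 / 5 / r ^ 2)) =
      (if p.2 = 0 then bracketFactor A r (k + 1) 0 else 0) +
      (p.1 : ℝ) / (k + 1 : ℕ) * bracketFactor A r p.1 (0 + p.2) *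
        (if p.2 = 0 then 0 else A ^ p.2 * (3 / 5 / r ^ 2)) := by
    intro p hp
    rw [mem_antidiagonal] at hp
    split_ifs with h
    · have h1 : p.1 = k + 1 := by omega
      rw [h, h1, div_self (by positivity)]
      ring
    · ring
  rw [Nat.succ_eq_add_one, Finset.sum_congr rfl hsplit, Finset.sum_add_distrib,
    if_neg (by omega)]
  have h1 : ∑ p ∈ antidiagonal (k + 1), (if p.2 = 0 then bracketFactor A r (k + 1) 0 else 0) ≤
      A ^ (k + 1) * (3 / 8 / r ^ 2) := by
    rw [Finset.sum_eq_single (k + 1, 0)]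
    · rw [if_pos rfl, bracketFactor]
      split_ifs
      · rw [div_le_iff₀ (by positivity)]
        calc 3 / 16 * ((k + 1 : ℕ) + 1 : ℝ) * ((0 : ℕ) + 1) * A ^ (k + 1)
            ≤ 3 / 16 * (2 * (k + 1 : ℕ)) * A ^ (k + 1) := by
              push_cast
              have : (k : ℝ) + 1 + 1 ≤ 2 * (k + 1) := by
                have : (0 : ℝ) ≤ k := Nat.cast_nonneg k
                linarith
              rw [zero_add, mul_one]
              gcongr
          _ = _ := by field_simp; ring
      · positivity
    · intro p hp hne
      rw [mem_antidiagonal] at hp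
      rw [if_neg]
      intro h
      exact hne (by ext <;> simp <;> omega)
    · simp
  have h2 := sum_bracketFactor_le (A := A) hA (r := r) (k := k) hr
    (μ := fun p => 0 + p.2) (m := fun p => if p.2 = 0 then 0 else 3 / 5 / (r : ℝ) ^ 2)
    (u := fun p => if p.2 = 0 then 0 else A ^ p.2 * (3 / 5 / r ^ 2))
    (c := 3 / 5 / (r : ℝ) ^ 2) (by positivity) (fun p hp h1 => by
      rw [mem_antidiagonal] at hp
      split_ifs
      · rw [mul_zero]; positivity
      · have : ((0 + p.2 : ℕ) + 1 : ℝ) ≤ k + 1 := by exact_mod_cast (by omega : 0 + p.2 + 1 ≤ k + 1)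
        gcongr)
      (fun p _ _ => by split_ifs <;> simp)
  refine (add_le_add h1 h2).trans (le_of_eq ?_)
  field_simp
  norm_num

/-- The final comparison between the growth of the Lie series and the constant of the remainder. -/
lemma remainder_factor_le {s r : ℕ} (hr : 1 ≤ r) (hs : r < s) :
    ((11 / 8 : ℝ) ^ s - 1) * (1 + r / s) ≤ 2 * (3 / 2) ^ (s - 1) := by
  have hs0 : (0 : ℝ) < s := by exact_mod_cast (by omega : 0 < s)
  have h1 : (r : ℝ) / s ≤ 1 := by
    rw [div_le_one hs0]; exact_mod_cast hs.le
  have h0 : (0 : ℝ) ≤ (11 / 8 : ℝ) ^ s - 1 := by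
    rw [sub_nonneg]; exact one_le_pow₀ (by norm_num)
  have h2 : ((11 / 8 : ℝ) ^ s - 1) * (1 + r / s) ≤ ((11 / 8 : ℝ) ^ s - 1) * 2 :=
    mul_le_mul_of_nonneg_left (by linarith) h0
  refine h2.trans ?_
  have key : ∀ t : ℕ, ((11 / 8 : ℝ) ^ (t + 4)) * 2 ≤ 2 * (3 / 2) ^ (t + 3) + 2 := by
    have : ∀ t : ℕ, ((11 / 8 : ℝ) ^ (t + 5)) ≤ (3 / 2) ^ (t + 4) := by
      intro t
      induction t with
      | zero => norm_num
      | succ t ih =>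
        rw [show t + 1 + 5 = (t + 5) + 1 by ring, show t + 1 + 4 = (t + 4) + 1 by ring,
          pow_succ (11 / 8 : ℝ) (t + 5), pow_succ (3 / 2 : ℝ) (t + 4)]
        have : (0 : ℝ) ≤ (11 / 8) ^ (t + 5) := by positivity
        linarith
    intro t
    rcases t with _ | t
    · norm_num
    · have := this t
      rw [show t + 1 + 4 = t + 5 by ring, show t + 1 + 3 = t + 4 by ring]
      linarith
  rcases (by omega : s = 2 ∨ s = 3 ∨ 4 ≤ s) with rfl | rfl | h4
  · norm_num
  · norm_num
  · obtain ⟨t, rfl⟩ := Nat.exists_eq_add_of_le' h4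
    have := key t
    rw [show t + 4 - 1 = t + 3 by omega]
    linarith

/-! ### Relations between the constants -/

/-- Concavity of `D ↦ 1 - e^{-D}`. -/
lemma mul_one_sub_exp_le {t : ℝ} (ht0 : 0 ≤ t) (ht1 : t ≤ 1) (D : ℝ) :
    t * (1 - Real.exp (-D)) ≤ 1 - Real.exp (-(t * D)) := by
  have h := convexOn_exp.2 (Set.mem_univ (-D)) (Set.mem_univ 0) ht0 (sub_nonneg.mpr ht1)
    (by ring)
  simp only [smul_eq_mul, mul_zero, add_zero, Real.exp_zero, mul_one] at h
  rw [mul_neg] at h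
  linarith

/-- The relations between the constants on which the construction of the normal form rests:
`Λ` bounds the loss of decay rate, and `2Ω` exceeds `γ` by the perturbation that the quadratic
coupling produces in the homological equation. -/
structure ConstantRelations (Ω Cζ Ch σ₀ σ₁ σs Λ γ A : ℝ) (r : ℕ) : Prop where
  Ω_pos : 0 < Ω
  Ch_pos : 0 < Ch
  r_pos : 1 ≤ r
  Λ_pos : 0 < Λ
  Λ_le : Λ ≤ 1 / 2
  γ_pos : 0 < γ
  A_pos : 0 < A
  exp_le : Real.exp (-σs) ≤ 1 / 4
  rate_lt : σs < σ₁
  rate_lt' : σ₁ < σ₀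
  loss : ∀ t, 0 ≤ t → t ≤ 1 → t * Λ ≤ 1 - Real.exp (-(t * (σ₁ - σs)))
  divisor : ∀ (s : ℕ) (σ : ℝ), 1 ≤ s → s ≤ r → σ ≤ σ₁ →
    γ + 2 * (2 * s + 2) * Cζ * (Real.exp (-(σ₀ - σ)) / (1 - Real.exp (-(σ₀ - σ)))) ≤ 2 * Ω
  const_eq : Ch / γ = A * Λ / (64 * r ^ 2)

namespace ConstantRelations
variable {Ω Cζ Ch σ₀ σ₁ σs Λ γ A : ℝ} {r : ℕ}

lemma rate_pos (R : ConstantRelations Ω Cζ Ch σ₀ σ₁ σs Λ γ A r) : 0 < σs := by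
  have h : Real.exp (-σs) < 1 := R.exp_le.trans_lt (by norm_num)
  rw [Real.exp_lt_one_iff] at h
  linarith

end ConstantRelations

/-- The decay rates used in the construction, decreasing from `σ₁` but staying away from `σ_*`. -/
noncomputable def innerRate (σ₁ σs : ℝ) (r s : ℕ) : ℝ :=
  σ₁ - 2 / 3 * (((s : ℝ) - 1) / r) * (σ₁ - σs)

section
variable {σ₁ σs : ℝ} {r : ℕ}

lemma innerRate_one : innerRate σ₁ σs r 1 = σ₁ := by simp [innerRate]

lemma innerRate_anti (h : σs < σ₁) {s s' : ℕ} (hs : s ≤ s') :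
    innerRate σ₁ σs r s' ≤ innerRate σ₁ σs r s := by
  have h1 : (s : ℝ) ≤ s' := by exact_mod_cast hs
  have h2 : 0 < σ₁ - σs := by linarith
  unfold innerRate
  gcongr

lemma innerRate_le (h : σs < σ₁) {s : ℕ} (hs : 1 ≤ s) : innerRate σ₁ σs r s ≤ σ₁ :=
  (innerRate_anti h hs).trans_eq innerRate_one

lemma le_innerRate (h : σs < σ₁) (hr : 1 ≤ r) {s : ℕ} (hs : s ≤ r) :
    σs + 1 / 3 * (σ₁ - σs) ≤ innerRate σ₁ σs r s := by
  have hr' : (0 : ℝ) < r := by exact_mod_cast hr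
  have h1 : ((s : ℝ) - 1) / r ≤ 1 := by
    rw [div_le_one hr']
    have : (s : ℝ) ≤ r := by exact_mod_cast hs
    linarith
  have h2 : 2 / 3 * (((s : ℝ) - 1) / r) * (σ₁ - σs) ≤ 2 / 3 * 1 * (σ₁ - σs) := by
    have : 0 < σ₁ - σs := by linarith
    gcongr
  unfold innerRate
  linarith

lemma sigmaSeq_le_innerRate (h : σs < σ₁) {s : ℕ} (hs : 1 ≤ s) :
    sigmaSeq σ₁ σs r s ≤ innerRate σ₁ σs r s := by
  have h1 : 0 ≤ ((s : ℝ) - 1) / r * (σ₁ - σs) := by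
    have : (1 : ℝ) ≤ s := by exact_mod_cast hs
    have h2 : 0 < σ₁ - σs := by linarith
    exact mul_nonneg (div_nonneg (by linarith) (Nat.cast_nonneg r)) h2.le
  unfold innerRate sigmaSeq
  linarith

lemma le_sigmaSeq (h : σs < σ₁) (hr : 1 ≤ r) {s : ℕ} (hs : s ≤ r) :
    σs ≤ sigmaSeq σ₁ σs r s := by
  have hr' : (0 : ℝ) < r := by exact_mod_cast hr
  have h1 : ((s : ℝ) - 1) / r ≤ 1 := by
    rw [div_le_one hr']
    have : (s : ℝ) ≤ r := by exact_mod_cast hs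
    linarith
  have h2 : ((s : ℝ) - 1) / r * (σ₁ - σs) ≤ 1 * (σ₁ - σs) := by
    have : 0 < σ₁ - σs := by linarith
    gcongr
  unfold sigmaSeq
  linarith

end

/-- The constants of the theorem satisfy the required relations. -/
lemma constantRelations {Ω μ Cζ Ch σ₁ σs : ℝ} (hΩ : 0 < Ω) (hμ : 0 < μ) (hCζ : 0 < Cζ)
    (hCh : 0 < Ch) (hσs : Real.log 4 ≤ σs) (hσs₁ : σs < σ₁) (hσ₁ : σ₁ < sigmaZero μ) :
    0 < muStar Ω Cζ μ σ₁ σs ∧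
    ∀ r : ℕ, 1 ≤ r → (r : ℝ) < 1 / 2 * (muStar Ω Cζ μ σ₁ σs / μ) →
      (Ω < gammaConst Ω Cζ μ σ₁ σs r ∧ gammaConst Ω Cζ μ σ₁ σs r < 2 * Ω ∧
        0 < CStar Ω Cζ Ch μ σ₁ σs r) ∧
      ConstantRelations Ω Cζ Ch (sigmaZero μ) σ₁ σs (lossFactor μ σ₁ σs)
        (gammaConst Ω Cζ μ σ₁ σs r) (64 * (r : ℝ) ^ 2 * CStar Ω Cζ Ch μ σ₁ σs r) r := by
  set σ₀ := sigmaZero μ with hσ₀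
  set Λ := lossFactor μ σ₁ σs with hΛ
  have hlog4 : 0 < Real.log 4 := Real.log_pos (by norm_num)
  have hσs0 : 0 < σs := by linarith
  have hexp0 : Real.exp (-σ₀) = 2 * μ := by
    rw [hσ₀, sigmaZero, neg_neg, Real.exp_log (by positivity)]
  have hexps : Real.exp (-σs) ≤ 1 / 4 := by
    rw [Real.exp_neg, ← Real.exp_log (show (0 : ℝ) < 4 by norm_num), one_div]
    exact inv_anti₀ (Real.exp_pos _) (Real.exp_le_exp.mpr hσs)
  have ha : 0 < σ₀ - σ₁ := by linarith
  have hb : 0 < σ₁ - σs := by linarith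
  have hab : 0 < σ₀ - σs := by linarith
  have e0 : 0 < 1 - Real.exp (-σ₀) := exp_lt_one_of_neg (by linarith)
  have e1 : 0 < 1 - Real.exp (-(σ₀ - σs)) := exp_lt_one_of_neg hab
  have e0' : 1 - Real.exp (-σ₀) ≤ 1 := by linarith [Real.exp_pos (-σ₀)]
  have e1' : 1 - Real.exp (-(σ₀ - σs)) ≤ 1 := by linarith [Real.exp_pos (-(σ₀ - σs))]
  have hmin : 0 < min (σ₀ - σ₁) (σ₁ - σs) := lt_min ha hb
  have hE : EStar μ σ₁ σs = min (σ₀ - σ₁) (σ₁ - σs) / (σ₀ - σs) := rfl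
  have hE0 : 0 < EStar μ σ₁ σs := by rw [hE]; positivity
  have hΛdef : Λ = (1 - Real.exp (-σ₀)) * (1 - Real.exp (-(σ₀ - σs))) * EStar μ σ₁ σs := rfl
  have hΛ0 : 0 < Λ := by rw [hΛdef]; positivity
  have hΛE : Λ ≤ EStar μ σ₁ σs * (1 - Real.exp (-(σ₀ - σs))) := by
    rw [hΛdef, mul_assoc, mul_comm (EStar μ σ₁ σs)]
    exact mul_le_of_le_one_left (by positivity) e0'
  have hΛ2 : Λ ≤ 1 / 2 := by
    have h1 : EStar μ σ₁ σs ≤ 1 / 2 := by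
      rw [hE, div_le_iff₀ hab]
      linarith [min_le_left (σ₀ - σ₁) (σ₁ - σs), min_le_right (σ₀ - σ₁) (σ₁ - σs)]
    refine hΛE.trans ((mul_le_of_le_one_right hE0.le e1').trans h1)
  have hΛD : ∀ D, 0 < D → D ≤ σ₀ - σs → min (σ₀ - σ₁) (σ₁ - σs) ≤ D → Λ ≤ 1 - Real.exp (-D) := by
    intro D hD hD' hm
    have h1 := mul_one_sub_exp_le (div_nonneg hD.le hab.le) ((div_le_one hab).mpr hD') (σ₀ - σs)
    rw [div_mul_cancel₀ _ hab.ne'] at h1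
    refine hΛE.trans (le_trans (mul_le_mul_of_nonneg_right ?_ e1.le) h1)
    rw [hE]
    gcongr
  have hloss : ∀ t, 0 ≤ t → t ≤ 1 → t * Λ ≤ 1 - Real.exp (-(t * (σ₁ - σs))) := by
    intro t ht0 ht1
    exact (mul_le_mul_of_nonneg_left (hΛD _ hb (by linarith) (min_le_right _ _)) ht0).trans
      (mul_one_sub_exp_le ht0 ht1 _)
  have hΛa := hΛD _ ha (by linarith) (min_le_left _ _)
  have hmu : muStar Ω Cζ μ σ₁ σs = Ω * Λ / (8 * Cζ * Real.exp σ₁) := rfl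
  have hmu0 : 0 < muStar Ω Cζ μ σ₁ σs := by rw [hmu]; positivity
  refine ⟨hmu0, fun r hr hrμ => ?_⟩
  have hr0 : (0 : ℝ) < r := by exact_mod_cast hr
  set γ := gammaConst Ω Cζ μ σ₁ σs r with hγ
  have hγdef : γ = 2 * Ω * (1 - r * μ / muStar Ω Cζ μ σ₁ σs) := rfl
  have hq0 : 0 < r * μ / muStar Ω Cζ μ σ₁ σs := by positivity
  have hq1 : r * μ / muStar Ω Cζ μ σ₁ σs < 1 / 2 := by
    rw [div_lt_iff₀ hmu0]
    calc (r : ℝ) * μ < 1 / 2 * (muStar Ω Cζ μ σ₁ σs / μ) * μ := by gcongr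
      _ = 1 / 2 * muStar Ω Cζ μ σ₁ σs := by field_simp
  have hγ1 : Ω < γ := by rw [hγdef]; nlinarith
  have hγ2 : γ < 2 * Ω := by rw [hγdef]; nlinarith
  have hγ0 : 0 < γ := hΩ.trans hγ1
  have hCs : CStar Ω Cζ Ch μ σ₁ σs r = Ch / (γ * Λ) := rfl
  have hCs0 : 0 < CStar Ω Cζ Ch μ σ₁ σs r := by rw [hCs]; positivity
  refine ⟨⟨hγ1, hγ2, hCs0⟩, hΩ, hCh, hr, hΛ0, hΛ2, hγ0, by positivity, hexps, hσs₁, hσ₁, hloss,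
    ?_, ?_⟩
  · intro s σ hs hsr hσ
    have hle : Real.exp (-(σ₀ - σ)) ≤ Real.exp (-(σ₀ - σ₁)) := Real.exp_le_exp.mpr (by linarith)
    have h1 : Real.exp (-(σ₀ - σ)) / (1 - Real.exp (-(σ₀ - σ))) ≤ 2 * μ * Real.exp σ₁ / Λ := by
      have h2 : Real.exp (-(σ₀ - σ₁)) = 2 * μ * Real.exp σ₁ := by
        rw [← hexp0, ← Real.exp_add]; ring_nf
      rw [← h2]
      exact div_le_div₀ (Real.exp_nonneg _) hle hΛ0 (by linarith)
    have h3 : (2 * s + 2 : ℝ) ≤ 4 * r := by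
      exact_mod_cast (by omega : 2 * s + 2 ≤ 4 * r)
    have h4 : 0 ≤ Real.exp (-(σ₀ - σ)) / (1 - Real.exp (-(σ₀ - σ))) :=
      div_nonneg (Real.exp_nonneg _) (by linarith)
    calc γ + 2 * (2 * s + 2) * Cζ * (Real.exp (-(σ₀ - σ)) / (1 - Real.exp (-(σ₀ - σ))))
        ≤ γ + 2 * (4 * r) * Cζ * (2 * μ * Real.exp σ₁ / Λ) := by gcongr
      _ = 2 * Ω := by
        rw [hγdef, hmu]
        field_simp
        ring
  · rw [hCs]
    field_simp

/-! ### Symmetric functions with decaying seeds -/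

section
variable {N : ℕ}

/-- `f` is a cyclically symmetric function generated by a seed with norm `C` and decay rate
`σ`. -/
def HasSeed (d : ℕ) (σ C : ℝ) (f : PhasePoly N) : Prop := ∃ g, DecayingSeed d g C σ ∧ oplus g = f

lemma DecayingSeed.hasSeed {d : ℕ} {C σ : ℝ} {f : PhasePoly N} (h : DecayingSeed d f C σ) :
    HasSeed d σ C (oplus f) := ⟨f, h, rfl⟩

lemma HasSeed.mono {d : ℕ} {C C' σ σ' : ℝ} {f : PhasePoly N} (h : HasSeed d σ C f) (hC : C ≤ C')
    (hσ : σ' ≤ σ) : HasSeed d σ' C' f := by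
  obtain ⟨g, hg, rfl⟩ := h
  exact (hg.mono hC hσ).hasSeed

lemma isSizeBound_hasSeed (d : ℕ → ℕ) (σ : ℕ → ℝ) :
    IsSizeBound fun l C (f : PhasePoly N) => HasSeed (d l) (σ l) C f where
  zero l := ⟨0, decayingSeed_zero _ _, by rw [← oplusL_apply, map_zero]⟩
  add := by
    rintro l C C' _ _ ⟨f, hf, rfl⟩ ⟨g, hg, rfl⟩
    exact ⟨f + g, hf.add hg, by simp only [← oplusL_apply, map_add]⟩
  smul := by
    rintro l C _ c ⟨f, hf, rfl⟩
    exact ⟨c • f, hf.smul c, by simp only [← oplusL_apply, map_smul]⟩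
  mono h hC := h.mono hC le_rfl
  nonneg := by
    rintro l C _ ⟨f, ⟨F, hF, _⟩, rfl⟩
    exact hF.const_nonneg

/-- If all the brackets `{𝒳_j, f}` are controlled, then so is `D_s f`, even if `f` itself
has no place in the scale. -/
lemma IsSizeBound.apply_lieD_of_brackets {𝒳 : ℕ → PhasePoly N} {Q : ℕ → ℝ → PhasePoly N → Prop}
    (hQ : IsSizeBound Q) {s : ℕ} {a w : ℕ → ℕ → ℝ} {c : ℕ → ℝ}
    (hbr : ∀ j l C f, 1 ≤ j → 1 ≤ l → l + j ≤ s → Q l C f → Q (l + j) (a j l * C) (poisson (𝒳 j) f))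
    (hw0 : ∀ l, 1 ≤ w 0 l)
    (hw : ∀ k l : ℕ, 1 ≤ k → 1 ≤ l → l + k ≤ s →
      ∑ p ∈ antidiagonal k, (p.1 : ℝ) / k * a p.1 l * w p.2 (l + p.1) ≤ w k l)
    (hs : 1 ≤ s) {f : PhasePoly N} (hf : ∀ j, 1 ≤ j → j ≤ s → Q j (c j) (poisson (𝒳 j) f)) :
    Q s (∑ p ∈ antidiagonal s, (p.1 : ℝ) / s * (w p.2 p.1 * c p.1)) (lieD 𝒳 s f) := by
  rw [lieD_eq 𝒳 (by omega)]
  refine hQ.neg (hQ.sum fun p hp => ?_)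
  rw [mem_antidiagonal] at hp
  rcases Nat.eq_zero_or_pos p.1 with h1 | h1
  · simpa [h1] using hQ.zero _
  · have h := hQ.apply_lieD 𝒳 hbr hw0 hw p.2 p.1 h1 (by omega) (hf p.1 h1 (by omega))
    rw [hp] at h
    have h2 := hQ.smul ((p.1 : ℝ) / s) h
    rwa [abs_of_nonneg (by positivity)] at h2

variable [NeZero N] {Ω Cζ Ch σ₀ σ₁ σs Λ γ A : ℝ} {r : ℕ}

/-- A bracket with a generating function costs a fraction `t` of the available decay rate. -/
lemma HasSeed.bracket (R : ConstantRelations Ω Cζ Ch σ₀ σ₁ σs Λ γ A r) {j l : ℕ} (hj : 1 ≤ j)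
    {χ f : PhasePoly N} {σ σ' t C : ℝ}
    (hχ : DecayingSeed (2 * j + 2) χ (A ^ (j - 1) * (Ch / (γ * j))) σ')
    (hf : HasSeed (2 * l + 2) σ C f) (hσ : 0 < σ) (ht0 : 0 < t) (ht1 : t ≤ 1)
    (hσσ : σ + t * (σ₁ - σs) ≤ σ') :
    HasSeed (2 * (l + j) + 2) σ ((j + 1) * (l + 1) * A ^ j / (16 * r ^ 2 * j * t) * C)
      (poisson (oplus χ) f) := by
  obtain ⟨g, hg, rfl⟩ := hf
  have hC : 0 ≤ C := by
    obtain ⟨G, hG, _⟩ := hg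
    exact hG.const_nonneg
  obtain ⟨h, hh, hh'⟩ := hχ.exists_poisson hg (e := 2 * (l + j) + 2) (by ring)
    (mul_pos ht0 (sub_pos.mpr R.rate_lt)) hσ hσσ
  refine ⟨h, hh.mono ?_ le_rfl, hh'⟩
  have hj0 : (0 : ℝ) < j := by exact_mod_cast hj
  have hr0 : (0 : ℝ) < r := by exact_mod_cast R.r_pos
  have hΛ := R.Λ_pos
  have hA := R.A_pos
  have h1 : A ^ (j - 1) * (Ch / (γ * j)) = A ^ j * Λ / (64 * r ^ 2 * j) := by
    rw [← div_div, R.const_eq]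
    obtain ⟨i, rfl⟩ := Nat.exists_eq_add_of_le' hj
    rw [Nat.add_sub_cancel, pow_succ]
    field_simp
    ring
  rw [h1]
  calc ((2 * j + 2 : ℕ) : ℝ) * ((2 * l + 2 : ℕ) : ℝ) * (A ^ j * Λ / (64 * r ^ 2 * j)) * C /
        (1 - Real.exp (-(t * (σ₁ - σs))))
      ≤ ((2 * j + 2 : ℕ) : ℝ) * ((2 * l + 2 : ℕ) : ℝ) * (A ^ j * Λ / (64 * r ^ 2 * j)) * C /
        (t * Λ) := by
        gcongr
        exact R.loss t ht0.le ht1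
    _ = _ := by
        push_cast
        field_simp
        ring

end

/-! ### Construction of the normal form -/

/-- The growth of `D_k` on orders `l ≥ 1` with `l + k ≤ r`. -/
noncomputable def innerFactor (A : ℝ) (r k : ℕ) : ℝ := if k = 0 then 1 else A ^ k / (2 * r)

lemma innerFactor_recursion {A : ℝ} (hA : 0 ≤ A) {r k l : ℕ} (hk : 1 ≤ k) (hl : 1 ≤ l)
    (hkl : l + k ≤ r) :
    ∑ p ∈ antidiagonal k, (p.1 : ℝ) / k * (3 / 32 * (p.1 + 1) * (l + 1) * A ^ p.1 / (r * p.1 * l)) *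
      innerFactor A r p.2 ≤ innerFactor A r k := by
  have hr0 : (0 : ℝ) < r := by exact_mod_cast (by omega : 0 < r)
  have hl1 : (1 : ℝ) ≤ l := by exact_mod_cast hl
  have hk1 : (1 : ℝ) ≤ k := by exact_mod_cast hk
  have hll : (l + 1 : ℝ) ≤ 2 * l := by linarith
  calc ∑ p ∈ antidiagonal k, (p.1 : ℝ) / k *
        (3 / 32 * (p.1 + 1) * (l + 1) * A ^ p.1 / (r * p.1 * l)) * innerFactor A r p.2
      ≤ ∑ p ∈ antidiagonal k, A ^ k * ((if p = (k, 0) then 3 / (8 * (r : ℝ)) else 0) +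
          3 / (32 * (r : ℝ) ^ 2)) := by
        refine Finset.sum_le_sum fun p hp => ?_
        rw [mem_antidiagonal] at hp
        rcases Nat.eq_zero_or_pos p.1 with h1 | h1
        · rw [h1]
          simp only [CharP.cast_eq_zero, zero_div, zero_mul]
          positivity
        have hp1 : (0 : ℝ) < p.1 := by exact_mod_cast h1
        rcases Nat.eq_zero_or_pos p.2 with h2 | h2
        · have h3 : p.1 = k := by omega
          rw [if_pos (Prod.ext h3 h2), h2, innerFactor, if_pos rfl, h3]
          calc (k : ℝ) / k * (3 / 32 * (k + 1) * (l + 1) * A ^ k / (r * k * l)) * 1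
              ≤ (k : ℝ) / k * (3 / 32 * (2 * k) * (2 * l) * A ^ k / (r * k * l)) * 1 := by
                gcongr
                linarith
            _ = A ^ k * (3 / (8 * r)) := by field_simp; ring
            _ ≤ _ := by
                gcongr
                exact le_add_of_nonneg_right (by positivity)
        · rw [if_neg (by rintro rfl; simp at h2), innerFactor, if_neg h2.ne', zero_add]
          have h3 : (p.1 + 1 : ℝ) ≤ k := by exact_mod_cast (by omega : p.1 + 1 ≤ k)
          calc (p.1 : ℝ) / k * (3 / 32 * (p.1 + 1) * (l + 1) * A ^ p.1 / (r * p.1 * l)) *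
                (A ^ p.2 / (2 * r))
              ≤ (p.1 : ℝ) / k * (3 / 32 * k * (2 * l) * A ^ p.1 / (r * p.1 * l)) *
                (A ^ p.2 / (2 * r)) := by gcongr
            _ = A ^ k * (3 / (32 * r ^ 2)) := by
                rw [← hp, pow_add]
                push_cast
                have : (p.1 : ℝ) + p.2 ≠ 0 := by positivity
                field_simp
            _ ≤ _ := le_rfl
    _ = A ^ k * (3 / (8 * r) + (k + 1) * (3 / (32 * (r : ℝ) ^ 2))) := by
        rw [← Finset.mul_sum, Finset.sum_add_distrib, Finset.sum_ite_eq' , if_pos (by simp),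
          Finset.sum_const, Finset.Nat.card_antidiagonal, nsmul_eq_mul]
        push_cast
        rfl
    _ ≤ A ^ k * (3 / (8 * r) + r * (3 / (32 * (r : ℝ) ^ 2))) := by
        have : (k + 1 : ℝ) ≤ r := by exact_mod_cast (by omega : k + 1 ≤ r)
        gcongr
    _ ≤ innerFactor A r k := by
        rw [innerFactor, if_neg (by omega), div_eq_mul_inv (A ^ k)]
        refine mul_le_mul_of_nonneg_left ?_ (by positivity)
        have : 3 / (8 * r) + r * (3 / (32 * (r : ℝ) ^ 2)) = (2 * (r : ℝ))⁻¹ * (15 / 16) := by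
          field_simp
          ring
        rw [this]
        exact mul_le_of_le_one_right (by positivity) (by norm_num)

section
variable {N : ℕ}

lemma oplus_zero : oplus (0 : PhasePoly N) = 0 := by rw [← oplusL_apply, map_zero]

/-- Switching on `𝒳_s` changes `D_s` by `-{𝒳_s, ·}`. -/
lemma lieD_update {𝒳 𝒴 : ℕ → PhasePoly N} {s : ℕ} (hs : 1 ≤ s) (h : ∀ j < s, 𝒳 j = 𝒴 j)
    (h0 : 𝒴 s = 0) (f : PhasePoly N) : lieD 𝒳 s f = lieD 𝒴 s f - poisson (𝒳 s) f := by
  obtain ⟨s, rfl⟩ := Nat.exists_eq_add_of_le' hs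
  rw [lieD_eq 𝒳 (by omega), lieD_eq 𝒴 (by omega), Finset.Nat.sum_antidiagonal_succ',
    Finset.Nat.sum_antidiagonal_succ', h0, poisson_zero_left, lieD_map_zero, smul_zero, zero_add,
    lieD_zero, div_self (by positivity), one_smul, neg_add, neg_add_eq_sub, sub_left_inj, neg_inj]
  refine Finset.sum_congr rfl fun p hp => ?_
  rw [mem_antidiagonal] at hp
  rw [h p.1 (by omega)]
  rcases Nat.eq_zero_or_pos p.1 with h1 | h1
  · simp [h1]
  · rw [lieD_congr 𝒳 (𝒴 := 𝒴) fun j _ hj => h j (by omega)]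

variable [NeZero N]

/-- The functions `χ_1, …, χ_m` generate a transformation that brings the Hamiltonian into normal
form up to order `m`, with normal form terms `ζ_s^⊕ = D_s H_0 + D_{s-1} H_1` and with the
quantitative bounds. -/
structure NormalizedTo (Ω Ch σ₁ σs γ A : ℝ) (r m : ℕ) (ζ₀ h₁ : PhasePoly N)
    (χ ζ : ℕ → PhasePoly N) : Prop where
  eq_zero : ∀ s, s = 0 ∨ m < s → χ s = 0
  gen : ∀ s, 1 ≤ s → s ≤ m →
    DecayingSeed (2 * s + 2) (χ s) (A ^ (s - 1) * (Ch / (γ * s))) (innerRate σ₁ σs r s)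
  normal : ∀ s, 1 ≤ s → s ≤ m →
    DecayingSeed (2 * s + 2) (ζ s) (A ^ (s - 1) * (Ch / s)) (innerRate σ₁ σs r s)
  bracket : ∀ s, 1 ≤ s → s ≤ m →
    HasSeed (2 * s + 2) (innerRate σ₁ σs r s) (A ^ (s - 1) * (Ch / s))
      (poisson (oplus (χ s)) (oplus (hOmega N Ω) + oplus ζ₀))
  comm : ∀ s, 1 ≤ s → s ≤ m → poisson (oplus (hOmega N Ω)) (oplus (ζ s)) = 0
  eq : ∀ s, 1 ≤ s → s ≤ m → oplus (ζ s) =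
    lieD (fun j => oplus (χ j)) s (oplus (hOmega N Ω) + oplus ζ₀) +
      lieD (fun j => oplus (χ j)) (s - 1) (oplus h₁)

namespace NormalizedTo
variable {Ω Cζ Ch σ₀ σ₁ σs Λ γ A : ℝ} {r m : ℕ} {ζ₀ h₁ : PhasePoly N} {χ ζ : ℕ → PhasePoly N}

/-- The right hand side of the homological equation at order `m + 1`. -/
lemma hasSeed_next (R : ConstantRelations Ω Cζ Ch σ₀ σ₁ σs Λ γ A r)
    (hh₁ : DecayingSeed 4 h₁ Ch σ₁) (hN : NormalizedTo Ω Ch σ₁ σs γ A r m ζ₀ h₁ χ ζ)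
    (hm : m + 1 ≤ r) :
    HasSeed (2 * (m + 1) + 2) (innerRate σ₁ σs r (m + 1)) (A ^ m * (Ch / (m + 1 : ℕ)))
      (lieD (fun j => oplus (χ j)) (m + 1) (oplus (hOmega N Ω) + oplus ζ₀) +
        lieD (fun j => oplus (χ j)) m (oplus h₁)) := by
  have hA := R.A_pos
  have hCh := R.Ch_pos
  have hr0 : (0 : ℝ) < r := by exact_mod_cast R.r_pos
  have hQ := isSizeBound_hasSeed (N := N) (fun l => 2 * l + 2) (innerRate σ₁ σs r)
  have hbr : ∀ (j l : ℕ) (C : ℝ) (f : PhasePoly N), 1 ≤ j → 1 ≤ l → l + j ≤ m + 1 →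
      HasSeed (2 * l + 2) (innerRate σ₁ σs r l) C f →
      HasSeed (2 * (l + j) + 2) (innerRate σ₁ σs r (l + j))
        (3 / 32 * (j + 1) * (l + 1) * A ^ j / (r * j * l) * C) (poisson (oplus (χ j)) f) := by
    intro j l C f hj hl hjl hf
    have hl0 : (0 : ℝ) < l := by exact_mod_cast hl
    have hj0 : (0 : ℝ) < j := by exact_mod_cast hj
    have h := HasSeed.bracket R (t := 2 / 3 * (l / r)) hj (hN.gen j hj (by omega))
      (hf.mono le_rfl (innerRate_anti (s' := l + j) R.rate_lt (by omega)))
      (by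
        have h1 := le_innerRate R.rate_lt R.r_pos (s := l + j) (by omega)
        have h2 := R.rate_lt
        have h3 := R.rate_pos
        linarith)
      (by positivity)
      (by
        have : (l : ℝ) / r ≤ 1 := by
          rw [div_le_one hr0]
          exact_mod_cast (by omega : l ≤ r)
        linarith)
      (by
        refine le_of_eq ?_
        unfold innerRate
        push_cast
        field_simp
        ring)
    convert h using 1
    field_simp
    ring
  have hw : ∀ k l : ℕ, 1 ≤ k → 1 ≤ l → l + k ≤ m + 1 →
      ∑ p ∈ antidiagonal k, (p.1 : ℝ) / k *
        (3 / 32 * (p.1 + 1) * (l + 1) * A ^ p.1 / (r * p.1 * l)) * innerFactor A r p.2 ≤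
        innerFactor A r k :=
    fun k l hk hl hkl => innerFactor_recursion hA.le hk hl (by omega)
  have hw0 : 1 ≤ innerFactor A r 0 := by simp [innerFactor]
  have h0 := hQ.apply_lieD_of_brackets (𝒳 := fun j => oplus (χ j)) (w := fun k _ => innerFactor A r k)
    (c := fun j => if j ≤ m then A ^ (j - 1) * (Ch / j) else 0)
    hbr (fun _ => hw0) hw (by omega) (f := oplus (hOmega N Ω) + oplus ζ₀) (fun j hj hjm => by
      split_ifs with h
      · exact hN.bracket j hj h
      · rw [hN.eq_zero j (Or.inr (by omega)), oplus_zero, poisson_zero_left]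
        exact hQ.zero j)
  have h1 := hQ.apply_lieD (fun j => oplus (χ j)) (w := fun k _ => innerFactor A r k)
    hbr (fun _ => hw0) hw m 1 le_rfl (by omega) (f := oplus h₁) (C := Ch)
    (by rw [innerRate_one]; exact hh₁.hasSeed)
  rw [add_comm 1 m] at h1
  refine (hQ.add h0 h1).mono ?_ le_rfl
  have hterm : ∀ p ∈ antidiagonal (m + 1), (p.1 : ℝ) / (m + 1 : ℕ) *
      (innerFactor A r p.2 * (if p.1 ≤ m then A ^ (p.1 - 1) * (Ch / p.1) else 0)) ≤
      if 1 ≤ p.1 ∧ 1 ≤ p.2 then A ^ m * Ch / (2 * r * (m + 1 : ℕ)) else 0 := by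
    intro p hp
    rw [mem_antidiagonal] at hp
    rcases Nat.eq_zero_or_pos p.1 with h1 | h1
    · rw [if_neg (by omega : ¬ (1 ≤ p.1 ∧ 1 ≤ p.2)), h1]; simp
    rcases Nat.eq_zero_or_pos p.2 with h2 | h2
    · rw [if_neg (by omega : ¬ (1 ≤ p.1 ∧ 1 ≤ p.2)), if_neg (by omega : ¬ p.1 ≤ m)]; simp
    rw [if_pos (⟨h1, h2⟩ : 1 ≤ p.1 ∧ 1 ≤ p.2), if_pos (by omega), innerFactor, if_neg h2.ne']
    have hp1 : (0 : ℝ) < p.1 := by exact_mod_cast h1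
    refine le_of_eq ?_
    rw [show m = p.2 + (p.1 - 1) by omega, pow_add]
    field_simp
  have hcard : ∑ p ∈ antidiagonal (m + 1),
      (if 1 ≤ p.1 ∧ 1 ≤ p.2 then A ^ m * Ch / (2 * r * (m + 1 : ℕ)) else 0) =
      m * (A ^ m * Ch / (2 * r * (m + 1 : ℕ))) := by
    rw [Finset.Nat.sum_antidiagonal_succ, if_neg (by simp), zero_add,
      Finset.Nat.sum_antidiagonal_eq_sum_range_succ_mk, Finset.sum_range_succ,
      if_neg (by simp), add_zero, Finset.sum_congr rfl fun i hi =>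
        if_pos ⟨by simp, by have := Finset.mem_range.mp hi; simp; omega⟩,
      Finset.sum_const, Finset.card_range, nsmul_eq_mul]
  refine (add_le_add_left ((Finset.sum_le_sum hterm).trans_eq hcard) _).trans ?_
  rcases Nat.eq_zero_or_pos m with rfl | hm0
  · simp [innerFactor]
  · rw [innerFactor, if_neg hm0.ne']
    have hm' : (m + 1 : ℝ) ≤ r := by exact_mod_cast hm
    have : (m : ℝ) * (A ^ m * Ch / (2 * r * (m + 1 : ℕ))) + A ^ m / (2 * r) * Ch =
        A ^ m * (Ch / (m + 1 : ℕ)) * ((2 * m + 1) / (2 * r)) := by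
      push_cast
      field_simp
      ring
    rw [this]
    refine mul_le_of_le_one_right (by positivity) ?_
    rw [div_le_one (by positivity)]
    linarith

/-- The seeds of the remainder. -/
lemma hasSeed_remainder (R : ConstantRelations Ω Cζ Ch σ₀ σ₁ σs Λ γ A r)
    (hh₁ : DecayingSeed 4 h₁ Ch σ₁) (hN : NormalizedTo Ω Ch σ₁ σs γ A r r ζ₀ h₁ χ ζ)
    {s : ℕ} (hs : r < s) :
    HasSeed (2 * s + 2) σs (2 * (3 / 2 * A) ^ (s - 1) * Ch)
      (lieD (fun j => oplus (χ j)) s (oplus (hOmega N Ω) + oplus ζ₀) +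
        lieD (fun j => oplus (χ j)) (s - 1) (oplus h₁)) := by
  have hA := R.A_pos
  have hCh := R.Ch_pos
  have hr := R.r_pos
  have hr0 : (0 : ℝ) < r := by exact_mod_cast R.r_pos
  have hs0 : (0 : ℝ) < s := by exact_mod_cast (by omega : 0 < s)
  have hQ := isSizeBound_hasSeed (N := N) (fun l => 2 * l + 2) (fun _ => σs)
  have hrate : ∀ j ≤ r, σs ≤ innerRate σ₁ σs r j := fun j hj => by
    have h1 := le_innerRate R.rate_lt R.r_pos hj
    have h2 := R.rate_lt
    linarith
  have hbr : ∀ (j l : ℕ) (C : ℝ) (f : PhasePoly N), 1 ≤ j → 1 ≤ l → l + j ≤ s →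
      HasSeed (2 * l + 2) σs C f →
      HasSeed (2 * (l + j) + 2) σs (bracketFactor A r j l * C) (poisson (oplus (χ j)) f) := by
    intro j l C f hj hl hjl hf
    by_cases hjr : j ≤ r
    · have h := HasSeed.bracket R (t := 1 / 3) hj (hN.gen j hj hjr) hf R.rate_pos (by norm_num)
        (by norm_num) (le_innerRate R.rate_lt R.r_pos hjr)
      rw [bracketFactor, if_pos hjr]
      have hj0 : (0 : ℝ) < j := by exact_mod_cast hj
      convert h using 1
      field_simp
    · rw [bracketFactor, if_neg hjr, hN.eq_zero j (Or.inr (by omega)), oplus_zero,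
        poisson_zero_left, zero_mul]
      exact hQ.zero (l + j)
  have hw : ∀ k l : ℕ, 1 ≤ k → 1 ≤ l → l + k ≤ s →
      ∑ p ∈ antidiagonal k, (p.1 : ℝ) / k * bracketFactor A r p.1 l * lieDFactor A p.2 (l + p.1) ≤
        lieDFactor A k l :=
    fun k l hk _ _ => lieDFactor_recursion hA.le hr k l hk
  have hw0 : ∀ l, 1 ≤ lieDFactor A 0 l := by simp [lieDFactor]
  have h0 := hQ.apply_lieD_of_brackets (𝒳 := fun j => oplus (χ j)) (w := lieDFactor A)
    (c := fun j => if j ≤ r then A ^ (j - 1) * (Ch / j) else 0)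
    hbr hw0 hw (by omega) (f := oplus (hOmega N Ω) + oplus ζ₀) (fun j hj hjm => by
      split_ifs with h
      · exact (hN.bracket j hj h).mono le_rfl (hrate j h)
      · rw [hN.eq_zero j (Or.inr (by omega)), oplus_zero, poisson_zero_left]
        exact hQ.zero j)
  have h1 := hQ.apply_lieD (fun j => oplus (χ j)) (w := lieDFactor A)
    hbr hw0 hw (s - 1) 1 le_rfl (by omega) (f := oplus h₁) (C := Ch)
    (hh₁.hasSeed.mono le_rfl R.rate_lt.le)
  rw [show 1 + (s - 1) = s by omega] at h1
  refine (hQ.add h0 h1).mono ?_ le_rfl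
  set θ : ℝ := (11 / 8) ^ s - 1 with hθ
  have hθ0 : 0 ≤ θ := by rw [hθ, sub_nonneg]; exact one_le_pow₀ (by norm_num)
  have hfac : ∀ k l : ℕ, 1 ≤ k → l + k = s → lieDFactor A k l ≤ A ^ k * θ := by
    intro k l hk hkl
    rw [lieDFactor, if_neg (by omega), hkl]
    have : binomSum s k - 1 ≤ θ := sub_le_sub_right (binomSum_le_pow s k) 1
    gcongr
  have hterm : ∀ p ∈ antidiagonal s, (p.1 : ℝ) / s *
      (lieDFactor A p.2 p.1 * (if p.1 ≤ r then A ^ (p.1 - 1) * (Ch / p.1) else 0)) ≤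
      if 1 ≤ p.1 ∧ p.1 ≤ r then A ^ (s - 1) * Ch * θ / s else 0 := by
    intro p hp
    rw [mem_antidiagonal] at hp
    rcases Nat.eq_zero_or_pos p.1 with h1 | h1
    · rw [if_neg (by omega : ¬ (1 ≤ p.1 ∧ p.1 ≤ r)), h1]; simp
    by_cases h2 : p.1 ≤ r
    · rw [if_pos (⟨h1, h2⟩ : 1 ≤ p.1 ∧ p.1 ≤ r), if_pos h2]
      have hp1 : (0 : ℝ) < p.1 := by exact_mod_cast h1
      calc (p.1 : ℝ) / s * (lieDFactor A p.2 p.1 * (A ^ (p.1 - 1) * (Ch / p.1)))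
          ≤ (p.1 : ℝ) / s * (A ^ p.2 * θ * (A ^ (p.1 - 1) * (Ch / p.1))) := by
            have := hfac p.2 p.1 (by omega) hp
            gcongr
        _ = A ^ (s - 1) * Ch * θ / s := by
            rw [show s - 1 = p.2 + (p.1 - 1) by omega, pow_add]
            field_simp
    · rw [if_neg (by omega : ¬ (1 ≤ p.1 ∧ p.1 ≤ r)), if_neg h2]; simp
  have hcard : ∑ p ∈ antidiagonal s,
      (if 1 ≤ p.1 ∧ p.1 ≤ r then A ^ (s - 1) * Ch * θ / s else 0) =
      r * (A ^ (s - 1) * Ch * θ / s) := by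
    rw [Finset.Nat.sum_antidiagonal_eq_sum_range_succ_mk, ← Finset.sum_filter, Finset.sum_const,
      nsmul_eq_mul, show (Finset.range s.succ).filter (fun i => 1 ≤ i ∧ i ≤ r) = Finset.Icc 1 r by
        ext i; simp; omega]
    simp
  refine (add_le_add ((Finset.sum_le_sum hterm).trans_eq hcard) (mul_le_mul_of_nonneg_right
    (hfac (s - 1) 1 (by omega) (by omega)) hCh.le)).trans ?_
  have hfin := remainder_factor_le hr hs
  calc (r : ℝ) * (A ^ (s - 1) * Ch * θ / s) + A ^ (s - 1) * θ * Ch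
      = A ^ (s - 1) * Ch * (θ * (1 + r / s)) := by field_simp; ring
    _ ≤ A ^ (s - 1) * Ch * (2 * (3 / 2) ^ (s - 1)) := by gcongr
    _ = _ := by rw [mul_pow]; ring

end NormalizedTo

variable {Ω Cζ Ch σ₀ σ₁ σs Λ γ A : ℝ} {r : ℕ} {ζ₀ h₁ : PhasePoly N}

lemma NormalizedTo.exists_succ (R : ConstantRelations Ω Cζ Ch σ₀ σ₁ σs Λ γ A r)
    {Z : ℕ → PhasePoly N} (hZ : DecayingPieces 2 Cζ σ₀ Z) (hZ0 : Z 0 = 0)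
    (hζ₀ : CoeffSum Z ζ₀) (hcomm : poisson (oplus (hOmega N Ω)) (oplus ζ₀) = 0)
    (hh₁ : DecayingSeed 4 h₁ Ch σ₁) {m : ℕ} {χ ζ : ℕ → PhasePoly N}
    (hN : NormalizedTo Ω Ch σ₁ σs γ A r m ζ₀ h₁ χ ζ) (hm : m + 1 ≤ r) :
    ∃ χ' ζ', NormalizedTo Ω Ch σ₁ σs γ A r (m + 1) ζ₀ h₁ χ' ζ' := by
  obtain ⟨ψ, hψ, hψ'⟩ := hN.hasSeed_next R hh₁ hm
  have hγ := R.γ_pos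
  have hCh := R.Ch_pos
  have hA := R.A_pos
  have hle := innerRate_le (r := r) R.rate_lt (s := m + 1) (by omega)
  have hpos : 0 < innerRate σ₁ σs r (m + 1) := by
    have h1 := le_innerRate R.rate_lt R.r_pos hm
    have h2 := R.rate_lt
    have h3 := R.rate_pos
    linarith
  obtain ⟨x, z, hx, hz, hd, hzc, heq⟩ := hψ.exists_homological (B := A ^ m * (Ch / (γ * (m + 1 : ℕ))))
    R.Ω_pos hZ hZ0 hζ₀ hcomm hpos (hle.trans_lt R.rate_lt') (by positivity) (by
      have h := R.divisor (m + 1) (innerRate σ₁ σs r (m + 1)) (by omega) hm hle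
      have h1 : A ^ m * (Ch / (m + 1 : ℕ)) = γ * (A ^ m * (Ch / (γ * (m + 1 : ℕ)))) := by
        field_simp
      rw [h1, ← add_mul]
      exact mul_le_mul_of_nonneg_right h (by positivity))
  set χ' : ℕ → PhasePoly N := Function.update χ (m + 1) x with hχ'
  set ζ' : ℕ → PhasePoly N := Function.update ζ (m + 1) z with hζ'
  have hχs : ∀ s, s ≤ m → χ' s = χ s := fun s hs => Function.update_of_ne (by omega) _ _
  have hζs : ∀ s, s ≤ m → ζ' s = ζ s := fun s hs => Function.update_of_ne (by omega) _ _
  have hχm : χ' (m + 1) = x := Function.update_self ..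
  have hζm : ζ' (m + 1) = z := Function.update_self ..
  have hcongr : ∀ s ≤ m, ∀ f, lieD (fun j => oplus (χ' j)) s f = lieD (fun j => oplus (χ j)) s f :=
    fun s hs f => lieD_congr _ (fun j _ hj => by rw [hχs j (by omega)]) f
  refine ⟨χ', ζ', ?_, ?_, ?_, ?_, ?_, ?_⟩
  · intro s hs
    rw [hχ', Function.update_of_ne (by omega)]
    exact hN.eq_zero s (by omega)
  · intro s hs hsm
    rcases Nat.lt_or_eq_of_le hsm with h | rfl
    · rw [hχs s (by omega)]; exact hN.gen s hs (by omega)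
    · rw [hχm]; exact hx
  · intro s hs hsm
    rcases Nat.lt_or_eq_of_le hsm with h | rfl
    · rw [hζs s (by omega)]; exact hN.normal s hs (by omega)
    · rw [hζm]; exact hz
  · intro s hs hsm
    rcases Nat.lt_or_eq_of_le hsm with h | rfl
    · rw [hχs s (by omega)]; exact hN.bracket s hs (by omega)
    · rw [hχm, heq]; exact hd.hasSeed
  · intro s hs hsm
    rcases Nat.lt_or_eq_of_le hsm with h | rfl
    · rw [hζs s (by omega)]; exact hN.comm s hs (by omega)
    · rw [hζm]; exact hzc
  · intro s hs hsm
    rcases Nat.lt_or_eq_of_le hsm with h | rfl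
    · rw [hζs s (by omega), hcongr s (by omega), hcongr (s - 1) (by omega)]
      exact hN.eq s hs (by omega)
    · rw [hζm, Nat.add_sub_cancel, hcongr m le_rfl,
        lieD_update (𝒴 := fun j => oplus (χ j)) (by omega)
          (fun j hj => by rw [hχs j (by omega)])
          (by rw [hN.eq_zero _ (Or.inr (by omega)), oplus_zero]), hχm, heq,
        sub_add_eq_add_sub, ← hψ']
      simp only [← oplusL_apply, map_sub]
      abel

theorem exists_normalizedTo (R : ConstantRelations Ω Cζ Ch σ₀ σ₁ σs Λ γ A r)
    {Z : ℕ → PhasePoly N} (hZ : DecayingPieces 2 Cζ σ₀ Z) (hZ0 : Z 0 = 0)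
    (hζ₀ : CoeffSum Z ζ₀) (hcomm : poisson (oplus (hOmega N Ω)) (oplus ζ₀) = 0)
    (hh₁ : DecayingSeed 4 h₁ Ch σ₁) (m : ℕ) (hm : m ≤ r) :
    ∃ χ ζ, NormalizedTo Ω Ch σ₁ σs γ A r m ζ₀ h₁ χ ζ := by
  induction m with
  | zero =>
    refine ⟨fun _ => 0, fun _ => 0, fun _ _ => rfl, ?_, ?_, ?_, ?_, ?_⟩
    all_goals intro s h1 h2; omega
  | succ m ih =>
    obtain ⟨χ, ζ, hN⟩ := ih (by omega)
    exact hN.exists_succ R hZ hZ0 hζ₀ hcomm hh₁ hm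

/-- If the terms of the normal form are `D_s H_0 + D_{s-1} H_1`, then the Lie transform sends the
normal form to `H_0 + H_1`. -/
lemma sum_lieE_eq_hamTerm (𝒳 K : ℕ → PhasePoly N)
    (h0 : K 0 = oplus (hOmega N Ω) + oplus ζ₀)
    (hK : ∀ s, 1 ≤ s →
      K s = lieD 𝒳 s (oplus (hOmega N Ω) + oplus ζ₀) + lieD 𝒳 (s - 1) (oplus h₁)) (s : ℕ) :
    ∑ l ∈ Finset.range (s + 1), lieE 𝒳 (s - l) (K l) = hamTerm Ω ζ₀ h₁ s := by
  have hinv : ∀ (n : ℕ) (f : PhasePoly N),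
      ∑ l ∈ Finset.range (n + 1), lieE 𝒳 (n - l) (lieD 𝒳 l f) = if n = 0 then f else 0 := by
    intro n f
    split_ifs with hn
    · subst hn
      simp [lieE_zero, lieD_zero]
    · rw [← sum_lieE_lieD 𝒳 n hn f, ← Finset.Nat.sum_antidiagonal_swap,
        Finset.Nat.sum_antidiagonal_eq_sum_range_succ_mk]
      rfl
  rcases s with _ | s
  · simp [lieE_zero, h0, hamTerm]
  · have hsplit : ∑ l ∈ Finset.range (s + 1 + 1), lieE 𝒳 (s + 1 - l) (K l) =
        ∑ l ∈ Finset.range (s + 1 + 1),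
          lieE 𝒳 (s + 1 - l) (lieD 𝒳 l (oplus (hOmega N Ω) + oplus ζ₀)) +
        ∑ l ∈ Finset.range (s + 1), lieE 𝒳 (s - l) (lieD 𝒳 l (oplus h₁)) := by
      rw [Finset.sum_range_succ', Finset.sum_range_succ' _ (s + 1), h0, lieD_zero, add_right_comm,
        ← Finset.sum_add_distrib]
      congr 1
      refine Finset.sum_congr rfl fun l _ => ?_
      rw [hK (l + 1) (by omega), lieE_add, Nat.add_sub_cancel, Nat.add_sub_add_right]
    rw [hsplit, hinv, hinv, if_neg (by omega), zero_add]
    rcases s with _ | s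
    · simp [hamTerm]
    · simp [hamTerm]

end

/-! ### Polynomials as functions on phase space -/

section
variable {σ : Type*}

/-- The value of a monomial of degree `n` as a product of `n` factors. -/
lemma exists_prod_eq_monomial {n : ℕ} (k : σ →₀ ℕ) (hk : k.degree = n) :
    ∃ v : Fin n → σ, ∀ w : σ → ℂ, ∏ i, w (v i) = k.prod fun a e => w a ^ e := by
  classical
  induction n generalizing k with
  | zero =>
    rw [Finsupp.degree_eq_zero_iff] at hk
    subst hk
    exact ⟨Fin.elim0, fun w => by simp⟩
  | succ n ih =>
    obtain ⟨a, ha⟩ : ∃ a, k a ≠ 0 := by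
      by_contra! h
      rw [(Finsupp.ext h : k = 0)] at hk
      simp at hk
    obtain ⟨k', rfl⟩ : ∃ k', k = Finsupp.single a 1 + k' := by
      refine ⟨k - Finsupp.single a 1, (add_tsub_cancel_of_le ?_).symm⟩
      exact Finsupp.single_le_iff.mpr (Nat.one_le_iff_ne_zero.mpr ha)
    rw [map_add, Finsupp.degree_single] at hk
    obtain ⟨v, hv⟩ := ih k' (by omega)
    refine ⟨Fin.cons a v, fun w => ?_⟩
    rw [Fin.prod_univ_succ, Finsupp.prod_add_index' (by simp) (fun _ _ _ => pow_add _ _ _),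
      Finsupp.prod_single_index (by simp)]
    simp [hv]

lemma MvPolynomial.IsHomogeneous.degree_eq {R : Type*} [CommSemiring R]
    {P : MvPolynomial σ R} {d : ℕ} (hP : P.IsHomogeneous d) {k : σ →₀ ℕ} (hk : k ∈ P.support) :
    k.degree = d := by
  rw [Finsupp.degree_eq_weight_one]
  exact hP (mem_support_iff.mp hk)

lemma norm_eval_le_coeffNorm {P : MvPolynomial σ ℂ} {d : ℕ} (hP : P.IsHomogeneous d) {w : σ → ℂ}
    {M : ℝ} (hw : ∀ v, ‖w v‖ ≤ M) : ‖eval w P‖ ≤ coeffNorm P * M ^ d := by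
  rw [eval_eq, coeffNorm, Finset.sum_mul]
  refine (norm_sum_le _ _).trans (Finset.sum_le_sum fun k hk => ?_)
  obtain ⟨v, hv⟩ := exists_prod_eq_monomial k (hP.degree_eq hk)
  rw [norm_mul]
  refine mul_le_mul_of_nonneg_left ?_ (norm_nonneg _)
  have h : ∏ i ∈ k.support, w i ^ k i = ∏ i, w (v i) := (hv w).symm
  rw [h, norm_prod]
  exact (Finset.prod_le_prod (fun _ _ => norm_nonneg _) fun i _ => hw _).trans_eq (by simp)

/-- Cauchy-Schwarz bound for the values of a polynomial at several points. -/
lemma sum_norm_eval_sq_le {ι : Type*} [Fintype ι] {P : MvPolynomial σ ℂ} {d : ℕ}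
    (hP : P.IsHomogeneous (d + 1)) {w : ι → σ → ℂ} {B : ℝ} (hB : ∀ v, ∑ j, ‖w j v‖ ^ 2 ≤ B) :
    ∑ j, ‖eval (w j) P‖ ^ 2 ≤ coeffNorm P ^ 2 * B ^ (d + 1) := by
  have hmon : ∀ k ∈ P.support, ∑ j, ‖∏ i ∈ k.support, w j i ^ k i‖ ^ 2 ≤ B ^ (d + 1) := by
    intro k hk
    obtain ⟨v, hv⟩ := exists_prod_eq_monomial k (hP.degree_eq hk)
    have hB0 : 0 ≤ B := (Finset.sum_nonneg fun j _ => sq_nonneg _).trans (hB (v 0))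
    calc ∑ j, ‖∏ i ∈ k.support, w j i ^ k i‖ ^ 2
        = ∑ j, ‖w j (v 0)‖ ^ 2 * ∏ i : Fin d, ‖w j (v i.succ)‖ ^ 2 := by
          refine Finset.sum_congr rfl fun j _ => ?_
          have h : ∏ i ∈ k.support, w j i ^ k i = ∏ i, w j (v i) := (hv (w j)).symm
          rw [h, Fin.prod_univ_succ, norm_mul, mul_pow, norm_prod, Finset.prod_pow]
      _ ≤ ∑ j, ‖w j (v 0)‖ ^ 2 * B ^ d := by
          refine Finset.sum_le_sum fun j _ => mul_le_mul_of_nonneg_left ?_ (sq_nonneg _)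
          refine (Finset.prod_le_prod (fun _ _ => sq_nonneg _) fun i _ =>
            (Finset.single_le_sum (f := fun j => ‖w j (v i.succ)‖ ^ 2) (fun _ _ => sq_nonneg _)
              (Finset.mem_univ j)).trans (hB _)).trans_eq (by simp)
      _ ≤ B * B ^ d := by
          rw [← Finset.sum_mul]
          exact mul_le_mul_of_nonneg_right (hB _) (by positivity)
      _ = B ^ (d + 1) := by ring
  have hpt : ∀ j, ‖eval (w j) P‖ ^ 2 ≤
      coeffNorm P * ∑ k ∈ P.support, ‖P.coeff k‖ * ‖∏ i ∈ k.support, w j i ^ k i‖ ^ 2 := by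
    intro j
    have h1 : ‖eval (w j) P‖ ≤ ∑ k ∈ P.support, ‖P.coeff k‖ * ‖∏ i ∈ k.support, w j i ^ k i‖ := by
      rw [eval_eq]
      refine (norm_sum_le _ _).trans_eq ?_
      simp only [norm_mul]
    refine (pow_le_pow_left₀ (norm_nonneg _) h1 2).trans ?_
    rw [coeffNorm]
    exact Finset.sum_sq_le_sum_mul_sum_of_sq_le_mul _ (fun _ _ => norm_nonneg _)
      (fun _ _ => by positivity) (fun _ _ => le_of_eq (by ring))
  calc ∑ j, ‖eval (w j) P‖ ^ 2
      ≤ ∑ j, coeffNorm P * ∑ k ∈ P.support, ‖P.coeff k‖ * ‖∏ i ∈ k.support, w j i ^ k i‖ ^ 2 :=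
        Finset.sum_le_sum fun j _ => hpt j
    _ = coeffNorm P * ∑ k ∈ P.support, ‖P.coeff k‖ * ∑ j, ‖∏ i ∈ k.support, w j i ^ k i‖ ^ 2 := by
        rw [← Finset.mul_sum, Finset.sum_comm]
        simp only [Finset.mul_sum]
    _ ≤ coeffNorm P * ∑ k ∈ P.support, ‖P.coeff k‖ * B ^ (d + 1) := by
        refine mul_le_mul_of_nonneg_left (Finset.sum_le_sum fun k hk => ?_) (coeffNorm_nonneg _)
        exact mul_le_mul_of_nonneg_left (hmon k hk) (norm_nonneg _)
    _ = coeffNorm P ^ 2 * B ^ (d + 1) := by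
        rw [← Finset.sum_mul, ← coeffNorm]
        ring

end

section
variable {N : ℕ} {p : ENNReal}

/-- The complex canonical variables `ξ_j = (x_j - i y_j)/√2`, `η_j = (y_j - i x_j)/√2` as linear
functions on phase space. -/
noncomputable def complexCoord : Var N → Phase N p →L[ℝ] ℂ :=
  Sum.elim
    (fun j => ((1 / Real.sqrt 2 : ℝ) : ℂ) •
      (Complex.ofRealCLM ∘L PiLp.proj p _ (Sum.inl j) -
        Complex.I • (Complex.ofRealCLM ∘L PiLp.proj p _ (Sum.inr j))))
    (fun j => ((1 / Real.sqrt 2 : ℝ) : ℂ) •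
      (Complex.ofRealCLM ∘L PiLp.proj p _ (Sum.inr j) -
        Complex.I • (Complex.ofRealCLM ∘L PiLp.proj p _ (Sum.inl j))))

lemma complexCoord_inl (j : Fin N) (z : Phase N p) : complexCoord (Sum.inl j) z =
    ((1 / Real.sqrt 2 : ℝ) : ℂ) * (z (Sum.inl j) - Complex.I * z (Sum.inr j)) := rfl

lemma complexCoord_inr (j : Fin N) (z : Phase N p) : complexCoord (Sum.inr j) z =
    ((1 / Real.sqrt 2 : ℝ) : ℂ) * (z (Sum.inr j) - Complex.I * z (Sum.inl j)) := rfl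

/-- Evaluating in the complex variables gives the same value. -/
lemma eval_complexHom (z : Phase N p) (f : PhasePoly N) :
    eval (fun v => complexCoord v z) (complexHom N f) = (evalAt z f : ℂ) := by
  have hs : ((1 / Real.sqrt 2 : ℝ) : ℂ) * ((1 / Real.sqrt 2 : ℝ) : ℂ) = 1 / 2 := by
    rw [← Complex.ofReal_mul, div_mul_div_comm, Real.mul_self_sqrt (by norm_num)]
    norm_num
  induction f using MvPolynomial.induction_on with
  | C a => simp [evalAt]
  | add f g hf hg => simp only [map_add, hf, hg, evalAt, Complex.ofReal_add]
  | mul_X f v hf =>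
    rw [map_mul, map_mul, hf]
    have hX : eval (fun v => complexCoord v z) (complexHom N (X v)) = (z v : ℂ) := by
      rcases v with j | j
      · rw [complexHom_X_inl]
        simp only [map_mul, map_add, eval_C, eval_X, complexCoord_inl, complexCoord_inr]
        linear_combination (2 * (z (Sum.inl j) : ℂ)) * hs -
          ((1 / Real.sqrt 2 : ℝ) : ℂ) * ((1 / Real.sqrt 2 : ℝ) : ℂ) * z (Sum.inl j) * Complex.I_sq
      · rw [complexHom_X_inr]
        simp only [map_mul, map_sub, eval_C, eval_X, complexCoord_inl, complexCoord_inr]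
        linear_combination (2 * (z (Sum.inr j) : ℂ)) * hs -
          ((1 / Real.sqrt 2 : ℝ) : ℂ) * ((1 / Real.sqrt 2 : ℝ) : ℂ) *
            (2 * z (Sum.inr j) - Complex.I * z (Sum.inl j)) * Complex.I_sq
    rw [hX]
    simp [evalAt]

lemma norm_complexCoord_sq (v : Var N) (z : Phase N p) : ‖complexCoord v z‖ ^ 2 =
    (z (Sum.inl (site v)) ^ 2 + z (Sum.inr (site v)) ^ 2) / 2 := by
  have hs : (1 / Real.sqrt 2) ^ 2 = 1 / 2 := by
    rw [div_pow, Real.sq_sqrt (by norm_num)]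
    norm_num
  have h : ∀ a b : ℝ, ‖((1 / Real.sqrt 2 : ℝ) : ℂ) * (a - Complex.I * b)‖ ^ 2 =
      (a ^ 2 + b ^ 2) / 2 := by
    intro a b
    rw [norm_mul, mul_pow, Complex.norm_real, Real.norm_eq_abs, sq_abs, hs, Complex.sq_norm,
      Complex.normSq_apply]
    simp
    ring
  rcases v with j | j
  · rw [complexCoord_inl, h]; rfl
  · rw [complexCoord_inr, h, add_comm]; rfl

variable [Fact (1 ≤ p)]

lemma norm_complexCoord_apply_le (v : Var N) (z : Phase N p) : ‖complexCoord v z‖ ≤ ‖z‖ := by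
  refine le_of_sq_le_sq ?_ (norm_nonneg z)
  rw [norm_complexCoord_sq]
  have h : ∀ v : Var N, z v ^ 2 ≤ ‖z‖ ^ 2 := fun v => by
    rw [← sq_abs, ← Real.norm_eq_abs]
    exact pow_le_pow_left₀ (norm_nonneg _) (PiLp.norm_apply_le z v) 2
  linarith [h (Sum.inl (site v)), h (Sum.inr (site v))]

lemma abs_evalAt_le {f : PhasePoly N} {d : ℕ} (hf : f.IsHomogeneous d) (z : Phase N p) :
    |evalAt z f| ≤ polyNorm f * ‖z‖ ^ d := by
  have h := norm_eval_le_coeffNorm (complexHom_isHomogeneous hf)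
    (fun v => norm_complexCoord_apply_le v z)
  rwa [eval_complexHom, Complex.norm_real] at h

lemma exists_multilinear_monomial {n : ℕ} (k : Var N →₀ ℕ) (hk : k.degree = n) :
    ∃ M : ContinuousMultilinearMap ℝ (fun _ : Fin n => Phase N p) ℂ,
      (∀ z, M (fun _ => z) = ∏ i ∈ k.support, complexCoord i z ^ k i) ∧ ‖M‖ ≤ 1 := by
  obtain ⟨v, hv⟩ := exists_prod_eq_monomial k hk
  refine ⟨(ContinuousMultilinearMap.mkPiAlgebra ℝ (Fin n) ℂ).compContinuousLinearMap
    fun i => complexCoord (v i), fun z => ?_, ?_⟩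
  · rw [ContinuousMultilinearMap.compContinuousLinearMap_apply,
      ContinuousMultilinearMap.mkPiAlgebra_apply]
    exact hv fun v => complexCoord v z
  · refine (ContinuousMultilinearMap.norm_compContinuousLinearMap_le _ _).trans ?_
    rw [ContinuousMultilinearMap.norm_mkPiAlgebra, one_mul]
    refine Finset.prod_le_one (fun _ _ => norm_nonneg _) fun i _ => ?_
    refine ContinuousLinearMap.opNorm_le_bound _ zero_le_one fun z => ?_
    rw [one_mul]
    exact norm_complexCoord_apply_le _ z

/-- A homogeneous polynomial is the restriction to the diagonal of a multilinear map whose norm is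
bounded by the polynomial norm. -/
lemma exists_multilinear {f : PhasePoly N} {n : ℕ} (hf : f.IsHomogeneous n) :
    ∃ M : ContinuousMultilinearMap ℝ (fun _ : Fin n => Phase N p) ℂ,
      (∀ z, M (fun _ => z) = (evalAt z f : ℂ)) ∧ ‖M‖ ≤ polyNorm f := by
  have h : ∀ k : Var N →₀ ℕ, ∃ M : ContinuousMultilinearMap ℝ (fun _ : Fin n => Phase N p) ℂ,
      k ∈ (complexHom N f).support →
      (∀ z, M (fun _ => z) = ∏ i ∈ k.support, complexCoord i z ^ k i) ∧ ‖M‖ ≤ 1 := by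
    intro k
    by_cases hk : k ∈ (complexHom N f).support
    · obtain ⟨M, hM⟩ := exists_multilinear_monomial (p := p) k
        ((complexHom_isHomogeneous hf).degree_eq hk)
      exact ⟨M, fun _ => hM⟩
    · exact ⟨0, fun h => absurd h hk⟩
  choose M hM using h
  refine ⟨∑ k ∈ (complexHom N f).support, (complexHom N f).coeff k • M k, fun z => ?_, ?_⟩
  · rw [← eval_complexHom, eval_eq, sum_apply]
    refine Finset.sum_congr rfl fun k hk => ?_
    rw [smul_apply, (hM k hk).1, smul_eq_mul]
  · rw [polyNorm_eq, coeffNorm]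
    refine (norm_sum_le _ _).trans (Finset.sum_le_sum fun k hk => ?_)
    refine (ContinuousMultilinearMap.opNorm_smul_le _ _).trans ?_
    exact mul_le_of_le_one_right (norm_nonneg _) (hM k hk).2

/-- A power series of homogeneous polynomials with geometrically bounded norms is analytic. -/
lemma analyticOnNhd_tsum_evalAt {G : ℕ → PhasePoly N} (hG : ∀ n, (G n).IsHomogeneous n) {ρ C : ℝ}
    (hρ : 0 < ρ) (hC : ∀ n, polyNorm (G n) * ρ ^ n ≤ C) :
    AnalyticOnNhd ℝ (fun z : Phase N p => ∑' n, evalAt z (G n)) (Metric.ball 0 ρ) := by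
  choose M hM hMn using fun n => exists_multilinear (p := p) (hG n)
  set q : FormalMultilinearSeries ℝ (Phase N p) ℂ := fun n => M n with hq
  have hr : ENNReal.ofReal ρ ≤ q.radius := q.le_radius_of_bound C fun n => by
    rw [Real.coe_toNNReal _ hρ.le]
    exact (mul_le_mul_of_nonneg_right (hMn n) (pow_nonneg hρ.le n)).trans (hC n)
  have hr0 : 0 < q.radius := lt_of_lt_of_le (by simpa using hρ) hr
  have han := (q.hasFPowerSeriesOnBall hr0).analyticOnNhd
  have hball : AnalyticOnNhd ℝ q.sum (Metric.ball 0 ρ) := by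
    refine han.mono fun z hz => ?_
    refine Metric.eball_subset_eball hr ?_
    rw [Metric.mem_eball, edist_dist]
    rw [Metric.mem_ball] at hz
    exact (ENNReal.ofReal_lt_ofReal_iff hρ).mpr hz
  have hre := Complex.reCLM.comp_analyticOnNhd hball
  convert hre using 1
  ext z
  have : q.sum z = ((∑' n, evalAt z (G n) : ℝ) : ℂ) := by
    rw [Complex.ofReal_tsum]
    exact tsum_congr fun n => hM n z
  simp [this]

/-- The version of `analyticOnNhd_tsum_evalAt` for a series with gaps: the degrees `e s` of its
terms are distinct, but need not exhaust the natural numbers. -/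
lemma analyticOnNhd_tsum_evalAt_of_injective {f : ℕ → PhasePoly N} {e : ℕ → ℕ}
    (he : Function.Injective e) (hf : ∀ s, (f s).IsHomogeneous (e s)) {ρ C : ℝ} (hρ : 0 < ρ)
    (hC : ∀ s, polyNorm (f s) * ρ ^ e s ≤ C) :
    AnalyticOnNhd ℝ (fun z : Phase N p => ∑' s, evalAt z (f s)) (Metric.ball 0 ρ) := by
  have hC0 : 0 ≤ C :=
    (mul_nonneg (polyNorm_nonneg (f 0)) (pow_nonneg hρ.le (e 0))).trans (hC 0)
  have hout : ∀ n, (¬ ∃ s, e s = n) → Function.extend e f (fun _ => 0) n = 0 := fun n hn =>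
    Function.extend_apply' f _ n hn
  have hG := analyticOnNhd_tsum_evalAt (p := p) (G := Function.extend e f fun _ => 0) (C := C)
    (fun n => by
      by_cases hn : ∃ s, e s = n
      · obtain ⟨s, rfl⟩ := hn
        rw [he.extend_apply]
        exact hf s
      · rw [hout n hn]
        exact isHomogeneous_zero _ _ _) hρ
    (fun n => by
      by_cases hn : ∃ s, e s = n
      · obtain ⟨s, rfl⟩ := hn
        rw [he.extend_apply]
        exact hC s
      · rw [hout n hn, polyNorm_zero, zero_mul]
        exact hC0)
  convert hG using 1
  ext z
  refine Eq.trans ?_ (he.tsum_eq ?_)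
  · exact tsum_congr fun s => by rw [he.extend_apply]
  · intro n hn
    by_contra h
    rw [Function.mem_support, hout n h] at hn
    simp [evalAt] at hn

end

/-- The norm of a vector field with cyclically covariant components is controlled by the norm of
the components, uniformly in `N`, both for the `ℓ²` and the `ℓ^∞` norm. -/
lemma norm_toLp_evalAt_le {N : ℕ} [NeZero N] {p : ENNReal} [Fact (1 ≤ p)] (hp : p = 2 ∨ p = ⊤)
    {F : Var N → PhasePoly N} {d : ℕ} {a : ℝ} (hF : ∀ v, (F v).IsHomogeneous (d + 1))
    (hcov : ∀ l v, F (shiftVar l v) = shiftBy l (F v)) (ha : ∀ v, polyNorm (F v) ≤ a)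
    (z : Phase N p) :
    ‖(WithLp.toLp p fun v => evalAt z (F v) : Phase N p)‖ ≤ a * ‖z‖ ^ (d + 1) := by
  have ha0 : 0 ≤ a := (polyNorm_nonneg _).trans (ha (Sum.inl 0))
  rcases hp with rfl | rfl
  · refine le_of_sq_le_sq ?_ (by positivity)
    rw [PiLp.norm_sq_eq_of_L2, Fintype.sum_sum_type]
    have hB : ∀ v : Var N, ∑ l : Fin N, ‖complexCoord (shiftVar l v) z‖ ^ 2 ≤ ‖z‖ ^ 2 / 2 := by
      intro v
      rw [PiLp.norm_sq_eq_of_L2, Fintype.sum_sum_type, ← Finset.sum_add_distrib, Finset.sum_div]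
      refine le_of_eq ?_
      rw [← Equiv.sum_comp (Equiv.addLeft (site v))
        fun l => (‖z (Sum.inl l)‖ ^ 2 + ‖z (Sum.inr l)‖ ^ 2) / 2]
      refine Finset.sum_congr rfl fun l _ => ?_
      rw [norm_complexCoord_sq, show site (shiftVar l v) = Equiv.addLeft (site v) l by
        rcases v with j | j <;> rfl]
      simp
    have hblock : ∀ v : Var N, ∑ l : Fin N, ‖evalAt z (F (shiftVar l v))‖ ^ 2 ≤
        a ^ 2 * (‖z‖ ^ 2 / 2) ^ (d + 1) := by
      intro v
      have h := sum_norm_eval_sq_le (complexHom_isHomogeneous (hF v))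
        (w := fun (l : Fin N) u => complexCoord (shiftVar l u) z) hB
      refine le_trans (le_of_eq (Finset.sum_congr rfl fun l _ => ?_)) (h.trans ?_)
      · rw [hcov, ← Complex.norm_real, ← eval_complexHom, complexHom_shiftBy, eval_rename]
        rfl
      · have := ha v
        have h0 := polyNorm_nonneg (F v)
        rw [polyNorm_eq] at this h0
        gcongr
    have h1 := hblock (Sum.inl 0)
    have h2 := hblock (Sum.inr 0)
    simp only [shiftVar, Sum.map_inl, Sum.map_inr, zero_add] at h1 h2
    refine (add_le_add h1 h2).trans ?_
    have h3 : (‖z‖ ^ 2 / 2) ^ (d + 1) ≤ ‖z‖ ^ (2 * (d + 1)) / 2 := by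
      rw [div_pow, ← pow_mul]
      refine div_le_div_of_nonneg_left (by positivity) (by norm_num) ?_
      exact le_self_pow₀ (by norm_num) (by omega)
    have h4 : a ^ 2 * (‖z‖ ^ 2 / 2) ^ (d + 1) ≤ a ^ 2 * (‖z‖ ^ (2 * (d + 1)) / 2) := by gcongr
    calc _ ≤ a ^ 2 * (‖z‖ ^ (2 * (d + 1)) / 2) + a ^ 2 * (‖z‖ ^ (2 * (d + 1)) / 2) :=
          add_le_add h4 h4
      _ = _ := by ring
  · rw [PiLp.norm_eq_ciSup]
    refine ciSup_le fun v => (abs_evalAt_le (hF v) z).trans ?_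
    have := ha v
    gcongr

/-! ### Derivatives of polynomials on phase space -/

section
variable {N : ℕ} {p : ENNReal}

/-- The derivative of the function defined by a polynomial. -/
noncomputable def evalDeriv (f : PhasePoly N) (z : Phase N p) : Phase N p →L[ℝ] ℝ :=
  ∑ a, evalAt z (pderiv a f) • PiLp.proj p (fun _ : Var N => ℝ) a

lemma evalDeriv_apply (f : PhasePoly N) (z u : Phase N p) :
    evalDeriv f z u = ∑ a, evalAt z (pderiv a f) * u a := by
  simp [evalDeriv]

variable [Fact (1 ≤ p)]

lemma hasFDerivAt_evalAt (f : PhasePoly N) (z : Phase N p) :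
    HasFDerivAt (fun z => evalAt z f) (evalDeriv f z) z := by
  classical
  induction f using MvPolynomial.induction_on with
  | C c =>
    have h1 : (fun z : Phase N p => evalAt z (C c : PhasePoly N)) = fun _ => c := by
      ext; simp [evalAt]
    have h2 : evalDeriv (C c) z = 0 := by ext u; simp [evalDeriv_apply, evalAt]
    rw [h1, h2]
    exact hasFDerivAt_const c z
  | add f g hf hg =>
    have h1 : (fun z : Phase N p => evalAt z (f + g)) = fun z => evalAt z f + evalAt z g := by
      ext; simp [evalAt]
    have h2 : evalDeriv (f + g) z = evalDeriv f z + evalDeriv g z := by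
      ext u
      simp [evalDeriv_apply, evalAt, add_mul, Finset.sum_add_distrib]
    rw [h1, h2]
    exact hf.add hg
  | mul_X f v hf =>
    have h1 : (fun z : Phase N p => evalAt z (f * X v)) = fun z => evalAt z f * z v := by
      ext; simp [evalAt]
    have h2 : evalDeriv (f * X v) z =
        evalAt z f • PiLp.proj p (fun _ : Var N => ℝ) v + z v • evalDeriv f z := by
      ext u
      simp only [evalDeriv_apply, evalAt, Derivation.leibniz, pderiv_X, smul_eq_mul, map_add,
        map_mul, eval_X, add_mul, Finset.sum_add_distrib, add_apply, smul_apply, PiLp.proj_apply,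
        Finset.mul_sum]
      congr 1
      · rw [Finset.sum_eq_single v]
        · simp
        · intro b _ hb
          simp [hb.symm]
        · simp
      · exact Finset.sum_congr rfl fun a _ => by ring
    rw [h1, h2]
    exact hf.mul (PiLp.proj p (fun _ : Var N => ℝ) v).hasFDerivAt

lemma norm_proj_le (v : Var N) : ‖(PiLp.proj p _ v : Phase N p →L[ℝ] ℝ)‖ ≤ 1 :=
  ContinuousLinearMap.opNorm_le_bound _ zero_le_one fun z => by
    rw [one_mul]
    exact PiLp.norm_apply_le z v

lemma polyNorm_pderiv_le [NeZero N] {f : PhasePoly N} {d : ℕ} (hf : f.IsHomogeneous d)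
    (v : Var N) : polyNorm (pderiv v f) ≤ Real.sqrt 2 * d * polyNorm f := by
  have h : ∀ w : Var N, polyNorm (poisson f (X w)) ≤ Real.sqrt 2 * d * polyNorm f := by
    intro w
    have h1 := sum_polyNorm_poisson_shiftBy_le hf (isHomogeneous_X ℝ w)
    have h2 : polyNorm (poisson f (X w)) ≤
        ∑ l : Fin N, polyNorm (poisson f (shiftBy l (X w))) := by
      have := Finset.single_le_sum (f := fun l : Fin N => polyNorm (poisson f (shiftBy l (X w))))
        (fun _ _ => polyNorm_nonneg _) (Finset.mem_univ 0)
      simpa only [shiftBy_zero] using this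
    refine h2.trans (h1.trans ?_)
    have h3 := polyNorm_X_le w
    have h4 := polyNorm_nonneg f
    calc (d : ℝ) * (1 : ℕ) * polyNorm f * polyNorm (X w)
        ≤ (d : ℝ) * (1 : ℕ) * polyNorm f * Real.sqrt 2 := by gcongr
      _ = _ := by push_cast; ring
  rcases v with j | j
  · rw [← poisson_X_inr]; exact h _
  · rw [← polyNorm_neg, ← poisson_X_inl]; exact h _

lemma isHomogeneous_pderiv_succ {f : PhasePoly N} {d : ℕ} (hf : f.IsHomogeneous (d + 1))
    (v : Var N) : (pderiv v f).IsHomogeneous d := hf.pderiv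

lemma abs_evalAt_pderiv_le [NeZero N] {f : PhasePoly N} {d : ℕ} (hf : f.IsHomogeneous (d + 1))
    (v : Var N) (z : Phase N p) :
    |evalAt z (pderiv v f)| ≤ Real.sqrt 2 * (d + 1 : ℕ) * polyNorm f * ‖z‖ ^ d :=
  (abs_evalAt_le (isHomogeneous_pderiv_succ hf v) z).trans
    (mul_le_mul_of_nonneg_right (polyNorm_pderiv_le hf v) (by positivity))

lemma norm_evalDeriv_le [NeZero N] {f : PhasePoly N} {d : ℕ} (hf : f.IsHomogeneous (d + 1))
    (z : Phase N p) : ‖evalDeriv f z‖ ≤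
      Fintype.card (Var N) * (Real.sqrt 2 * (d + 1 : ℕ) * polyNorm f * ‖z‖ ^ d) := by
  rw [evalDeriv]
  refine (norm_sum_le _ _).trans ((Finset.sum_le_sum (g := fun _ =>
    Real.sqrt 2 * (d + 1 : ℕ) * polyNorm f * ‖z‖ ^ d) fun a _ => ?_).trans_eq (by simp))
  rw [norm_smul]
  exact (mul_le_of_le_one_right (norm_nonneg _) (norm_proj_le a)).trans
    (abs_evalAt_pderiv_le hf a z)

end

/-! ### Lie series as transformations of phase space -/

section
variable {N : ℕ}

/-- The properties shared by the families `E_n` and `D_n` of operators: they form a formal one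
parameter family of homomorphisms for the product and for the bracket, commute with translations,
and are bounded geometrically on the coordinate functions. -/
structure IsLieSeries (B : ℝ) (Φ : ℕ → PhasePoly N → PhasePoly N) : Prop where
  zero : ∀ f, Φ 0 f = f
  add : ∀ n f g, Φ n (f + g) = Φ n f + Φ n g
  const : ∀ n c, n ≠ 0 → Φ n (C c) = 0
  mul : ∀ n f g, Φ n (f * g) = ∑ p ∈ antidiagonal n, Φ p.1 f * Φ p.2 g
  bracket : ∀ n f g,
    Φ n (poisson f g) = ∑ p ∈ antidiagonal n, poisson (Φ p.1 f) (Φ p.2 g)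
  shift : ∀ n l f, shiftBy l (Φ n f) = Φ n (shiftBy l f)
  homogeneous : ∀ n v, (Φ n (X v)).IsHomogeneous (2 * n + 1)
  bound : ∀ n v, polyNorm (Φ n (X v)) ≤ Real.sqrt 2 * B ^ n

/-- The map of phase space defined by applying a Lie series to the coordinate functions. -/
noncomputable def seriesMap {p : ENNReal} (Φ : ℕ → PhasePoly N → PhasePoly N) (z : Phase N p) :
    Phase N p :=
  WithLp.toLp p fun v => ∑' n, evalAt z (Φ n (X v))

lemma seriesMap_apply {p : ENNReal} (Φ : ℕ → PhasePoly N → PhasePoly N) (z : Phase N p)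
    (v : Var N) : seriesMap Φ z v = ∑' n, evalAt z (Φ n (X v)) := rfl

lemma evalAt_sum {p : ENNReal} {ι : Type*} (t : Finset ι) (f : ι → PhasePoly N) (z : Phase N p) :
    evalAt z (∑ i ∈ t, f i) = ∑ i ∈ t, evalAt z (f i) := by
  simp [evalAt]

lemma evalAt_add {p : ENNReal} (f g : PhasePoly N) (z : Phase N p) :
    evalAt z (f + g) = evalAt z f + evalAt z g := by simp [evalAt]

lemma evalAt_mul {p : ENNReal} (f g : PhasePoly N) (z : Phase N p) :
    evalAt z (f * g) = evalAt z f * evalAt z g := by simp [evalAt]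

lemma evalAt_C {p : ENNReal} (c : ℝ) (z : Phase N p) : evalAt z (C c : PhasePoly N) = c := by
  simp [evalAt]

lemma evalAt_X {p : ENNReal} (v : Var N) (z : Phase N p) : evalAt z (X v : PhasePoly N) = z v := by
  simp [evalAt]

lemma evalAt_poisson {p : ENNReal} (f g : PhasePoly N) (z : Phase N p) :
    evalAt z (poisson f g) = ∑ j : Fin N,
      (evalAt z (pderiv (Sum.inl j) f) * evalAt z (pderiv (Sum.inr j) g) -
        evalAt z (pderiv (Sum.inr j) f) * evalAt z (pderiv (Sum.inl j) g)) := by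
  simp [evalAt, poisson]

end

/-- The Cauchy product. -/
lemma HasSum.mul_antidiagonal {f g : ℕ → ℝ} {a b : ℝ} (hf : HasSum f a) (hg : HasSum g b) :
    HasSum (fun n => ∑ p ∈ antidiagonal n, f p.1 * g p.2) (a * b) :=
  (hf.mul hg (summable_mul_of_summable_norm hf.summable.norm hg.summable.norm)).sum_antidiagonal

lemma hasSum_ite_eq_zero (c : ℝ) : HasSum (fun n : ℕ => if n = 0 then c else 0) c :=
  hasSum_ite_eq 0 c

namespace IsLieSeries
variable {N : ℕ} {p : ENNReal} [Fact (1 ≤ p)] {B : ℝ} {Φ : ℕ → PhasePoly N → PhasePoly N}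

lemma abs_evalAt_X_le (hΦ : IsLieSeries B Φ) (z : Phase N p) (n : ℕ) (v : Var N) :
    |evalAt z (Φ n (X v))| ≤ Real.sqrt 2 * ‖z‖ * (B * ‖z‖ ^ 2) ^ n := by
  refine (abs_evalAt_le (hΦ.homogeneous n v) z).trans ?_
  calc polyNorm (Φ n (X v)) * ‖z‖ ^ (2 * n + 1)
      ≤ Real.sqrt 2 * B ^ n * ‖z‖ ^ (2 * n + 1) := by
        have := hΦ.bound n v
        gcongr
    _ = _ := by rw [mul_pow]; ring

lemma hasSum_X (hΦ : IsLieSeries B Φ) (hB : 0 ≤ B) {z : Phase N p} (hz : B * ‖z‖ ^ 2 < 1)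
    (v : Var N) : HasSum (fun n => evalAt z (Φ n (X v))) (seriesMap Φ z v) := by
  refine Summable.hasSum (Summable.of_norm_bounded
    ((summable_geometric_of_lt_one (by positivity) hz).mul_left (Real.sqrt 2 * ‖z‖))
    fun n => hΦ.abs_evalAt_X_le z n v)

/-- Exchange theorem: transforming a polynomial amounts to substituting the transformed
coordinates. -/
lemma hasSum_evalAt (hΦ : IsLieSeries B Φ) (hB : 0 ≤ B) {z : Phase N p} (hz : B * ‖z‖ ^ 2 < 1)
    (f : PhasePoly N) : HasSum (fun n => evalAt z (Φ n f)) (evalAt (seriesMap Φ z) f) := by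
  induction f using MvPolynomial.induction_on with
  | C c =>
    have h : ∀ n, evalAt z (Φ n (C c)) = if n = 0 then c else 0 := by
      intro n
      split_ifs with hn
      · rw [hn, hΦ.zero, evalAt_C]
      · rw [hΦ.const n c hn]; simp [evalAt]
    rw [evalAt_C, funext h]
    exact hasSum_ite_eq_zero c
  | add f g hf hg =>
    simp only [hΦ.add, evalAt_add]
    exact hf.add hg
  | mul_X f v hf =>
    have h := HasSum.mul_antidiagonal hf (hΦ.hasSum_X hB hz v)
    rw [evalAt_mul, evalAt_X]
    refine h.congr_fun fun n => ?_
    rw [hΦ.mul, evalAt_sum]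
    simp only [evalAt_mul]

/-- Composition of two Lie series that are formally inverse to each other. -/
lemma seriesMap_seriesMap {B' : ℝ} {Ψ : ℕ → PhasePoly N → PhasePoly N} (hΦ : IsLieSeries B Φ)
    (hΨ : IsLieSeries B Ψ) (hB : 0 ≤ B) (hBB : B ≤ B')
    (hinv : ∀ n f, n ≠ 0 → ∑ q ∈ antidiagonal n, Ψ q.1 (Φ q.2 f) = 0)
    (hhom : ∀ k n v, (Ψ k (Φ n (X v))).IsHomogeneous (2 * (k + n) + 1))
    (hbound : ∀ k n v, polyNorm (Ψ k (Φ n (X v))) ≤ Real.sqrt 2 * B' ^ (k + n))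
    {z : Phase N p} (hz : B' * ‖z‖ ^ 2 < 1) : seriesMap Φ (seriesMap Ψ z) = z := by
  have hB' : 0 ≤ B' := hB.trans hBB
  have hzB : B * ‖z‖ ^ 2 < 1 := lt_of_le_of_lt (by gcongr) hz
  ext v
  have hsum : Summable fun q : ℕ × ℕ => evalAt z (Ψ q.1 (Φ q.2 (X v))) := by
    have hgeom := summable_geometric_of_lt_one (by positivity) hz
    refine Summable.of_norm_bounded
      ((summable_mul_of_summable_norm hgeom.norm hgeom.norm).mul_left (Real.sqrt 2 * ‖z‖))
      fun q => ?_
    refine (abs_evalAt_le (hhom q.1 q.2 v) z).trans ?_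
    calc polyNorm (Ψ q.1 (Φ q.2 (X v))) * ‖z‖ ^ (2 * (q.1 + q.2) + 1)
        ≤ Real.sqrt 2 * B' ^ (q.1 + q.2) * ‖z‖ ^ (2 * (q.1 + q.2) + 1) := by
          have := hbound q.1 q.2 v
          gcongr
      _ = _ := by rw [← pow_add, mul_pow]; ring
  have h1 : HasSum (fun n => evalAt (seriesMap Ψ z) (Φ n (X v)))
      (∑' q : ℕ × ℕ, evalAt z (Ψ q.1 (Φ q.2 (X v)))) := by
    have h := (Equiv.prodComm ℕ ℕ).hasSum_iff.mpr hsum.hasSum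
    exact h.prod_fiberwise fun n => hΨ.hasSum_evalAt hB hzB (Φ n (X v))
  have h2 := hsum.hasSum.sum_antidiagonal
  have h3 : (fun n => ∑ q ∈ antidiagonal n, evalAt z (Ψ q.1 (Φ q.2 (X v)))) =
      fun n => if n = 0 then z v else 0 := by
    ext n
    split_ifs with hn
    · subst hn
      simp [hΦ.zero, hΨ.zero, evalAt_X]
    · rw [← evalAt_sum, hinv n _ hn]
      simp [evalAt]
  rw [h3] at h2
  rw [seriesMap_apply, h1.tsum_eq, h2.unique (hasSum_ite_eq_zero (z v))]

lemma analyticOnNhd (hΦ : IsLieSeries B Φ) (hB : 0 ≤ B) {ρ : ℝ} (hρ : 0 < ρ)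
    (hBρ : B * ρ ^ 2 ≤ 1) :
    AnalyticOnNhd ℝ (seriesMap Φ : Phase N p → Phase N p) (Metric.ball 0 ρ) := by
  have hcoord : ∀ v : Var N, AnalyticOnNhd ℝ (fun z : Phase N p => seriesMap Φ z v)
      (Metric.ball 0 ρ) := by
    intro v
    refine analyticOnNhd_tsum_evalAt_of_injective (e := fun n => 2 * n + 1)
      (fun a b h => by dsimp only at h; omega) (fun n => hΦ.homogeneous n v) hρ
      (C := Real.sqrt 2 * ρ) fun n => ?_
    calc polyNorm (Φ n (X v)) * ρ ^ (2 * n + 1)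
        ≤ Real.sqrt 2 * B ^ n * ρ ^ (2 * n + 1) := by
          have := hΦ.bound n v
          gcongr
      _ = Real.sqrt 2 * ρ * (B * ρ ^ 2) ^ n := by rw [mul_pow]; ring
      _ ≤ Real.sqrt 2 * ρ := mul_le_of_le_one_right (by positivity)
          (pow_le_one₀ (by positivity) hBρ)
  have hpi := AnalyticOnNhd.pi hcoord
  have := ((PiLp.continuousLinearEquiv p ℝ (fun _ : Var N => ℝ)).symm :
    (Var N → ℝ) →L[ℝ] Phase N p).comp_analyticOnNhd hpi
  exact this

/-- The distance of the transformation from the identity. -/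
lemma norm_seriesMap_sub_le [NeZero N] (hp : p = 2 ∨ p = ⊤) (hΦ : IsLieSeries B Φ) (hB : 0 ≤ B)
    {b c : ℝ} (hb : 0 ≤ b) (hbc : ∀ n v, 1 ≤ n → polyNorm (Φ n (X v)) ≤ c * b ^ n)
    {z : Phase N p} (hz : B * ‖z‖ ^ 2 < 1) (hbz : b * ‖z‖ ^ 2 < 1) :
    ‖seriesMap Φ z - z‖ ≤ c * ‖z‖ * (b * ‖z‖ ^ 2 / (1 - b * ‖z‖ ^ 2)) := by
  have hgeom := (hasSum_geometric_of_lt_one (by positivity) hbz).mul_left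
    (c * ‖z‖ * (b * ‖z‖ ^ 2))
  have hterm : ∀ n : ℕ, ‖(WithLp.toLp p fun v => evalAt z (Φ (n + 1) (X v)) : Phase N p)‖ ≤
      c * ‖z‖ * (b * ‖z‖ ^ 2) * (b * ‖z‖ ^ 2) ^ n := by
    intro n
    refine (norm_toLp_evalAt_le hp (fun v => hΦ.homogeneous (n + 1) v) (fun l v => ?_)
      (fun v => hbc (n + 1) v (by omega)) z).trans_eq (by ring)
    rw [hΦ.shift, shiftBy_eq, rename_X]
  have hsub : seriesMap Φ z - z =
      ∑' n : ℕ, (WithLp.toLp p fun v => evalAt z (Φ (n + 1) (X v)) : Phase N p) := by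
    have hs := (Summable.of_norm_bounded hgeom.summable hterm).hasSum
    ext v
    have h1 := hs.mapL (PiLp.proj p _ v : Phase N p →L[ℝ] ℝ)
    have h2 := (hasSum_nat_add_iff' 1).mpr (hΦ.hasSum_X hB hz v)
    simp only [Finset.sum_range_one, hΦ.zero, evalAt_X] at h2
    exact h2.unique h1
  rw [hsub, ← mul_div_assoc, div_eq_mul_inv]
  exact tsum_of_norm_bounded hgeom hterm

end IsLieSeries

/-! ### Lie series define symplectic maps -/

/-- The fundamental brackets. -/
lemma poisson_X_X {N : ℕ} (v w : Var N) :
    poisson (X v) (X w : PhasePoly N) = C (-Matrix.J (Fin N) ℝ v w) := by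
  classical
  rcases w with j | j
  · rw [poisson_X_inl]
    rcases v with i | i
    · simp [Matrix.J, pderiv_X]
    · rw [pderiv_X, Pi.single_apply, Matrix.J, Matrix.fromBlocks_apply₂₁, Matrix.one_apply]
      by_cases h : i = j <;> simp [h]
  · rw [poisson_X_inr]
    rcases v with i | i
    · rw [pderiv_X, Pi.single_apply, Matrix.J, Matrix.fromBlocks_apply₁₂, Matrix.neg_apply,
        Matrix.one_apply]
      by_cases h : i = j <;> simp [h]
    · simp [Matrix.J, pderiv_X]

lemma symplecticForm_eq {N : ℕ} {p : ENNReal} (u v : Phase N p) :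
    symplecticForm u v = -(u.ofLp ⬝ᵥ (Matrix.J (Fin N) ℝ).mulVec v.ofLp) := by
  simp [symplecticForm, Matrix.J, Matrix.mulVec, dotProduct, Matrix.one_apply, Matrix.neg_apply,
    Finset.sum_sub_distrib]
  ring

/-- The components of the bracket of two rows of a Jacobian matrix. -/
lemma mul_J_mul_transpose_apply {N : ℕ} (A : Matrix (Var N) (Var N) ℝ) (v w : Var N) :
    (A * Matrix.J (Fin N) ℝ * A.transpose) v w =
      -∑ j : Fin N, (A v (Sum.inl j) * A w (Sum.inr j) - A v (Sum.inr j) * A w (Sum.inl j)) := by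
  simp [Matrix.mul_apply, Matrix.J, Matrix.one_apply, Matrix.neg_apply, Finset.sum_sub_distrib]
  ring

namespace IsLieSeries
variable {N : ℕ} {p : ENNReal} [Fact (1 ≤ p)] {B : ℝ}
  {Φ : ℕ → PhasePoly N → PhasePoly N}

/-- The Jacobian matrix of the map defined by a Lie series. -/
noncomputable def _root_.seriesJacobian (Φ : ℕ → PhasePoly N → PhasePoly N) (z : Phase N p) :
    Matrix (Var N) (Var N) ℝ :=
  Matrix.of fun v a => ∑' n, evalAt z (pderiv a (Φ n (X v)))

lemma summable_succ_mul_geometric {y : ℝ} (hy0 : 0 ≤ y) (hy : y < 1) (c : ℝ) :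
    Summable fun n : ℕ => c * ((2 * n + 1 : ℕ) * y ^ n) := by
  have hn : ‖y‖ < 1 := by rwa [Real.norm_of_nonneg hy0]
  have h1 := (summable_pow_mul_geometric_of_norm_lt_one 1 hn).mul_left 2
  have h2 := summable_geometric_of_lt_one hy0 hy
  refine ((h1.add h2).congr fun n => ?_).mul_left c
  push_cast
  ring

variable [NeZero N]

lemma abs_evalAt_pderiv_X_le (hΦ : IsLieSeries B Φ) (z : Phase N p) (n : ℕ) (v a : Var N) :
    |evalAt z (pderiv a (Φ n (X v)))| ≤ 2 * ((2 * n + 1 : ℕ) * (B * ‖z‖ ^ 2) ^ n) := by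
  refine (abs_evalAt_pderiv_le (hΦ.homogeneous n v) a z).trans ?_
  calc Real.sqrt 2 * (2 * n + 1 : ℕ) * polyNorm (Φ n (X v)) * ‖z‖ ^ (2 * n)
      ≤ Real.sqrt 2 * (2 * n + 1 : ℕ) * (Real.sqrt 2 * B ^ n) * ‖z‖ ^ (2 * n) := by
        have := hΦ.bound n v
        gcongr
    _ = (Real.sqrt 2 * Real.sqrt 2) * ((2 * n + 1 : ℕ) * (B * ‖z‖ ^ 2) ^ n) := by
        rw [mul_pow]; ring
    _ = _ := by rw [Real.mul_self_sqrt (by norm_num)]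

lemma hasSum_seriesJacobian (hΦ : IsLieSeries B Φ) (hB : 0 ≤ B) {z : Phase N p}
    (hz : B * ‖z‖ ^ 2 < 1) (v a : Var N) :
    HasSum (fun n => evalAt z (pderiv a (Φ n (X v)))) (seriesJacobian Φ z v a) :=
  (Summable.of_norm_bounded (summable_succ_mul_geometric (by positivity) hz 2)
    fun n => hΦ.abs_evalAt_pderiv_X_le z n v a).hasSum

lemma hasFDerivAt_seriesMap_apply (hΦ : IsLieSeries B Φ) (hB : 0 ≤ B) {ρ : ℝ} (hρ : 0 < ρ)
    (hBρ : B * ρ ^ 2 < 1) {z : Phase N p} (hz : z ∈ Metric.ball (0 : Phase N p) ρ) (v : Var N) :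
    HasFDerivAt (fun z : Phase N p => seriesMap Φ z v)
      (∑ a, seriesJacobian Φ z v a • (PiLp.proj p _ a : Phase N p →L[ℝ] ℝ)) z := by
  have hnorm : ∀ y ∈ Metric.ball (0 : Phase N p) ρ, ‖y‖ ≤ ρ := fun y hy =>
    (mem_ball_zero_iff.mp hy).le
  have hbound : ∀ n, ∀ y ∈ Metric.ball (0 : Phase N p) ρ, ‖evalDeriv (Φ n (X v)) y‖ ≤
      Fintype.card (Var N) * 2 * ((2 * n + 1 : ℕ) * (B * ρ ^ 2) ^ n) := by
    intro n y hy
    refine (norm_evalDeriv_le (hΦ.homogeneous n v) y).trans ?_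
    rw [mul_assoc (Fintype.card (Var N) : ℝ) 2]
    refine mul_le_mul_of_nonneg_left ?_ (by positivity)
    calc Real.sqrt 2 * (2 * n + 1 : ℕ) * polyNorm (Φ n (X v)) * ‖y‖ ^ (2 * n)
        ≤ Real.sqrt 2 * (2 * n + 1 : ℕ) * (Real.sqrt 2 * B ^ n) * ρ ^ (2 * n) := by
          have h1 := hΦ.bound n v
          have h2 := hnorm y hy
          gcongr
      _ = (Real.sqrt 2 * Real.sqrt 2) * ((2 * n + 1 : ℕ) * (B * ρ ^ 2) ^ n) := by
          rw [mul_pow]; ring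
      _ = _ := by rw [Real.mul_self_sqrt (by norm_num)]
  have hsum := summable_succ_mul_geometric (by positivity) hBρ (Fintype.card (Var N) * 2)
  have hzB : B * ‖z‖ ^ 2 < 1 := lt_of_le_of_lt (by have := hnorm z hz; gcongr) hBρ
  have h := hasFDerivAt_tsum_of_isPreconnected hsum Metric.isOpen_ball
    (convex_ball (0 : Phase N p) ρ).isPreconnected
    (fun n y _ => hasFDerivAt_evalAt (Φ n (X v)) y) hbound hz (hΦ.hasSum_X hB hzB v).summable hz
  have heq : ∑' n, evalDeriv (Φ n (X v)) z =
      ∑ a, seriesJacobian Φ z v a • (PiLp.proj p _ a : Phase N p →L[ℝ] ℝ) := by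
    refine HasSum.tsum_eq ?_
    exact hasSum_sum fun a _ => (hΦ.hasSum_seriesJacobian hB hzB v a).smul_const _
  rw [heq] at h
  exact h

lemma fderiv_seriesMap_apply (hΦ : IsLieSeries B Φ) (hB : 0 ≤ B) {ρ : ℝ} (hρ : 0 < ρ)
    (hBρ : B * ρ ^ 2 < 1) {z : Phase N p} (hz : z ∈ Metric.ball (0 : Phase N p) ρ) (u : Phase N p) :
    (fderiv ℝ (seriesMap Φ) z u).ofLp = (seriesJacobian Φ z).mulVec u.ofLp := by
  ext v
  have h1 := (hΦ.analyticOnNhd hB hρ hBρ.le z hz).differentiableAt.hasFDerivAt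
  have h2 := (PiLp.proj p _ v : Phase N p →L[ℝ] ℝ).hasFDerivAt.comp z h1
  have h3 := congrArg (fun L : Phase N p →L[ℝ] ℝ => L u)
    (h2.unique (hΦ.hasFDerivAt_seriesMap_apply hB hρ hBρ hz v))
  simpa [Matrix.mulVec, dotProduct] using h3

/-- The Jacobian matrix of a Lie series is symplectic, because the Lie series preserves the
fundamental brackets. -/
lemma seriesJacobian_mem_symplecticGroup (hΦ : IsLieSeries B Φ) (hB : 0 ≤ B) {z : Phase N p}
    (hz : B * ‖z‖ ^ 2 < 1) : seriesJacobian Φ z ∈ Matrix.symplecticGroup (Fin N) ℝ := by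
  rw [SymplecticGroup.mem_iff]
  ext v w
  rw [mul_J_mul_transpose_apply, neg_eq_iff_eq_neg]
  have hJ := hΦ.hasSum_seriesJacobian hB hz
  have h1 : HasSum (fun n => evalAt z (Φ n (poisson (X v) (X w))))
      (∑ j : Fin N, (seriesJacobian Φ z v (Sum.inl j) * seriesJacobian Φ z w (Sum.inr j) -
        seriesJacobian Φ z v (Sum.inr j) * seriesJacobian Φ z w (Sum.inl j))) := by
    have h := hasSum_sum (s := Finset.univ) fun (j : Fin N) _ =>
      (HasSum.mul_antidiagonal (hJ v (Sum.inl j)) (hJ w (Sum.inr j))).sub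
        (HasSum.mul_antidiagonal (hJ v (Sum.inr j)) (hJ w (Sum.inl j)))
    refine h.congr_fun fun n => ?_
    rw [hΦ.bracket, evalAt_sum]
    simp only [evalAt_poisson, ← Finset.sum_sub_distrib]
    rw [Finset.sum_comm]
  have h2 : ∀ n, evalAt z (Φ n (poisson (X v) (X w))) =
      if n = 0 then -Matrix.J (Fin N) ℝ v w else 0 := by
    intro n
    rw [poisson_X_X]
    split_ifs with hn
    · rw [hn, hΦ.zero, evalAt_C]
    · rw [hΦ.const n _ hn]; simp [evalAt]
  rw [funext h2] at h1
  exact h1.unique (hasSum_ite_eq_zero _)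

/-- A Lie series with a left inverse defines an analytic canonical transformation. -/
lemma isAnalyticCanonicalOn (hΦ : IsLieSeries B Φ) (hB : 0 ≤ B) {ρ : ℝ} (hρ : 0 < ρ)
    (hBρ : B * ρ ^ 2 < 1) {S : Phase N p → Phase N p}
    (hS : ∀ z ∈ Metric.ball (0 : Phase N p) ρ, S (seriesMap Φ z) = z) :
    IsAnalyticCanonicalOn (seriesMap Φ : Phase N p → Phase N p) (Metric.ball 0 ρ) where
  analytic := hΦ.analyticOnNhd hB hρ hBρ.le
  injOn := Set.LeftInvOn.injOn hS
  symplectic := by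
    intro z hz u v
    have hzB : B * ‖z‖ ^ 2 < 1 :=
      lt_of_le_of_lt (by have := (mem_ball_zero_iff.mp hz).le; gcongr) hBρ
    have hA := SymplecticGroup.mem_iff'.mp (hΦ.seriesJacobian_mem_symplecticGroup hB hzB)
    rw [symplecticForm_eq, symplecticForm_eq, hΦ.fderiv_seriesMap_apply hB hρ hBρ hz,
      hΦ.fderiv_seriesMap_apply hB hρ hBρ hz, Matrix.mulVec_mulVec, ← Matrix.vecMul_transpose,
      ← Matrix.dotProduct_mulVec, Matrix.mulVec_mulVec, ← Matrix.mul_assoc, hA]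

end IsLieSeries

/-! ### Bounds for the Lie transform -/

section
variable {N : ℕ}

lemma isSizeBound_polyNorm : IsSizeBound fun l C (f : PhasePoly N) =>
    f.IsHomogeneous (2 * l + 1) ∧ polyNorm f ≤ C where
  zero _ := ⟨isHomogeneous_zero _ _ _, polyNorm_zero.le⟩
  add hf hg := ⟨hf.1.add hg.1, (polyNorm_add_le _ _).trans (add_le_add hf.2 hg.2)⟩
  smul c hf := ⟨(homogeneousSubmodule _ _ _).smul_mem c hf.1,
    (polyNorm_smul c _).trans_le (mul_le_mul_of_nonneg_left hf.2 (abs_nonneg c))⟩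
  mono hf hC := ⟨hf.1, hf.2.trans hC⟩
  nonneg hf := (polyNorm_nonneg _).trans hf.2

lemma size_X (v : Var N) : (X v : PhasePoly N).IsHomogeneous (2 * 0 + 1) ∧
    polyNorm (X v : PhasePoly N) ≤ Real.sqrt 2 := ⟨isHomogeneous_X ℝ v, polyNorm_X_le v⟩

variable [NeZero N]

lemma shiftBy_lieE {𝒳 : ℕ → PhasePoly N} {l : Fin N} (h𝒳 : ∀ j, shiftBy l (𝒳 j) = 𝒳 j) (n : ℕ)
    (f : PhasePoly N) : shiftBy l (lieE 𝒳 n f) = lieE 𝒳 n (shiftBy l f) := by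
  induction n using Nat.strong_induction_on with
  | _ n ih =>
  rcases eq_or_ne n 0 with rfl | hn
  · rw [lieE_zero, lieE_zero]
  rw [lieE_eq 𝒳 hn, lieE_eq 𝒳 hn, shiftBy_eq, map_sum]
  simp only [map_smul, ← shiftBy_eq, shiftBy_poisson, h𝒳]
  exact sum_antidiagonal_smul_congr _ fun q _ hq => by rw [ih q.2 hq]

lemma shiftBy_lieD {𝒳 : ℕ → PhasePoly N} {l : Fin N} (h𝒳 : ∀ j, shiftBy l (𝒳 j) = 𝒳 j) (n : ℕ)
    (f : PhasePoly N) : shiftBy l (lieD 𝒳 n f) = lieD 𝒳 n (shiftBy l f) := by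
  induction n using Nat.strong_induction_on generalizing f with
  | _ n ih =>
  rcases eq_or_ne n 0 with rfl | hn
  · rw [lieD_zero, lieD_zero]
  rw [lieD_eq 𝒳 hn, lieD_eq 𝒳 hn, shiftBy_eq, map_neg, map_sum]
  simp only [map_smul, ← shiftBy_eq]
  rw [sum_antidiagonal_smul_congr _ fun q _ hq => ih q.2 hq _]
  simp only [shiftBy_poisson, h𝒳]

/-- A finite sequence of generating functions whose norms grow at most geometrically. -/
structure GeneratorBound (A : ℝ) (r : ℕ) (χ : ℕ → PhasePoly N) : Prop where
  A_nonneg : 0 ≤ A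
  r_pos : 1 ≤ r
  homogeneous : ∀ j, 1 ≤ j → j ≤ r → (χ j).IsHomogeneous (2 * j + 2)
  bound : ∀ j, 1 ≤ j → j ≤ r → polyNorm (χ j) ≤ A ^ j / (96 * r ^ 2 * j)
  eq_zero : ∀ j, r < j → χ j = 0

namespace GeneratorBound
variable {A : ℝ} {r : ℕ} {χ : ℕ → PhasePoly N}

lemma bracket (h : GeneratorBound A r χ) {j l : ℕ} {c : ℝ} {f : PhasePoly N} (hj : 1 ≤ j)
    (hf : f.IsHomogeneous (2 * l + 1) ∧ polyNorm f ≤ c) :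
    (poisson (oplus (χ j)) f).IsHomogeneous (2 * (l + j) + 1) ∧
      polyNorm (poisson (oplus (χ j)) f) ≤ bracketFactor A r j l * c := by
  by_cases hjr : j ≤ r
  · have hχ := h.homogeneous j hj hjr
    refine ⟨isHomogeneous_poisson (isHomogeneous_oplus hχ) hf.1 (by ring), ?_⟩
    have hA := h.A_nonneg
    have hr : (0 : ℝ) < r := by exact_mod_cast h.r_pos
    have hj0 : (0 : ℝ) < j := by exact_mod_cast hj
    have hb := h.bound j hj hjr
    have h0 := polyNorm_nonneg f
    calc polyNorm (poisson (oplus (χ j)) f)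
        ≤ (2 * j + 2 : ℕ) * (2 * l + 1 : ℕ) * polyNorm (χ j) * polyNorm f :=
          polyNorm_poisson_oplus_le hχ hf.1
      _ ≤ (2 * j + 2 : ℕ) * (9 * (l + 1 : ℕ)) * (A ^ j / (96 * r ^ 2 * j)) * c := by
          have h1 : ((2 * l + 1 : ℕ) : ℝ) ≤ 9 * (l + 1 : ℕ) := by
            exact_mod_cast (by omega : 2 * l + 1 ≤ 9 * (l + 1))
          have h2 := hf.2
          have h3 := polyNorm_nonneg (χ j)
          gcongr
      _ = bracketFactor A r j l * c := by
          rw [bracketFactor, if_pos hjr]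
          push_cast
          field_simp
          ring
  · rw [h.eq_zero j (by omega), oplus_zero, poisson_zero_left, bracketFactor, if_neg hjr, zero_mul]
    exact isSizeBound_polyNorm.zero _

lemma lieE_bound (h : GeneratorBound A r χ) (k : ℕ) {l : ℕ} {c : ℝ} {f : PhasePoly N}
    (hf : f.IsHomogeneous (2 * l + 1) ∧ polyNorm f ≤ c) :
    (lieE (fun j => oplus (χ j)) k f).IsHomogeneous (2 * (l + k) + 1) ∧
      polyNorm (lieE (fun j => oplus (χ j)) k f) ≤ A ^ k * (11 / 8) ^ (l + k) * c := by
  have hA := h.A_nonneg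
  have h1 := isSizeBound_polyNorm.apply_lieE (fun j => oplus (χ j))
    (u := fun k => A ^ k * binomSum (l + k) k) (a := bracketFactor A r)
    (fun j l c f hj hf => h.bracket hj hf) (by simp [binomSum_zero])
    (fun k hk => lieEFactor_recursion hA h.r_pos l k hk) k hf
  refine isSizeBound_polyNorm.mono h1 (mul_le_mul_of_nonneg_right ?_
    (isSizeBound_polyNorm.nonneg hf))
  exact mul_le_mul_of_nonneg_left (binomSum_le_pow _ _) (by positivity)

lemma lieD_bound (h : GeneratorBound A r χ) (k : ℕ) {l : ℕ} {c : ℝ} {f : PhasePoly N}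
    (hf : f.IsHomogeneous (2 * l + 1) ∧ polyNorm f ≤ c) :
    (lieD (fun j => oplus (χ j)) k f).IsHomogeneous (2 * (l + k) + 1) ∧
      polyNorm (lieD (fun j => oplus (χ j)) k f) ≤ A ^ k * (11 / 8) ^ (l + k) * c := by
  have hA := h.A_nonneg
  have h1 := isSizeBound_polyNorm.apply_lieD (fun j => oplus (χ j)) (l₀ := 0) (n := l + k)
    (w := lieDFactor A) (a := bracketFactor A r)
    (fun j l c f hj _ _ hf => h.bracket hj hf) (by simp [lieDFactor])
    (fun k l hk _ _ => lieDFactor_recursion hA h.r_pos k l hk) k l (Nat.zero_le l) le_rfl hf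
  refine isSizeBound_polyNorm.mono h1 (mul_le_mul_of_nonneg_right ?_
    (isSizeBound_polyNorm.nonneg hf))
  exact (lieDFactor_le hA _ _).trans
    (mul_le_mul_of_nonneg_left (binomSum_le_pow _ _) (by positivity))

lemma lieE_X_bound (h : GeneratorBound A r χ) {k : ℕ} (hk : 1 ≤ k) (v : Var N) :
    polyNorm (lieE (fun j => oplus (χ j)) k (X v)) ≤ Real.sqrt 2 * (3 / 5 / r ^ 2) * A ^ k := by
  have h1 := isSizeBound_polyNorm.apply_lieE (fun j => oplus (χ j))
    (u := fun k => if k = 0 then 1 else A ^ k * (3 / 5 / r ^ 2)) (a := bracketFactor A r)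
    (fun j l c f hj hf => h.bracket hj hf) (by simp)
    (fun k hk => lieEFactor_recursion_zero h.A_nonneg h.r_pos k hk) k (size_X v)
  refine h1.2.trans_eq ?_
  rw [if_neg (by omega)]
  ring

lemma isLieSeries_lieE (h : GeneratorBound A r χ) :
    IsLieSeries (11 / 8 * A) (lieE fun j => oplus (χ j)) where
  zero := lieE_zero _
  add := lieE_add _
  const _ c hn := lieE_C _ hn c
  mul := lieE_mul _
  bracket := lieE_poisson _
  shift n l f := shiftBy_lieE (fun j => shiftBy_oplus l (χ j)) n f
  homogeneous n v := by simpa using (h.lieE_bound n (size_X v)).1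
  bound n v := by
    refine (h.lieE_bound n (size_X v)).2.trans_eq ?_
    rw [zero_add, mul_pow]
    ring

lemma isLieSeries_lieD (h : GeneratorBound A r χ) :
    IsLieSeries (11 / 8 * A) (lieD fun j => oplus (χ j)) where
  zero := lieD_zero _
  add := lieD_add _
  const _ c hn := lieD_C _ hn c
  mul := lieD_mul _
  bracket := lieD_poisson _
  shift n l f := shiftBy_lieD (fun j => shiftBy_oplus l (χ j)) n f
  homogeneous n v := by simpa using (h.lieD_bound n (size_X v)).1
  bound n v := by
    refine (h.lieD_bound n (size_X v)).2.trans_eq ?_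
    rw [zero_add, mul_pow]
    ring

lemma composition_factor_le {A : ℝ} (hA : 0 ≤ A) (k n : ℕ) :
    A ^ k * (11 / 8) ^ (n + k) * (A ^ n * (11 / 8) ^ (0 + n) * Real.sqrt 2) ≤
      Real.sqrt 2 * (121 / 64 * A) ^ (k + n) := by
  have h1 : (11 / 8 : ℝ) ^ n ≤ (11 / 8) ^ (k + n) := pow_le_pow_right₀ (by norm_num) (by omega)
  calc A ^ k * (11 / 8) ^ (n + k) * (A ^ n * (11 / 8) ^ (0 + n) * Real.sqrt 2)
      = Real.sqrt 2 * (A ^ (k + n) * (11 / 8) ^ (k + n) * (11 / 8) ^ n) := by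
        rw [zero_add, pow_add A, add_comm n k]; ring
    _ ≤ Real.sqrt 2 * (A ^ (k + n) * (11 / 8) ^ (k + n) * (11 / 8) ^ (k + n)) := by gcongr
    _ = _ := by rw [mul_assoc (A ^ (k + n)), ← mul_pow, ← mul_pow]; norm_num [mul_comm]

variable {p : ENNReal} [Fact (1 ≤ p)]

lemma lieE_lieD (h : GeneratorBound A r χ) {z : Phase N p} (hz : 121 / 64 * A * ‖z‖ ^ 2 < 1) :
    seriesMap (lieE fun j => oplus (χ j)) (seriesMap (lieD fun j => oplus (χ j)) z) = z := by
  have hA := h.A_nonneg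
  refine h.isLieSeries_lieE.seriesMap_seriesMap (B' := 121 / 64 * A) h.isLieSeries_lieD
    (by positivity) (by linarith) (fun n f hn => sum_lieD_lieE _ n hn f)
    (fun k n v => ?_) (fun k n v => ?_) hz
  · have := (h.lieD_bound k (h.lieE_bound n (size_X v))).1
    rwa [show 0 + n + k = k + n by omega] at this
  · have := (h.lieD_bound k (h.lieE_bound n (size_X v))).2
    rw [zero_add n] at this
    refine this.trans ?_
    simpa using composition_factor_le hA k n

lemma lieD_lieE (h : GeneratorBound A r χ) {z : Phase N p} (hz : 121 / 64 * A * ‖z‖ ^ 2 < 1) :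
    seriesMap (lieD fun j => oplus (χ j)) (seriesMap (lieE fun j => oplus (χ j)) z) = z := by
  have hA := h.A_nonneg
  refine h.isLieSeries_lieD.seriesMap_seriesMap (B' := 121 / 64 * A) h.isLieSeries_lieE
    (by positivity) (by linarith) (fun n f hn => sum_lieE_lieD _ n hn f)
    (fun k n v => ?_) (fun k n v => ?_) hz
  · have := (h.lieE_bound k (h.lieD_bound n (size_X v))).1
    rwa [show 0 + n + k = k + n by omega] at this
  · have := (h.lieE_bound k (h.lieD_bound n (size_X v))).2
    rw [zero_add n] at this
    refine this.trans ?_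
    simpa using composition_factor_le hA k n

lemma sqrt_two_le : Real.sqrt 2 ≤ 3 / 2 := by
  rw [Real.sqrt_le_left (by norm_num)]
  norm_num

lemma div_one_sub_le {x q : ℝ} (hx : 0 ≤ x) (hxq : x ≤ q) (hq : q < 1) :
    x / (1 - x) ≤ x / (1 - q) :=
  div_le_div_of_nonneg_left hx (by linarith) (by linarith)

/-- The displacement of the Lie transform, on the larger ball of radius `R`. -/
lemma norm_lieE_sub_le (h : GeneratorBound A r χ) (hp : p = 2 ∨ p = ⊤) {R : ℝ}
    (hAR : A * R ^ 2 ≤ 2 / 9) {z : Phase N p} (hz : ‖z‖ ≤ R) :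
    ‖seriesMap (lieE fun j => oplus (χ j)) z - z‖ ≤ 4 * (A / r ^ 2) * (‖z‖ * R ^ 2) := by
  have hA := h.A_nonneg
  have hr : (1 : ℝ) ≤ r := by exact_mod_cast h.r_pos
  have hle : A * ‖z‖ ^ 2 ≤ A * R ^ 2 := by gcongr
  have h1 := h.isLieSeries_lieE.norm_seriesMap_sub_le hp (by positivity) hA
    (fun n v hn => h.lieE_X_bound hn v) (z := z) (by linarith) (by linarith)
  refine h1.trans ?_
  have h2 : A * ‖z‖ ^ 2 / (1 - A * ‖z‖ ^ 2) ≤ A * R ^ 2 * (9 / 7) :=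
    (div_one_sub_le (by positivity) (hle.trans hAR) (by norm_num)).trans (by
      rw [div_le_iff₀ (by norm_num)]
      linarith)
  calc Real.sqrt 2 * (3 / 5 / (r : ℝ) ^ 2) * ‖z‖ * (A * ‖z‖ ^ 2 / (1 - A * ‖z‖ ^ 2))
      ≤ 3 / 2 * (3 / 5 / (r : ℝ) ^ 2) * ‖z‖ * (A * R ^ 2 * (9 / 7)) := by
        have := sqrt_two_le
        have h3 : 0 ≤ A * ‖z‖ ^ 2 / (1 - A * ‖z‖ ^ 2) :=
          div_nonneg (by positivity) (by linarith)
        gcongr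
    _ = 81 / 70 * (A / r ^ 2) * (‖z‖ * R ^ 2) := by ring
    _ ≤ _ := by gcongr; norm_num

lemma norm_lieE_sub_le_third (h : GeneratorBound A r χ) (hp : p = 2 ∨ p = ⊤) {R : ℝ}
    (hAR : A * R ^ 2 ≤ 2 / 9) {z : Phase N p} (hz : ‖z‖ ≤ 2 / 3 * R) :
    ‖seriesMap (lieE fun j => oplus (χ j)) z - z‖ ≤ R / 3 := by
  have hA := h.A_nonneg
  have hr : (1 : ℝ) ≤ r := by exact_mod_cast h.r_pos
  have hR : 0 ≤ R := by linarith [norm_nonneg z]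
  have hAρ : A * (2 / 3 * R) ^ 2 ≤ 2 / 9 := by nlinarith
  refine (h.norm_lieE_sub_le hp hAρ hz).trans ?_
  have h1 : A / (r : ℝ) ^ 2 ≤ A := div_le_self hA (one_le_pow₀ hr)
  calc 4 * (A / (r : ℝ) ^ 2) * (‖z‖ * (2 / 3 * R) ^ 2)
      ≤ 4 * A * (2 / 3 * R * (2 / 3 * R) ^ 2) := by gcongr
    _ = 32 / 27 * R * (A * R ^ 2) := by ring
    _ ≤ 32 / 27 * R * (2 / 9) := by gcongr
    _ ≤ R / 3 := by linarith

lemma norm_lieD_sub_le_third (h : GeneratorBound A r χ) (hp : p = 2 ∨ p = ⊤) {R : ℝ}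
    (hAR : A * R ^ 2 ≤ 2 / 9) {z : Phase N p} (hz : ‖z‖ ≤ 2 / 3 * R) :
    ‖seriesMap (lieD fun j => oplus (χ j)) z - z‖ ≤ R / 3 := by
  have hA := h.A_nonneg
  have hR : 0 ≤ R := by linarith [norm_nonneg z]
  have hle : 11 / 8 * A * ‖z‖ ^ 2 ≤ 11 / 81 := by
    calc 11 / 8 * A * ‖z‖ ^ 2 ≤ 11 / 8 * A * (2 / 3 * R) ^ 2 := by gcongr
      _ = 11 / 18 * (A * R ^ 2) := by ring
      _ ≤ _ := by linarith
  have h1 := h.isLieSeries_lieD.norm_seriesMap_sub_le hp (by positivity) (by positivity)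
    (fun n v _ => h.isLieSeries_lieD.bound n v) (z := z) (by linarith) (by linarith)
  refine h1.trans ?_
  have h2 : 11 / 8 * A * ‖z‖ ^ 2 / (1 - 11 / 8 * A * ‖z‖ ^ 2) ≤ 11 / 70 :=
    (div_one_sub_le (by positivity) hle (by norm_num)).trans (by
      rw [div_le_iff₀ (by norm_num)]
      linarith)
  calc Real.sqrt 2 * ‖z‖ * (11 / 8 * A * ‖z‖ ^ 2 / (1 - 11 / 8 * A * ‖z‖ ^ 2))
      ≤ 3 / 2 * (2 / 3 * R) * (11 / 70) := by
        have := sqrt_two_le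
        have h3 : 0 ≤ 11 / 8 * A * ‖z‖ ^ 2 / (1 - 11 / 8 * A * ‖z‖ ^ 2) :=
          div_nonneg (by positivity) (by linarith)
        gcongr
    _ ≤ R / 3 := by linarith

end GeneratorBound

end

/-! ### The transformed Hamiltonian -/

section
variable {N : ℕ} [NeZero N] {Ω Cζ Ch σ₀ σ₁ σs Λ γ A : ℝ} {r : ℕ} {ζ₀ h₁ : PhasePoly N}
  {χ ζ h : ℕ → PhasePoly N}

lemma NormalizedTo.generatorBound (R : ConstantRelations Ω Cζ Ch σ₀ σ₁ σs Λ γ A r)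
    (hN : NormalizedTo Ω Ch σ₁ σs γ A r r ζ₀ h₁ χ ζ) : GeneratorBound A r χ where
  A_nonneg := R.A_pos.le
  r_pos := R.r_pos
  homogeneous j hj hjr := (hN.gen j hj hjr).isHomogeneous
  eq_zero j hj := hN.eq_zero j (Or.inr hj)
  bound j hj hjr := by
    have hrate : σs ≤ innerRate σ₁ σs r j := by
      have h1 := le_innerRate R.rate_lt R.r_pos hjr
      have h2 := R.rate_lt
      linarith
    have hA := R.A_pos
    have hr : (0 : ℝ) < r := by exact_mod_cast R.r_pos
    have hj0 : (0 : ℝ) < j := by exact_mod_cast hj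
    refine (((hN.gen j hj hjr).mono le_rfl hrate).polyNorm_le R.rate_pos).trans ?_
    have h1 : A ^ (j - 1) * (Ch / (γ * j)) = A ^ j * Λ / (64 * r ^ 2 * j) := by
      rw [← div_div, R.const_eq]
      obtain ⟨i, rfl⟩ := Nat.exists_eq_add_of_le' hj
      rw [Nat.add_sub_cancel, pow_succ]
      field_simp
      ring
    rw [h1]
    calc A ^ j * Λ / (64 * r ^ 2 * j) / (1 - Real.exp (-σs))
        ≤ A ^ j * (1 / 2) / (64 * r ^ 2 * j) / (3 / 4) := by
          have h2 := R.Λ_le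
          have h3 := R.exp_le
          have h4 := R.Λ_pos
          gcongr
          linarith
      _ = A ^ j / (96 * r ^ 2 * j) := by field_simp; norm_num

lemma polyNorm_oplus_le (f : PhasePoly N) : polyNorm (oplus f) ≤ N * polyNorm f := by
  refine (polyNorm_sum_le _ _).trans_eq ?_
  simp [polyNorm_shiftBy]

variable {p : ENNReal} [Fact (1 ≤ p)]

lemma analyticOnNhd_remainder {C σ ρ : ℝ} (hA : 0 ≤ A) (hσ : 0 < σ) (hρ : 0 < ρ)
    (hh : ∀ s, r < s → DecayingSeed (2 * s + 2) (h s) (C * A ^ (s - 1)) σ)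
    (hAρ : A * ρ ^ 2 ≤ 1) : AnalyticOnNhd ℝ
      (fun z : Phase N p => ∑' s, evalAt z (oplus (h (r + 1 + s)))) (Metric.ball 0 ρ) := by
  have he := exp_lt_one_of_neg hσ
  have hC : 0 ≤ C * A ^ r := by
    obtain ⟨F, hF, _⟩ := hh (r + 1) (by omega)
    simpa using hF.const_nonneg
  refine analyticOnNhd_tsum_evalAt_of_injective (e := fun s => 2 * (r + 1 + s) + 2)
    (fun a b hab => by dsimp only at hab; omega)
    (fun s => isHomogeneous_oplus (hh (r + 1 + s) (by omega)).isHomogeneous) hρ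
    (C := N * (C * A ^ r / (1 - Real.exp (-σ))) * ρ ^ (2 * r + 4)) fun s => ?_
  have h1 := (hh (r + 1 + s) (by omega)).polyNorm_le hσ
  rw [show r + 1 + s - 1 = r + s by omega] at h1
  calc polyNorm (oplus (h (r + 1 + s))) * ρ ^ (2 * (r + 1 + s) + 2)
      ≤ N * (C * A ^ (r + s) / (1 - Real.exp (-σ))) * ρ ^ (2 * (r + 1 + s) + 2) := by
        refine mul_le_mul_of_nonneg_right ((polyNorm_oplus_le _).trans ?_) (by positivity)
        gcongr
    _ = N * (C * A ^ r / (1 - Real.exp (-σ))) * ρ ^ (2 * r + 4) * (A * ρ ^ 2) ^ s := by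
        rw [pow_add A, mul_pow]; ring
    _ ≤ _ := mul_le_of_le_one_right (by positivity) (pow_le_one₀ (by positivity) hAρ)

/-- The transformed Hamiltonian `H ∘ T⁻¹` is the sum of the terms `D_s H_0 + D_{s-1} H_1`. -/
lemma GeneratorBound.hasSum_transformed (hG : GeneratorBound A r χ) {z : Phase N p}
    (hz : 11 / 8 * A * ‖z‖ ^ 2 < 1) {K : ℕ → PhasePoly N} {H₀ H₁ : PhasePoly N} (h0 : K 0 = H₀)
    (hK : ∀ s, 1 ≤ s → K s = lieD (fun j => oplus (χ j)) s H₀ +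
      lieD (fun j => oplus (χ j)) (s - 1) H₁) :
    HasSum (fun s => evalAt z (K s))
      (evalAt (seriesMap (lieD fun j => oplus (χ j)) z) (H₀ + H₁)) := by
  have hA := hG.A_nonneg
  have hsum := fun f => hG.isLieSeries_lieD.hasSum_evalAt (by positivity) hz f
  rw [evalAt_add, ← hasSum_nat_add_iff' 1]
  have h1 := (hasSum_nat_add_iff' 1).mpr (hsum H₀)
  simp only [Finset.sum_range_one, lieD_zero] at h1 ⊢
  rw [h0, add_sub_right_comm]
  refine (h1.add (hsum H₁)).congr_fun fun s => ?_
  rw [hK (s + 1) (by omega), evalAt_add, Nat.add_sub_cancel]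

lemma sum_normalFormTerm : ∑ s ∈ Finset.range (r + 1), normalFormTerm Ω r ζ h s =
    oplus (hOmega N Ω) + ∑ s ∈ Finset.range (r + 1), oplus (ζ s) := by
  simp only [normalFormTerm, Finset.sum_add_distrib, Finset.sum_ite_eq' (Finset.range (r + 1)) 0]
  rw [if_pos (by simp)]
  congr 1
  exact Finset.sum_congr rfl fun s hs => if_pos (by rw [Finset.mem_range] at hs; omega)

lemma normalFormTerm_of_lt {s : ℕ} (hs : r < s) : normalFormTerm Ω r ζ h s = oplus (h s) := by
  rw [normalFormTerm, if_neg (by omega), if_neg (by omega), zero_add]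

lemma normalFormTerm_of_le {s : ℕ} (hs : 1 ≤ s) (hsr : s ≤ r) :
    normalFormTerm Ω r ζ h s = oplus (ζ s) := by
  rw [normalFormTerm, if_neg (by omega), if_pos hsr, zero_add]

lemma normalFormTerm_zero : normalFormTerm Ω r ζ h 0 = oplus (hOmega N Ω) + oplus (ζ 0) := by
  rw [normalFormTerm, if_pos rfl, if_pos (Nat.zero_le r)]

end

/-- The smallness condition on the radius. -/
lemma mul_sq_le_of_sq_lt {A R : ℝ} (hA : 0 < A)
    (hR : R ^ 2 < 2 / (3 * (1 + Real.exp 1) * A)) : A * R ^ 2 ≤ 2 / 9 := by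
  have he : (2 : ℝ) ≤ Real.exp 1 := by linarith [Real.add_one_le_exp (1 : ℝ)]
  have h1 : R ^ 2 * (3 * (1 + Real.exp 1) * A) < 2 := (lt_div_iff₀ (by positivity)).mp hR
  have h2 : A * R ^ 2 * 9 ≤ R ^ 2 * (3 * (1 + Real.exp 1) * A) := by
    have : 0 ≤ A * R ^ 2 := by positivity
    nlinarith
  linarith

theorem theorem1 (N : ℕ) [NeZero N] (Ω μ Cζ Ch σ₁ σs : ℝ) (ζ₀ h₁ : PhasePoly N)
    (hΩ : 0 < Ω) (hμ : 0 < μ)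
    (hσs : max (Real.log 4) (sigmaZero μ / 4) ≤ σs) (hσs₁ : σs < σ₁) (hσ₁ : σ₁ < sigmaZero μ)
    (hζ₀ : IsClassDZero 2 ζ₀ Cζ (sigmaZero μ)) (hh₁ : IsClassD 4 h₁ Ch σ₁)
    (hcomm : poisson (oplus (hOmega N Ω)) (oplus ζ₀) = 0) :
    0 < muStar Ω Cζ μ σ₁ σs ∧
    ∀ r : ℕ, 1 ≤ r → (r : ℝ) < 1 / 2 * (muStar Ω Cζ μ σ₁ σs / μ) →
    ∀ γ Cs Cr : ℝ, γ = gammaConst Ω Cζ μ σ₁ σs r → Cs = CStar Ω Cζ Ch μ σ₁ σs r →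
      Cr = 64 * (r : ℝ) ^ 2 * Cs →
    (Ω < γ ∧ γ < 2 * Ω ∧ 0 < Cs) ∧
    ∃ χ ζ h : ℕ → PhasePoly N,
      -- the generating sequence is finite, and the lowest order normal form term is the given one
      (∀ s, s = 0 ∨ r < s → χ s = 0) ∧ ζ 0 = ζ₀ ∧
      (∀ s, 1 ≤ s → s ≤ r → (χ s).IsHomogeneous (2 * s + 2)) ∧
      (∀ s ≤ r, (ζ s).IsHomogeneous (2 * s + 2)) ∧
      (∀ s, r < s → (h s).IsHomogeneous (2 * s + 2)) ∧
      -- the Lie transform of the normal form is the original Hamiltonian, degree by degree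
      (∀ s, ∑ l ∈ Finset.range (s + 1),
          lieE (fun j => oplus (χ j)) (s - l) (normalFormTerm Ω r ζ h l) = hamTerm Ω ζ₀ h₁ s) ∧
      (∀ s ≤ r, poisson (oplus (hOmega N Ω)) (oplus (ζ s)) = 0) ∧
      -- (i) and (ii)
      (∀ s, 1 ≤ s → s ≤ r →
        IsClassD (2 * s + 2) (χ s) (Cr ^ (s - 1) * (Ch / (γ * s))) (sigmaSeq σ₁ σs r s)) ∧
      (∀ s, 1 ≤ s → s ≤ r →
        IsClassD (2 * s + 2) (ζ s) (Cr ^ (s - 1) * (Ch / s)) (sigmaSeq σ₁ σs r s)) ∧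
      (σs = sigmaZero μ / 4 →
        -- (iv), seeds of the remainder
        (∀ s, r < s →
          IsClassD (2 * s + 2) (h s) (2 * (96 * (r : ℝ) ^ 2 * Cs) ^ (s - 1) * Ch) σs) ∧
        ∀ (p : ENNReal) [Fact (1 ≤ p)], p = 2 ∨ p = ⊤ →
        ∀ R : ℝ, 0 < R → R ^ 2 < 2 / (3 * (1 + Real.exp 1) * Cr) →
        ∃ (T S : Phase N p → Phase N p) (P : Phase N p → ℝ),
          -- (iii): `T` is the transformation defined by the generating sequence, `S` its inverse
          (∀ z ∈ Metric.ball (0 : Phase N p) (2 / 3 * R), ∀ v : Var N,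
            HasSum (fun s => evalAt z (lieE (fun j => oplus (χ j)) s (MvPolynomial.X v))) (T z v) ∧
            HasSum (fun s => evalAt z (lieD (fun j => oplus (χ j)) s (MvPolynomial.X v))) (S z v)) ∧
          IsAnalyticCanonicalOn T (Metric.ball 0 (2 / 3 * R)) ∧
          IsAnalyticCanonicalOn S (Metric.ball 0 (2 / 3 * R)) ∧
          (∀ z ∈ Metric.ball (0 : Phase N p) (2 / 3 * R),
            (T z ∈ Metric.ball (0 : Phase N p) (2 / 3 * R) → S (T z) = z) ∧
            (S z ∈ Metric.ball (0 : Phase N p) (2 / 3 * R) → T (S z) = z)) ∧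
          Metric.ball 0 (R / 3) ⊆ T '' Metric.ball 0 (2 / 3 * R) ∧
          T '' Metric.ball 0 (2 / 3 * R) ⊆ Metric.ball 0 R ∧
          Metric.ball 0 (R / 3) ⊆ S '' Metric.ball 0 (2 / 3 * R) ∧
          S '' Metric.ball 0 (2 / 3 * R) ⊆ Metric.ball 0 R ∧
          (∀ z ∈ Metric.ball (0 : Phase N p) (2 / 3 * R),
            ‖T z - z‖ ≤ 4 ^ 4 * Cs * R ^ 3 ∧ ‖S z - z‖ ≤ 4 ^ 4 * Cs * R ^ 3) ∧
          -- (iv): the remainder is analytic and is the sum of its homogeneous parts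
          AnalyticOnNhd ℝ P (Metric.ball 0 (2 / 3 * R)) ∧
          (∀ z ∈ Metric.ball (0 : Phase N p) (2 / 3 * R),
            HasSum (fun s => evalAt z (oplus (h (r + 1 + s)))) (P z)) ∧
          -- the transformation brings the Hamiltonian to normal form
          (∀ z ∈ Metric.ball (0 : Phase N p) (2 / 3 * R),
            evalAt (S z) (oplus (hOmega N Ω) + oplus ζ₀ + oplus h₁) =
              evalAt z (oplus (hOmega N Ω) + ∑ s ∈ Finset.range (r + 1), oplus (ζ s)) + P z) ∧
          (∀ z ∈ Metric.ball (0 : Phase N p) (2 / 3 * R),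
            T z ∈ Metric.ball (0 : Phase N p) (2 / 3 * R) →
            evalAt z (oplus (hOmega N Ω) + oplus ζ₀ + oplus h₁) =
              evalAt (T z) (oplus (hOmega N Ω) + ∑ s ∈ Finset.range (r + 1), oplus (ζ s))
                + P (T z))) := by
  have hlog : Real.log 4 ≤ σs := (le_max_left _ _).trans hσs
  obtain ⟨Z, hZ, hZ0⟩ := hζ₀
  have hCh : 0 < Ch := by
    obtain ⟨F, hF⟩ := hh₁
    exact hF.C_pos
  obtain ⟨hmu, hconst⟩ := constantRelations hΩ hμ hZ.C_pos hCh hlog hσs₁ hσ₁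
  refine ⟨hmu, fun r hr hrμ γ Cs Cr hγ hCs hCr => ?_⟩
  obtain ⟨hbounds, K⟩ := hconst r hr hrμ
  rw [← hγ, ← hCs] at hbounds
  rw [← hγ, ← hCs, ← hCr] at K
  refine ⟨hbounds, ?_⟩
  have hγ0 := K.γ_pos
  have hA := K.A_pos
  have hσs0 := K.rate_pos
  obtain ⟨χ, ζ', hN⟩ := exists_normalizedTo K hZ.decayingPieces hZ0 hZ.sum hcomm
    hh₁.decayingSeed r le_rfl
  have hrem : ∀ s, ∃ g : PhasePoly N, r < s →
      DecayingSeed (2 * s + 2) g (2 * (3 / 2 * Cr) ^ (s - 1) * Ch) σs ∧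
      oplus g = lieD (fun j => oplus (χ j)) s (oplus (hOmega N Ω) + oplus ζ₀) +
        lieD (fun j => oplus (χ j)) (s - 1) (oplus h₁) := by
    intro s
    by_cases hs : r < s
    · obtain ⟨g, hg⟩ := hN.hasSeed_remainder K hh₁.decayingSeed hs
      exact ⟨g, fun _ => hg⟩
    · exact ⟨0, fun h => absurd h hs⟩
  choose h hh using hrem
  set ζ : ℕ → PhasePoly N := Function.update ζ' 0 ζ₀ with hζ
  have hζ0 : ζ 0 = ζ₀ := Function.update_self ..
  have hζs : ∀ s, 1 ≤ s → ζ s = ζ' s := fun s hs => Function.update_of_ne (by omega) _ _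
  have hK0 : normalFormTerm Ω r ζ h 0 = oplus (hOmega N Ω) + oplus ζ₀ := by
    rw [normalFormTerm_zero, hζ0]
  have hKs : ∀ s, 1 ≤ s → normalFormTerm Ω r ζ h s =
      lieD (fun j => oplus (χ j)) s (oplus (hOmega N Ω) + oplus ζ₀) +
        lieD (fun j => oplus (χ j)) (s - 1) (oplus h₁) := by
    intro s hs
    rcases Nat.lt_or_ge r s with hrs | hrs
    · rw [normalFormTerm_of_lt hrs, (hh s hrs).2]
    · rw [normalFormTerm_of_le hs hrs, hζs s hs, hN.eq s hs hrs]
  have hrate : ∀ s ≤ r, 0 < sigmaSeq σ₁ σs r s := fun s hs =>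
    hσs0.trans_le (le_sigmaSeq hσs₁ hr hs)
  refine ⟨χ, ζ, h, hN.eq_zero, hζ0, fun s hs hsr => (hN.gen s hs hsr).isHomogeneous,
    fun s hsr => ?_, fun s hs => (hh s hs).1.isHomogeneous,
    sum_lieE_eq_hamTerm _ _ hK0 hKs, fun s hsr => ?_, fun s hs hsr => ?_, fun s hs hsr => ?_,
    fun _ => ⟨fun s hs => ?_, ?_⟩⟩
  · rcases Nat.eq_zero_or_pos s with rfl | hs
    · rw [hζ0]
      exact CoeffSum.isHomogeneous hZ.sum hZ.homogeneous
    · rw [hζs s hs]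
      exact (hN.normal s hs hsr).isHomogeneous
  · rcases Nat.eq_zero_or_pos s with rfl | hs
    · rw [hζ0, hcomm]
    · rw [hζs s hs, hN.comm s hs hsr]
  · have hs0 : (0 : ℝ) < s := by exact_mod_cast hs
    exact ((hN.gen s hs hsr).mono le_rfl (sigmaSeq_le_innerRate hσs₁ hs)).isClassD
      (by positivity) (hrate s hsr)
  · have hs0 : (0 : ℝ) < s := by exact_mod_cast hs
    rw [hζs s hs]
    exact ((hN.normal s hs hsr).mono le_rfl (sigmaSeq_le_innerRate hσs₁ hs)).isClassD
      (by positivity) (hrate s hsr)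
  · have hconst' : 96 * (r : ℝ) ^ 2 * Cs = 3 / 2 * Cr := by rw [hCr]; ring
    rw [hconst']
    exact (hh s hs).1.isClassD (by positivity) hσs0
  intro p _ hp R hR0 hR
  have hAR := mul_sq_le_of_sq_lt hA hR
  have hG := hN.generatorBound K
  have hEseries := hG.isLieSeries_lieE
  have hDseries := hG.isLieSeries_lieD
  set T : Phase N p → Phase N p := seriesMap (lieE fun j => oplus (χ j)) with hT
  set S : Phase N p → Phase N p := seriesMap (lieD fun j => oplus (χ j)) with hS
  have hρ : 0 < 2 / 3 * R := by positivity
  have hball : ∀ z ∈ Metric.ball (0 : Phase N p) (2 / 3 * R), ‖z‖ < 2 / 3 * R := fun z hz =>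
    mem_ball_zero_iff.mp hz
  have hsmall : ∀ z : Phase N p, ‖z‖ < R → Cr * ‖z‖ ^ 2 ≤ 2 / 9 := fun z hz =>
    (mul_le_mul_of_nonneg_left (pow_le_pow_left₀ (norm_nonneg z) hz.le 2) hA.le).trans hAR
  have hTS : ∀ z : Phase N p, ‖z‖ < R → T (S z) = z := fun z hz =>
    hG.lieE_lieD (by nlinarith [hsmall z hz])
  have hST : ∀ z : Phase N p, ‖z‖ < R → S (T z) = z := fun z hz =>
    hG.lieD_lieE (by nlinarith [hsmall z hz])
  have hconv : ∀ z ∈ Metric.ball (0 : Phase N p) (2 / 3 * R), 11 / 8 * Cr * ‖z‖ ^ 2 < 1 :=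
    fun z hz => by nlinarith [hsmall z (by linarith [hball z hz])]
  have hconvρ : 11 / 8 * Cr * (2 / 3 * R) ^ 2 < 1 := by nlinarith
  have hTd : ∀ z : Phase N p, ‖z‖ ≤ 2 / 3 * R → ‖T z - z‖ ≤ R / 3 := fun z hz =>
    hG.norm_lieE_sub_le_third hp hAR hz
  have hSd : ∀ z : Phase N p, ‖z‖ ≤ 2 / 3 * R → ‖S z - z‖ ≤ R / 3 := fun z hz =>
    hG.norm_lieD_sub_le_third hp hAR hz
  have hshift : ∀ F : Phase N p → Phase N p, (∀ z : Phase N p, ‖z‖ ≤ 2 / 3 * R →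
      ‖F z - z‖ ≤ R / 3) → ∀ z : Phase N p, ‖z‖ ≤ 2 / 3 * R → ‖F z‖ ≤ ‖z‖ + R / 3 := by
    intro F hF z hz
    have := norm_add_le (F z - z) z
    rw [sub_add_cancel] at this
    linarith [hF z hz]
  have hTn : ∀ z : Phase N p, ‖z‖ ≤ R → ‖T z - z‖ ≤ 4 ^ 4 * Cs * R ^ 3 := by
    intro z hz
    refine (hG.norm_lieE_sub_le hp hAR hz).trans ?_
    have hr0 : (0 : ℝ) < r := by exact_mod_cast hr
    have hCs0 := hbounds.2.2
    calc 4 * (Cr / (r : ℝ) ^ 2) * (‖z‖ * R ^ 2) = 4 ^ 4 * Cs * (‖z‖ * R ^ 2) := by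
          rw [hCr]; field_simp; norm_num
      _ ≤ 4 ^ 4 * Cs * (R * R ^ 2) := by gcongr
      _ = _ := by ring
  have hHS : ∀ z ∈ Metric.ball (0 : Phase N p) (2 / 3 * R),
      HasSum (fun s => evalAt z (oplus (h (r + 1 + s))))
        (evalAt (S z) (oplus (hOmega N Ω) + oplus ζ₀ + oplus h₁) -
          evalAt z (oplus (hOmega N Ω) + ∑ s ∈ Finset.range (r + 1), oplus (ζ s))) := by
    intro z hz
    have h1 := (hasSum_nat_add_iff' (r + 1)).mpr (hG.hasSum_transformed (hconv z hz) hK0 hKs)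
    rw [← evalAt_sum, sum_normalFormTerm] at h1
    refine h1.congr_fun fun s => ?_
    rw [normalFormTerm_of_lt (by omega), add_comm s]
  have hPS : ∀ z ∈ Metric.ball (0 : Phase N p) (2 / 3 * R),
      evalAt (S z) (oplus (hOmega N Ω) + oplus ζ₀ + oplus h₁) =
        evalAt z (oplus (hOmega N Ω) + ∑ s ∈ Finset.range (r + 1), oplus (ζ s)) +
          ∑' s, evalAt z (oplus (h (r + 1 + s))) := by
    intro z hz
    rw [(hHS z hz).tsum_eq]
    ring
  have hlt : ∀ z ∈ Metric.ball (0 : Phase N p) (2 / 3 * R), ‖z‖ < R := fun z hz => by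
    linarith [hball z hz]
  refine ⟨T, S, fun z => ∑' s, evalAt z (oplus (h (r + 1 + s))), fun z hz v =>
    ⟨hEseries.hasSum_X (by positivity) (hconv z hz) v,
      hDseries.hasSum_X (by positivity) (hconv z hz) v⟩,
    hEseries.isAnalyticCanonicalOn (by positivity) hρ hconvρ fun z hz => hST z (hlt z hz),
    hDseries.isAnalyticCanonicalOn (by positivity) hρ hconvρ fun z hz => hTS z (hlt z hz),
    fun z hz => ⟨fun _ => hST z (hlt z hz), fun _ => hTS z (hlt z hz)⟩,
    fun w hw => ?_, ?_, fun w hw => ?_, ?_, fun z hz => ⟨hTn z (hlt z hz).le, ?_⟩, ?_,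
    fun z hz => ?_, hPS, fun z hz hTz => ?_⟩
  · have hw' := mem_ball_zero_iff.mp hw
    refine ⟨S w, mem_ball_zero_iff.mpr ?_, hTS w (by linarith)⟩
    linarith [hshift S hSd w (by linarith)]
  · rintro _ ⟨z, hz, rfl⟩
    rw [mem_ball_zero_iff]
    linarith [hshift T hTd z (hball z hz).le, hball z hz]
  · have hw' := mem_ball_zero_iff.mp hw
    refine ⟨T w, mem_ball_zero_iff.mpr ?_, hST w (by linarith)⟩
    linarith [hshift T hTd w (by linarith)]
  · rintro _ ⟨z, hz, rfl⟩
    rw [mem_ball_zero_iff]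
    linarith [hshift S hSd z (hball z hz).le, hball z hz]
  · -- the displacement of the inverse at `z` is that of `T` at `S z`, which lies in `B_R`
    have hSz : ‖S z‖ ≤ R := by linarith [hshift S hSd z (hball z hz).le, hball z hz]
    have h1 := hTn (S z) hSz
    rwa [hTS z (hlt z hz), norm_sub_rev] at h1
  · refine analyticOnNhd_remainder (A := 3 / 2 * Cr) (C := 2 * Ch) (by positivity) hσs0 hρ
      (fun s hs => ?_) (by nlinarith)
    rw [mul_right_comm]
    exact (hh s hs).1
  · exact (hHS z hz).summable.hasSum
  · rw [← hPS (T z) hTz, hST z (hlt z hz)]
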